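/- Let $M(c)=(M^{2n+1},\phi,\xi,\eta,g)$, $n\ge 2$, be a Sasakian space form of constant $\phi$-sectional curvature $c\neq 1$: the almost contact metric structure is a contact metric structure ($d\eta(X,Y)=g(X,\phi Y)$, with $2\,d\eta(X,Y)=X\eta(Y)-Y\eta(X)-\eta([X,Y])$), it is normal ($N_\phi=-2\,d\eta\otimes\xi$), and every plane spanned by $u$ and $\phi u$ with $u\perp\xi$, $|u|=1$, has sectional curvature $c$. Let $\nabla$ be the Levi-Civita connection. Let $I\subset\mathbb R$ be an open interval and $\gamma:I\to M(c)$ a smooth unit speed Legendre curve ($\eta(\gamma')=0$) which is a Frenet curve of osculating order $r\ge 2$: there are smooth orthonormal vector fields $E_1=T=\gamma',E_2,\dots,E_r$ along $\gamma$ and smooth functions $k_1,\dots,k_{r-1}\ge 0$ on $I$ with $\nabla_TE_i=-k_{i-1}E_{i-1}+k_iE_{i+1}$ for $1\le i\le r$, where the term with $E_0$ and the term with $E_{r+1}$ are omitted. Assume that the function $g(\phi T,E_2)$ is not identically $0$, not identically $1$ and not identically $-1$ on $I$. Let $\delta_1,\delta_2\in\mathbb R$, $\delta_2\ne 0$. The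 curve $\gamma$ is called interpolating sesqui-harmonic if it is a critical point of $$E_{\delta_1,\delta_2}(\gamma)=\delta_1\int_a^b|\gamma'|^2\,dt+\delta_2\int_a^b|\nabla_{\gamma'}\gamma'|^2\,dt$$ for every compact interval $[a,b]\subset I$, with respect to all smooth variations of $\gamma$ supported in $[a,b]$. (1) If $c\le -3$ and $\delta_1/\delta_2\ge 0$, then $\gamma$ is interpolating sesqui-harmonic if and only if it is a geodesic. (2) If $c>-3$ and $\delta_1/\delta_2<0$, and $\gamma$ is not a geodesic (which is automatic if $k_1>0$), then $\gamma$ is interpolating sesqui-harmonic if and only if $r\ge 4$ and there is a constant $\alpha_0\in(0,2\pi)\setminus\{\frac{\pi}{2},\pi,\frac{3\pi}{2}\}$ with $$c+3+3(c-1)\cos^2\alpha_0-\frac{4\delta_1}{\delta_2}>0,\qquad 3(c-1)\sin 2\alpha_0<0,$$ such that $\phi T=\cos\alpha_0\,E_2+\sin\alpha_0\,E_4$ along $\gamma$, the functions $k_1,k_2,k_3$ are positive constants, and $$k_1^2+k_2^2=\frac{c+3}{4}+\frac{3(c-1)}{4}\cos^2\alpha_0-\frac{\delta_1}{\delta_2},\qquad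 k_2k_3=-\frac{3(c-1)}{8}\sin 2\alpha_0 .$$ -/

import Mathlib

open Bundle Manifold Set VectorField
open scoped ContDiff Topology

noncomputable section

namespace SesquiHarmonic

variable {E : Type*} [NormedAddCommGroup E] [NormedSpace ℝ E] [FiniteDimensional ℝ E]
  {H : Type*} [TopologicalSpace H] {I : ModelWithCorners ℝ E H}
  {M : Type*} [TopologicalSpace M] [ChartedSpace H M] [IsManifold I ∞ M]

/-! ### Vector fields, curves and fields along curves -/

/-- The vector field `X` is smooth at `x` (so in a neighbourhood of `x`). -/
def SmoothFieldAt (X : Π x : M, TangentSpace I x) (x : M) : Prop :=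
  ContMDiffAt I I.tangent ∞ (fun y => (⟨y, X y⟩ : TangentBundle I M)) x

/-- The vector field `V` along the curve `γ` is smooth on `J`. -/
def SmoothAlongOn (γ : ℝ → M) (V : Π t : ℝ, TangentSpace I (γ t)) (J : Set ℝ) : Prop :=
  ContMDiffOn 𝓘(ℝ, ℝ) I.tangent ∞ (fun t => (⟨γ t, V t⟩ : TangentBundle I M)) J

variable (I) in
/-- The velocity `γ'(t)`. -/
def velocity (γ : ℝ → M) (t : ℝ) : TangentSpace I (γ t) :=
  mfderiv 𝓘(ℝ, ℝ) I γ t (1 : ℝ)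

/-- The covariant derivative `(∇_{γ'} V)(t₀)` of a vector field `V` along `γ`. In the trivialization
of `TM` at `γ t₀`, with its frame `(e_i)`, write `V = ∑ vⁱ (e_i ∘ γ)`; the value is
`∑ (vⁱ)'(t₀) e_i + ∑ vⁱ(t₀) ∇_{γ'(t₀)} e_i`. The second sum is the covariant derivative of
the field `∑ vⁱ(t₀) e_i`, which is `FiberBundle.extend E (V t₀)`. -/
def covDerivAlong (cov : CovariantDerivative I E (TangentSpace I : M → Type _)) (γ : ℝ → M)
    (V : Π t : ℝ, TangentSpace I (γ t)) (t₀ : ℝ) : TangentSpace I (γ t₀) :=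
  (trivializationAt E (TangentSpace I : M → Type _) (γ t₀)).symm (γ t₀)
      (deriv (fun t : ℝ =>
        (trivializationAt E (TangentSpace I : M → Type _) (γ t₀) ⟨γ t, V t⟩).2) t₀)
    + cov (FiberBundle.extend E (V t₀)) (γ t₀) (velocity I γ t₀)

/-- The tension field `τ(γ) = ∇_{γ'} γ'` of a curve (for the metric `dt²` on the line). -/
def tension (cov : CovariantDerivative I E (TangentSpace I : M → Type _)) (γ : ℝ → M) (t : ℝ) :
    TangentSpace I (γ t) :=
  covDerivAlong cov γ (velocity I γ) t

/-- `γ` is a geodesic on `J`. -/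
def IsGeodesicOn (cov : CovariantDerivative I E (TangentSpace I : M → Type _)) (γ : ℝ → M)
    (J : Set ℝ) : Prop :=
  ∀ t ∈ J, tension cov γ t = 0

/-- The curvature tensor `R(u,v)w = ∇_X∇_Y Z - ∇_Y∇_X Z - ∇_{[X,Y]} Z` at `x`, where
`X, Y, Z` are the local extensions of `u, v, w` that are constant in the trivialization at `x`. -/
def curvature (cov : CovariantDerivative I E (TangentSpace I : M → Type _)) (x : M)
    (u v w : TangentSpace I x) : TangentSpace I x :=
  let X : Π y : M, TangentSpace I y := FiberBundle.extend E u
  let Y : Π y : M, TangentSpace I y := FiberBundle.extend E v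
  let Z : Π y : M, TangentSpace I y := FiberBundle.extend E w
  cov (fun y => cov Z y (Y y)) x u - cov (fun y => cov Z y (X y)) x v
    - cov Z x (mlieBracket I X Y x)

variable (I) in
/-- `Γ` (with `Γ s` defined for `|s| < ε`) is a smooth variation of the curve `γ` on `J` which
is supported in `[a, b]`. -/
structure IsVariation (J : Set ℝ) (γ : ℝ → M) (a b ε : ℝ) (Γ : ℝ → ℝ → M) : Prop where
  smooth : ContMDiffOn 𝓘(ℝ, ℝ × ℝ) I ∞ (fun p : ℝ × ℝ => Γ p.1 p.2) (Ioo (-ε) ε ×ˢ J)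
  initial : ∀ t ∈ J, Γ 0 t = γ t
  support : ∀ s ∈ Ioo (-ε) ε, ∀ t ∈ J, t ∉ Icc a b → Γ s t = γ t

variable [RiemannianBundle (fun x : M => TangentSpace I x)]

/-- `cov` is the Levi-Civita connection of the Riemannian metric: it is torsion-free, and
`u⟨X, Y⟩ = ⟨∇_u X, Y⟩ + ⟨X, ∇_u Y⟩` for all differentiable vector fields `X`, `Y`. -/
structure IsLeviCivita (cov : CovariantDerivative I E (TangentSpace I : M → Type _)) : Prop where
  torsion_free : cov.torsion = 0
  metric : ∀ (X Y : Π x : M, TangentSpace I x) (x : M) (u : TangentSpace I x),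
    MDifferentiableAt I I.tangent (fun y => (⟨y, X y⟩ : TangentBundle I M)) x →
    MDifferentiableAt I I.tangent (fun y => (⟨y, Y y⟩ : TangentBundle I M)) x →
      mvfderiv I (fun y => (inner ℝ (X y) (Y y) : ℝ)) x u
        = inner ℝ (cov X x u) (Y x) + inner ℝ (X x) (cov Y x u)

/-! ### Interpolating sesqui-harmonic curves -/

/-- The energy `δ₁ ∫ ‖γ'‖² + δ₂ ∫ ‖τ(γ)‖²` over `[a, b]`. -/
def interpolatingEnergy (cov : CovariantDerivative I E (TangentSpace I : M → Type _))
    (δ₁ δ₂ : ℝ) (a b : ℝ) (γ : ℝ → M) : ℝ :=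
  δ₁ * (∫ t in a..b, ‖velocity I γ t‖ ^ 2) + δ₂ * (∫ t in a..b, ‖tension cov γ t‖ ^ 2)

/-- `γ`, defined on the open interval `J`, is interpolating sesqui-harmonic: it is a critical point
of the energy on every compact interval, with respect to all variations supported there. -/
def IsInterpolatingSesquiHarmonic (cov : CovariantDerivative I E (TangentSpace I : M → Type _))
    (δ₁ δ₂ : ℝ) (J : Set ℝ) (γ : ℝ → M) : Prop :=
  ∀ a b : ℝ, a < b → Icc a b ⊆ J → ∀ ε : ℝ, 0 < ε → ∀ Γ : ℝ → ℝ → M,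
    IsVariation I J γ a b ε Γ →
      HasDerivAt (fun s : ℝ => interpolatingEnergy cov δ₁ δ₂ a b (Γ s)) 0 0

/-! ### Sasakian space forms -/

variable (I M) in
/-- An almost contact metric structure `(φ, ξ, η, g)`, where `g` is the given Riemannian metric. -/
structure AlmostContactMetric where
  φ : Π x : M, TangentSpace I x →L[ℝ] TangentSpace I x
  ξ : Π x : M, TangentSpace I x
  η : Π x : M, TangentSpace I x →L[ℝ] ℝ
  smooth_φ : ContMDiff I (I.prod 𝓘(ℝ, E →L[ℝ] E)) ∞
    (fun x => TotalSpace.mk' (E →L[ℝ] E)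
      (E := fun x : M => TangentSpace I x →L[ℝ] TangentSpace I x) x (φ x))
  smooth_ξ : ∀ x, SmoothFieldAt ξ x
  smooth_η : ContMDiff I (I.prod 𝓘(ℝ, E →L[ℝ] ℝ)) ∞
    (fun x => TotalSpace.mk' (E →L[ℝ] ℝ) (E := fun x : M => TangentSpace I x →L[ℝ] ℝ) x (η x))
  φ_φ : ∀ x (u : TangentSpace I x), φ x (φ x u) = -u + η x u • ξ x
  η_ξ : ∀ x, η x (ξ x) = 1
  metric_φ : ∀ x (u v : TangentSpace I x),
    inner ℝ (φ x u) (φ x v) = inner ℝ u v - η x u * η x v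

/-- The exterior derivative of a one-form, with the convention
`2 dη(X,Y) = X(η(Y)) - Y(η(X)) - η([X,Y])` of contact metric geometry. -/
def extDerivOneForm (η : Π x : M, TangentSpace I x →L[ℝ] ℝ) (X Y : Π x : M, TangentSpace I x)
    (x : M) : ℝ :=
  (1 / 2) * (mvfderiv I (fun y => η y (Y y)) x (X x) - mvfderiv I (fun y => η y (X y)) x (Y x)
    - η x (mlieBracket I X Y x))

/-- The Nijenhuis tensor `φ²[X,Y] + [φX,φY] - φ[φX,Y] - φ[X,φY]`. -/
def nijenhuis (φ : Π x : M, TangentSpace I x →L[ℝ] TangentSpace I x)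
    (X Y : Π x : M, TangentSpace I x) (x : M) : TangentSpace I x :=
  φ x (φ x (mlieBracket I X Y x)) + mlieBracket I (fun y => φ y (X y)) (fun y => φ y (Y y)) x
    - φ x (mlieBracket I (fun y => φ y (X y)) Y x) - φ x (mlieBracket I X (fun y => φ y (Y y)) x)

/-- A Sasakian structure: a contact metric structure (`dη(X,Y) = g(X,φY)`) which is normal
(`N_φ = -2 dη ⊗ ξ`). -/
structure AlmostContactMetric.IsSasakian (S : AlmostContactMetric I M) : Prop where
  contact : ∀ (X Y : Π x : M, TangentSpace I x) (x : M), SmoothFieldAt X x → SmoothFieldAt Y x →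
    extDerivOneForm S.η X Y x = inner ℝ (X x) (S.φ x (Y x))
  normal : ∀ (X Y : Π x : M, TangentSpace I x) (x : M), SmoothFieldAt X x → SmoothFieldAt Y x →
    nijenhuis S.φ X Y x = (-2 * extDerivOneForm S.η X Y x) • S.ξ x

/-- A Sasakian space form `M(c)`: the sectional curvature of every plane spanned by `u` and `φu`,
with `u` a unit vector orthogonal to `ξ`, is `c`. -/
structure AlmostContactMetric.IsSasakianSpaceForm (S : AlmostContactMetric I M)
    (cov : CovariantDerivative I E (TangentSpace I : M → Type _)) (c : ℝ) : Prop where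
  sasakian : S.IsSasakian
  phi_sectional : ∀ (x : M) (u : TangentSpace I x), S.η x u = 0 → ‖u‖ = 1 →
    inner ℝ (curvature cov x u (S.φ x u) (S.φ x u)) u = c

/-- `γ` is a Legendre curve on `J`: its tangent vectors are annihilated by `η`. -/
def AlmostContactMetric.IsLegendreOn (S : AlmostContactMetric I M) (γ : ℝ → M) (J : Set ℝ) :
    Prop :=
  ∀ t ∈ J, S.η (γ t) (velocity I γ t) = 0

/-! ### Frenet curves -/

/-- `γ` is a smooth unit speed Frenet curve on `J` of osculating order `r`, with Frenet frame
`F 1 = γ', F 2, …, F r` and curvatures `k 1, …, k (r - 1) ≥ 0`; the values `F i` for `i ∉ [1, r]` and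
`k i` for `i ∉ [1, r - 1]` are irrelevant. -/
structure IsFrenetCurveOn (cov : CovariantDerivative I E (TangentSpace I : M → Type _))
    (J : Set ℝ) (γ : ℝ → M) (r : ℕ) (F : ℕ → Π t : ℝ, TangentSpace I (γ t)) (k : ℕ → ℝ → ℝ) :
    Prop where
  smooth : ContMDiffOn 𝓘(ℝ, ℝ) I ∞ γ J
  order_pos : 1 ≤ r
  smooth_frame : ∀ i ∈ Icc 1 r, SmoothAlongOn γ (F i) J
  smooth_curvature : ∀ i ∈ Ico 1 r, ContDiffOn ℝ ∞ (k i) J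
  curvature_nonneg : ∀ i ∈ Ico 1 r, ∀ t ∈ J, 0 ≤ k i t
  frame_one : ∀ t ∈ J, F 1 t = velocity I γ t
  orthonormal : ∀ t ∈ J, ∀ i ∈ Icc 1 r, ∀ j ∈ Icc 1 r,
    inner ℝ (F i t) (F j t) = if i = j then (1 : ℝ) else 0
  frenet : ∀ t ∈ J, ∀ i ∈ Icc 1 r,
    covDerivAlong cov γ (F i) t =
      (if i = 1 then 0 else -(k (i - 1) t • F (i - 1) t))
        + (if i = r then 0 else k i t • F (i + 1) t)

end SesquiHarmonic

end

/-! Write T for the velocity, τ = ∇_T T, and f = g(φT, E₂). Two integrations by parts turn the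
derivative of the energy along a compactly supported variation with field V into 2 ∫ ⟨V, δ₂(∇_T∇_T τ
+ R(τ,T)T) − δ₁τ⟩ (`hasDerivAt_interpolatingEnergy`). Bump-function variations inside a chart then
show that a curve is critical exactly when this Euler-Lagrange field vanishes
(`isInterpolatingSesquiHarmonic_iff`).

For a Legendre curve T and τ are orthogonal to ξ, and the curvature of the space form gives R(τ,T)T
= k₁((c+3)/4 E₂ + 3(c−1)/4 f φT). The T-component of the equation is k₁k₁' = 0, so k₁ is constant.
If it is not zero, division by δ₂k₁ leaves ((c+3)/4 − δ₁/δ₂ − k₁² − k₂²) E₂ + k₂' E₃ + k₂k₃ E₄ +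
3(c−1)/4 f φT = 0. The E₂-component expresses k₁² + k₂² through f², and the E₃-component is k₂' =
−3(c−1)/4 f g(φT,E₃). The Sasakian identities give f' = k₂ g(φT,E₃). Differentiating the first
relation and inserting the other two gives ff' = −ff', so f² is constant, and hence so are f and k₂.
As f ≠ 0, the vector equation can be solved for φT, which lies in the span of E₂ and E₄. From |φT| =
1 and f² ≠ 1 it follows that E₄ exists and that k₂, k₃ do not vanish; the coefficients of φT are the
cosine and sine of the angle (`structure_of_eulerLagrange`). When c ≤ −3 and δ₁/δ₂ ≥ 0 the formula
for k₁² + k₂² has a nonpositive right side, so only geodesics remain. The converse is a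
substitution.

The geometric input is proved in charts, where the connection becomes the Christoffel symbols of the
metric. Pointwise linear algebra gives ∇ξ = −φ and (∇_uφ)w = g(u,w)ξ − η(w)u
(`structure_equations`). The space form curvature then comes from a uniqueness argument: its
difference from the model tensor is of Kähler type, transverse to ξ, and has zero holomorphic
sectional curvature, so the Jacobi operators vanish (`eq_zero_of_holomorphic`). -/

noncomputable section

set_option linter.unusedSectionVars false
set_option maxSynthPendingDepth 3

namespace SesquiHarmonic

/-! ### Tangent vectors and vector fields in a chart -/

variable {E : Type*} [NormedAddCommGroup E] [NormedSpace ℝ E]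
  {M : Type*} [TopologicalSpace M] [ChartedSpace E M] [IsManifold 𝓘(ℝ, E) ∞ M]

/-- The coordinates at `y` in the trivialization of the tangent bundle at `x₀`. -/
def toCoord (x₀ y : M) : TangentSpace 𝓘(ℝ, E) y →L[ℝ] E :=
  (trivializationAt E (TangentSpace 𝓘(ℝ, E) : M → Type _) x₀).continuousLinearMapAt ℝ y

/-- The tangent vector at `y` with given coordinates in the trivialization at `x₀`. -/
def ofCoord (x₀ y : M) : E →L[ℝ] TangentSpace 𝓘(ℝ, E) y :=
  (trivializationAt E (TangentSpace 𝓘(ℝ, E) : M → Type _) x₀).symmL ℝ y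

variable {x₀ y : M}

lemma toCoord_eq_trivializationAt (hy : y ∈ (chartAt E x₀).source) (v : TangentSpace 𝓘(ℝ, E) y) :
    toCoord x₀ y v = (trivializationAt E (TangentSpace 𝓘(ℝ, E) : M → Type _) x₀ ⟨y, v⟩).2 := by
  have : y ∈ (trivializationAt E (TangentSpace 𝓘(ℝ, E) : M → Type _) x₀).baseSet := hy
  rw [toCoord, Trivialization.continuousLinearMapAt_apply,
    Trivialization.coe_linearMapAt_of_mem _ this]

lemma ofCoord_eq_symm (hy : y ∈ (chartAt E x₀).source) (w : E) :
    ofCoord x₀ y w = (trivializationAt E (TangentSpace 𝓘(ℝ, E) : M → Type _) x₀).symm y w := by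
  rw [ofCoord, Trivialization.symmL_apply _ (by exact hy)]

@[simp] lemma toCoord_ofCoord (hy : y ∈ (chartAt E x₀).source) (w : E) :
    toCoord x₀ y (ofCoord x₀ y w) = w :=
  Trivialization.continuousLinearMapAt_symmL _ (by exact hy) w

@[simp] lemma ofCoord_toCoord (hy : y ∈ (chartAt E x₀).source) (v : TangentSpace 𝓘(ℝ, E) y) :
    ofCoord x₀ y (toCoord x₀ y v) = v :=
  Trivialization.symmL_continuousLinearMapAt _ (by exact hy) v

lemma toCoord_eq_mfderiv (hy : y ∈ (chartAt E x₀).source) :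
    toCoord x₀ y = mfderiv 𝓘(ℝ, E) 𝓘(ℝ, E) (chartAt E x₀) y := by
  have := TangentBundle.continuousLinearMapAt_trivializationAt (I := 𝓘(ℝ, E)) hy
  rw [toCoord, this]
  congr 1

lemma mdifferentiableAt_chart (hy : y ∈ (chartAt E x₀).source) :
    MDifferentiableAt 𝓘(ℝ, E) 𝓘(ℝ, E) (chartAt E x₀) y :=
  ((contMDiffOn_chart (n := ∞) (I := 𝓘(ℝ, E)) (x := x₀)).contMDiffAt
    ((chartAt E x₀).open_source.mem_nhds hy)).mdifferentiableAt (by simp)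

lemma toCoord_velocity {γ : ℝ → M} {t : ℝ} (ht : γ t ∈ (chartAt E x₀).source)
    (hγ : MDifferentiableAt 𝓘(ℝ, ℝ) 𝓘(ℝ, E) γ t) :
    toCoord x₀ (γ t) (velocity 𝓘(ℝ, E) γ t) = deriv (fun s => chartAt E x₀ (γ s)) t := by
  rw [toCoord_eq_mfderiv ht, velocity, ← fderiv_apply_one_eq_deriv, ← mfderiv_eq_fderiv]
  rw [show (fun s => chartAt E x₀ (γ s)) = chartAt E x₀ ∘ γ from rfl,
    mfderiv_comp t (mdifferentiableAt_chart ht) hγ]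
  rfl

/-- The representation of a vector field in the chart at `x₀`. -/
def fieldRep (x₀ : M) (X : Π x : M, TangentSpace 𝓘(ℝ, E) x) (p : E) : E :=
  toCoord x₀ ((chartAt E x₀).symm p) (X ((chartAt E x₀).symm p))

lemma chart_symm_chart (hy : y ∈ (chartAt E x₀).source) :
    (chartAt E x₀).symm (chartAt E x₀ y) = y := (chartAt E x₀).left_inv hy

lemma chart_mem_target (hy : y ∈ (chartAt E x₀).source) :
    chartAt E x₀ y ∈ (chartAt E x₀).target := (chartAt E x₀).map_source hy

lemma contMDiffAt_chart_symm {p : E} (hp : p ∈ (chartAt E x₀).target) :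
    ContMDiffAt 𝓘(ℝ, E) 𝓘(ℝ, E) ∞ (chartAt E x₀).symm p :=
  (contMDiffOn_chart_symm (n := ∞) (I := 𝓘(ℝ, E)) (x := x₀)).contMDiffAt
    ((chartAt E x₀).open_target.mem_nhds hp)

lemma contMDiffAt_chart (hy : y ∈ (chartAt E x₀).source) :
    ContMDiffAt 𝓘(ℝ, E) 𝓘(ℝ, E) ∞ (chartAt E x₀) y :=
  (contMDiffOn_chart (n := ∞) (I := 𝓘(ℝ, E)) (x := x₀)).contMDiffAt
    ((chartAt E x₀).open_source.mem_nhds hy)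

variable {F : Type*} [NormedAddCommGroup F] [NormedSpace ℝ F]

lemma eventually_chart_symm_chart (hy : y ∈ (chartAt E x₀).source) :
    ∀ᶠ z in 𝓝 y, (chartAt E x₀).symm (chartAt E x₀ z) = z :=
  Filter.eventually_of_mem ((chartAt E x₀).open_source.mem_nhds hy) fun _ hz => chart_symm_chart hz

lemma contMDiffAt_iff_chart {n : WithTop ℕ∞} (hn : n ≤ ∞) {f : M → F}
    (hy : y ∈ (chartAt E x₀).source) :
    ContMDiffAt 𝓘(ℝ, E) 𝓘(ℝ, F) n f y ↔
      ContDiffAt ℝ n (fun p => f ((chartAt E x₀).symm p)) (chartAt E x₀ y) := by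
  rw [← contMDiffAt_iff_contDiffAt]
  constructor
  · intro h
    rw [← chart_symm_chart hy] at h
    exact h.comp _ ((contMDiffAt_chart_symm (chart_mem_target hy)).of_le hn)
  · intro h
    refine (h.comp y ((contMDiffAt_chart hy).of_le hn)).congr_of_eventuallyEq ?_
    filter_upwards [eventually_chart_symm_chart hy] with z hz
    simp [hz]

lemma mdifferentiableAt_iff_chart {f : M → F} (hy : y ∈ (chartAt E x₀).source) :
    MDifferentiableAt 𝓘(ℝ, E) 𝓘(ℝ, F) f y ↔
      DifferentiableAt ℝ (fun p => f ((chartAt E x₀).symm p)) (chartAt E x₀ y) := by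
  rw [← mdifferentiableAt_iff_differentiableAt]
  constructor
  · intro h
    rw [← chart_symm_chart hy] at h
    exact h.comp _ ((contMDiffAt_chart_symm (chart_mem_target hy)).mdifferentiableAt (by simp))
  · intro h
    refine (h.comp y (mdifferentiableAt_chart hy)).congr_of_eventuallyEq ?_
    filter_upwards [eventually_chart_symm_chart hy] with z hz
    simp [hz]

lemma mvfderiv_eq_fderiv {f : M → F} (hy : y ∈ (chartAt E x₀).source)
    (hf : MDifferentiableAt 𝓘(ℝ, E) 𝓘(ℝ, F) f y) (v : TangentSpace 𝓘(ℝ, E) y) :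
    mvfderiv 𝓘(ℝ, E) f y v =
      fderiv ℝ (fun p => f ((chartAt E x₀).symm p)) (chartAt E x₀ y) (toCoord x₀ y v) := by
  have h1 : f =ᶠ[𝓝 y] (fun p => f ((chartAt E x₀).symm p)) ∘ (chartAt E x₀) := by
    filter_upwards [eventually_chart_symm_chart hy] with z hz
    simp [hz]
  have h2 : mfderiv 𝓘(ℝ, E) 𝓘(ℝ, F) f y v = mfderiv 𝓘(ℝ, E) 𝓘(ℝ, F)
      ((fun p => f ((chartAt E x₀).symm p)) ∘ (chartAt E x₀)) y v := by
    rw [h1.mfderiv_eq]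
    rfl
  have h3 := mfderiv_comp y (mdifferentiableAt_iff_differentiableAt.mpr
    ((mdifferentiableAt_iff_chart hy).mp hf)) (mdifferentiableAt_chart hy)
  rw [h3] at h2
  rw [toCoord_eq_mfderiv hy, ← mfderiv_eq_fderiv]
  exact h2

lemma contMDiffAt_field_iff {n : WithTop ℕ∞} (hn : n ≤ ∞) {X : Π x : M, TangentSpace 𝓘(ℝ, E) x}
    (hy : y ∈ (chartAt E x₀).source) :
    ContMDiffAt 𝓘(ℝ, E) 𝓘(ℝ, E).tangent n (fun y => (⟨y, X y⟩ : TangentBundle 𝓘(ℝ, E) M)) y ↔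
      ContDiffAt ℝ n (fieldRep x₀ X) (chartAt E x₀ y) := by
  have : ContMDiffVectorBundle n E (TangentSpace 𝓘(ℝ, E) : M → Type _) 𝓘(ℝ, E) :=
    ContMDiffVectorBundle.of_le hn
  rw [Trivialization.contMDiffAt_section_iff (IB := 𝓘(ℝ, E)) (e := trivializationAt E
    (TangentSpace 𝓘(ℝ, E) : M → Type _) x₀) (x₀ := y) (by exact hy), contMDiffAt_iff_chart hn hy]
  have h : (fun p => (trivializationAt E (TangentSpace 𝓘(ℝ, E) : M → Type _) x₀
      ⟨(chartAt E x₀).symm p, X ((chartAt E x₀).symm p)⟩).2) =ᶠ[𝓝 (chartAt E x₀ y)]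
      fieldRep x₀ X := by
    filter_upwards [(chartAt E x₀).open_target.mem_nhds (chart_mem_target hy)] with p hp
    rw [fieldRep, toCoord_eq_trivializationAt ((chartAt E x₀).map_target hp)]
  exact ⟨fun h' => h'.congr_of_eventuallyEq h.symm, fun h' => h'.congr_of_eventuallyEq h⟩

lemma mdifferentiableAt_field_iff {X : Π x : M, TangentSpace 𝓘(ℝ, E) x}
    (hy : y ∈ (chartAt E x₀).source) :
    MDifferentiableAt 𝓘(ℝ, E) 𝓘(ℝ, E).tangent
      (fun y => (⟨y, X y⟩ : TangentBundle 𝓘(ℝ, E) M)) y ↔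
      DifferentiableAt ℝ (fieldRep x₀ X) (chartAt E x₀ y) := by
  rw [Trivialization.mdifferentiableAt_section_iff (IB := 𝓘(ℝ, E)) (trivializationAt E
    (TangentSpace 𝓘(ℝ, E) : M → Type _) x₀) X (b₀ := y) (by exact hy),
    mdifferentiableAt_iff_chart hy]
  refine Filter.EventuallyEq.differentiableAt_iff ?_
  filter_upwards [(chartAt E x₀).open_target.mem_nhds (chart_mem_target hy)] with p hp
  rw [fieldRep, toCoord_eq_trivializationAt ((chartAt E x₀).map_target hp)]

/-- The vector field with constant coordinates `w` in the chart at `x₀`. -/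
def constField (x₀ : M) (w : E) (y : M) : TangentSpace 𝓘(ℝ, E) y := ofCoord x₀ y w

/-- Both are defined by the trivialization at `x`. This ties the extensions used in `covDerivAlong`
and `curvature` to coordinate fields, so that both become computable in a chart. -/
lemma extend_eq_constField {x : M} (v : TangentSpace 𝓘(ℝ, E) x)
    (hy : y ∈ (chartAt E x).source) :
    FiberBundle.extend E v y = constField x (toCoord x x v) y := by
  rw [constField, ofCoord_eq_symm hy, toCoord_eq_trivializationAt (mem_chart_source E x)]
  rfl

lemma fieldRep_constField {p : E} (hp : p ∈ (chartAt E x₀).target) (w : E) :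
    fieldRep x₀ (constField x₀ w) p = w :=
  toCoord_ofCoord ((chartAt E x₀).map_target hp) w

lemma fieldRep_constField_eventuallyEq (hy : y ∈ (chartAt E x₀).source) (w : E) :
    fieldRep x₀ (constField x₀ w) =ᶠ[𝓝 (chartAt E x₀ y)] fun _ => w := by
  filter_upwards [(chartAt E x₀).open_target.mem_nhds (chart_mem_target hy)] with p hp
  exact fieldRep_constField hp w

lemma fieldRep_chart (hy : y ∈ (chartAt E x₀).source) (X : Π x : M, TangentSpace 𝓘(ℝ, E) x) :
    fieldRep x₀ X (chartAt E x₀ y) = toCoord x₀ y (X y) := by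
  rw [fieldRep, chart_symm_chart hy]

lemma mdifferentiableAt_constField (hy : y ∈ (chartAt E x₀).source) (w : E) :
    MDifferentiableAt 𝓘(ℝ, E) 𝓘(ℝ, E).tangent
      (fun y => (⟨y, constField x₀ w y⟩ : TangentBundle 𝓘(ℝ, E) M)) y :=
  (mdifferentiableAt_field_iff hy).mpr
    ((differentiableAt_const w).congr_of_eventuallyEq (fieldRep_constField_eventuallyEq hy w))

variable [FiniteDimensional ℝ E]
  (cov : CovariantDerivative 𝓘(ℝ, E) E (TangentSpace 𝓘(ℝ, E) : M → Type _))

/-- In the chart at `x₀`, a covariant derivative is the directional derivative plus a term which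
depends only on the value of the field. -/
lemma toCoord_cov (hy : y ∈ (chartAt E x₀).source) {X : Π x : M, TangentSpace 𝓘(ℝ, E) x}
    (hX : MDifferentiableAt 𝓘(ℝ, E) 𝓘(ℝ, E).tangent
      (fun y => (⟨y, X y⟩ : TangentBundle 𝓘(ℝ, E) M)) y) (v : TangentSpace 𝓘(ℝ, E) y) :
    toCoord x₀ y (cov X y v) = fderiv ℝ (fieldRep x₀ X) (chartAt E x₀ y) (toCoord x₀ y v)
      + toCoord x₀ y (cov (constField x₀ (toCoord x₀ y (X y))) y v) := by
  -- `cov` and the coordinate derivative obey the same Leibniz rule, so their difference is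
  -- tensorial. Its value at `y` is therefore unchanged when `X` is replaced by the constant field
  -- with the same value there.
  have key : TensorialAt 𝓘(ℝ, E) E (fun X : Π x : M, TangentSpace 𝓘(ℝ, E) x =>
      toCoord x₀ y (cov X y v) - fderiv ℝ (fieldRep x₀ X) (chartAt E x₀ y) (toCoord x₀ y v)) y := by
    constructor
    · intro f σ hf hσ
      have h1 : fieldRep x₀ (f • σ) = fun p => f ((chartAt E x₀).symm p) • fieldRep x₀ σ p := by
        funext p
        simp [fieldRep]
      rw [cov.isCovariantDerivativeOnUniv.leibniz hσ hf, h1, fderiv_fun_smul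
        ((mdifferentiableAt_iff_chart hy).mp hf) ((mdifferentiableAt_field_iff hy).mp hσ)]
      simp [mvfderiv_eq_fderiv hy hf, chart_symm_chart hy, fieldRep_chart hy, smul_sub]
    · intro σ σ' hσ hσ'
      have h1 : fieldRep x₀ (σ + σ') = fun p => fieldRep x₀ σ p + fieldRep x₀ σ' p := by
        funext p
        simp [fieldRep]
      rw [cov.isCovariantDerivativeOnUniv.add hσ hσ', h1, fderiv_fun_add
        ((mdifferentiableAt_field_iff hy).mp hσ) ((mdifferentiableAt_field_iff hy).mp hσ')]
      simp only [add_apply, map_add]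
      abel
  have := key.pointwise hX (mdifferentiableAt_constField hy (toCoord x₀ y (X y)))
    (by simp [constField, ofCoord_toCoord hy])
  rw [(fieldRep_constField_eventuallyEq hy _).fderiv_eq] at this
  simp only [fderiv_fun_const, Pi.zero_apply, zero_apply, sub_zero] at this
  rw [← this]
  abel

end SesquiHarmonic

namespace SesquiHarmonic

/-! ### The Levi-Civita connection in a chart -/

section Christoffel

variable {E : Type*} [NormedAddCommGroup E] [NormedSpace ℝ E]

/-- The right hand side of the Koszul formula for the metric `G` on an open subset of a vector
space. -/
def koszul (G : E → E →L[ℝ] E →L[ℝ] ℝ) (p : E) : E →L[ℝ] E →L[ℝ] E →L[ℝ] ℝ :=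
  (1 / 2 : ℝ) • (fderiv ℝ G p + (fderiv ℝ G p).flip
    - ((ContinuousLinearMap.flipₗᵢ ℝ E E ℝ).toContinuousLinearEquiv.toContinuousLinearMap ∘L
      (fderiv ℝ G p).flip))

/-- The Christoffel symbols of the metric `G`. -/
def christoffel (G : E → E →L[ℝ] E →L[ℝ] ℝ) (p : E) : E →L[ℝ] E →L[ℝ] E :=
  ContinuousLinearMap.compL ℝ E (E →L[ℝ] ℝ) E (G p).inverse ∘L koszul G p

lemma koszul_apply (G : E → E →L[ℝ] E →L[ℝ] ℝ) (p u w z : E) :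
    koszul G p u w z =
      1 / 2 * (fderiv ℝ G p u w z + fderiv ℝ G p w u z - fderiv ℝ G p z u w) := by
  simp [koszul]

lemma metric_christoffel {G : E → E →L[ℝ] E →L[ℝ] ℝ} {p : E} (hG : (G p).IsInvertible) (u w z : E) :
    G p (christoffel G p u w) z =
      1 / 2 * (fderiv ℝ G p u w z + fderiv ℝ G p w u z - fderiv ℝ G p z u w) := by
  rw [← koszul_apply, christoffel]
  simp [hG.self_apply_inverse]

set_option synthInstance.maxHeartbeats 200000 in
lemma contDiffAt_christoffel [CompleteSpace E] {G : E → E →L[ℝ] E →L[ℝ] ℝ} {p : E}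
    (hG : ContDiffAt ℝ ∞ G p)
    (hp : (G p).IsInvertible) : ContDiffAt ℝ ∞ (christoffel G) p := by
  have h1 : ContDiffAt ℝ ∞ (fun p => (G p).inverse) p :=
    hp.contDiffAt_map_inverse.comp p hG
  have h2 : ContDiffAt ℝ ∞ (fderiv ℝ G) p := hG.fderiv_right (by simp)
  have h3 : ContDiffAt ℝ ∞ (fun p => (fderiv ℝ G p).flip) p :=
    ((ContinuousLinearMap.flipₗᵢ ℝ E E (E →L[ℝ] ℝ)).toContinuousLinearEquiv.contDiff.contDiffAt).comp p h2
  have h4 : ContDiffAt ℝ ∞ (fun p => ((ContinuousLinearMap.flipₗᵢ ℝ E E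
      ℝ).toContinuousLinearEquiv.toContinuousLinearMap ∘L (fderiv ℝ G p).flip)) p :=
    contDiffAt_const.clm_comp h3
  have h5 : ContDiffAt ℝ ∞ (koszul G) p := ((h2.add h3).sub h4).const_smul _
  have h6 : ContDiffAt ℝ ∞ (fun p => ContinuousLinearMap.compL ℝ E (E →L[ℝ] ℝ) E (G p).inverse) p :=
    (ContinuousLinearMap.compL ℝ E (E →L[ℝ] ℝ) E).contDiff.contDiffAt.comp p h1
  exact h6.clm_comp h5

end Christoffel

variable {E : Type*} [NormedAddCommGroup E] [NormedSpace ℝ E] [FiniteDimensional ℝ E]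
  {M : Type*} [TopologicalSpace M] [ChartedSpace E M] [IsManifold 𝓘(ℝ, E) ∞ M]
  [RiemannianBundle (fun x : M => TangentSpace 𝓘(ℝ, E) x)]
  {x₀ y : M}

/-- The metric in the chart at `x₀`. -/
def metricRep (x₀ : M) (p : E) : E →L[ℝ] E →L[ℝ] ℝ :=
  ((RiemannianBundle.g (E := fun x : M => TangentSpace 𝓘(ℝ, E) x)).inner
    ((chartAt E x₀).symm p)).bilinearComp (ofCoord x₀ ((chartAt E x₀).symm p))
      (ofCoord x₀ ((chartAt E x₀).symm p))

lemma metricRep_apply (x₀ : M) (p u w : E) : metricRep x₀ p u w =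
    inner ℝ (constField x₀ u ((chartAt E x₀).symm p)) (constField x₀ w ((chartAt E x₀).symm p)) :=
  rfl

lemma metricRep_chart (hy : y ∈ (chartAt E x₀).source) (u w : TangentSpace 𝓘(ℝ, E) y) :
    metricRep x₀ (chartAt E x₀ y) (toCoord x₀ y u) (toCoord x₀ y w) = inner ℝ u w := by
  rw [metricRep_apply, chart_symm_chart hy, constField, constField, ofCoord_toCoord hy,
    ofCoord_toCoord hy]

lemma metricRep_comm (x₀ : M) (p u w : E) : metricRep x₀ p u w = metricRep x₀ p w u := by
  rw [metricRep_apply, metricRep_apply, real_inner_comm]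

lemma metricRep_pos {p : E} (hp : p ∈ (chartAt E x₀).target) {u : E} (hu : u ≠ 0) :
    0 < metricRep x₀ p u u := by
  rw [metricRep_apply]
  refine real_inner_self_pos.mpr fun h => hu ?_
  rw [← toCoord_ofCoord ((chartAt E x₀).map_target hp) u]
  change toCoord x₀ _ (constField x₀ u _) = 0
  rw [h, map_zero]

/-- Positive definiteness makes the map to the dual injective, and in finite dimension the two
spaces have equal dimension. -/
lemma isInvertible_metricRep {p : E} (hp : p ∈ (chartAt E x₀).target) :
    (metricRep x₀ p).IsInvertible := by
  have hinj : Function.Injective (metricRep x₀ p : E →ₗ[ℝ] (E →L[ℝ] ℝ)) := by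
    rw [← LinearMap.ker_eq_bot, LinearMap.ker_eq_bot']
    intro u hu
    by_contra h
    have := metricRep_pos hp h
    have h' : metricRep x₀ p u = 0 := hu
    simp [h'] at this
  have hdim : Module.finrank ℝ E = Module.finrank ℝ (E →L[ℝ] ℝ) := by
    rw [← (LinearMap.toContinuousLinearMap (𝕜 := ℝ) (E := E) (F' := ℝ)).finrank_eq]
    exact (Subspace.dual_finrank_eq (K := ℝ) (V := E)).symm
  refine ⟨(LinearMap.linearEquivOfInjective _ hinj hdim).toContinuousLinearEquiv, ?_⟩
  ext u w
  rfl

variable [IsContMDiffRiemannianBundle 𝓘(ℝ, E) ∞ E (fun x : M => TangentSpace 𝓘(ℝ, E) x)]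

lemma contMDiffAt_constField (hy : y ∈ (chartAt E x₀).source) (w : E) :
    ContMDiffAt 𝓘(ℝ, E) 𝓘(ℝ, E).tangent ∞
      (fun y => (⟨y, constField x₀ w y⟩ : TangentBundle 𝓘(ℝ, E) M)) y :=
  (contMDiffAt_field_iff le_rfl hy).mpr
    (contDiffAt_const.congr_of_eventuallyEq (fieldRep_constField_eventuallyEq hy w))

lemma contMDiffAt_inner_constField (hy : y ∈ (chartAt E x₀).source) (u w : E) :
    ContMDiffAt 𝓘(ℝ, E) 𝓘(ℝ, ℝ) ∞
      (fun y => (inner ℝ (constField x₀ u y) (constField x₀ w y) : ℝ)) y :=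
  ContMDiffAt.inner_bundle (F := E) (E := fun x : M => TangentSpace 𝓘(ℝ, E) x)
    (contMDiffAt_constField hy u) (contMDiffAt_constField hy w)

lemma contDiffOn_metricRep (x₀ : M) :
    ContDiffOn ℝ ∞ (metricRep (E := E) x₀) (chartAt E x₀).target := by
  rw [contDiffOn_clm_apply]
  intro u
  rw [contDiffOn_clm_apply]
  intro w p hp
  have hy := (chartAt E x₀).map_target hp
  have h := (contMDiffAt_iff_chart le_rfl hy).mp
    (contMDiffAt_inner_constField hy u w)
  rw [(chartAt E x₀).right_inv hp] at h
  exact h.contDiffWithinAt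

lemma contDiffAt_metricRep {p : E} (hp : p ∈ (chartAt E x₀).target) :
    ContDiffAt ℝ ∞ (metricRep (E := E) x₀) p :=
  (contDiffOn_metricRep x₀).contDiffAt ((chartAt E x₀).open_target.mem_nhds hp)

/-- The Christoffel symbols of the metric in the chart at `x₀`. -/
def chris (x₀ : M) (p : E) : E →L[ℝ] E →L[ℝ] E := christoffel (metricRep x₀) p

lemma contDiffAt_chris {p : E} (hp : p ∈ (chartAt E x₀).target) :
    ContDiffAt ℝ ∞ (chris (E := E) x₀) p :=
  contDiffAt_christoffel (contDiffAt_metricRep hp) (isInvertible_metricRep hp)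

/-- The constant vector field on a vector space. -/
def constVec (u : E) : Π x : E, TangentSpace 𝓘(ℝ, E) x := fun _ => u

/-- Near `y` these are pullbacks under the chart of constant fields on `E`. Brackets are natural
under pullback, and constant fields commute. -/
lemma mlieBracket_constField (hy : y ∈ (chartAt E x₀).source) (u w : E) :
    mlieBracket 𝓘(ℝ, E) (constField x₀ u) (constField x₀ w) y = 0 := by
  have : IsManifold 𝓘(ℝ, E) (minSmoothness ℝ 2) M := by
    rw [minSmoothness_of_isRCLikeNormedField]
    infer_instance
  have hc : ∀ u : E, (constField x₀ u : Π y : M, TangentSpace 𝓘(ℝ, E) y) =ᶠ[𝓝 y]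
      mpullback 𝓘(ℝ, E) 𝓘(ℝ, E) (chartAt E x₀) (constVec u) := by
    intro u
    filter_upwards [(chartAt E x₀).open_source.mem_nhds hy] with z hz
    change @Eq (TangentSpace 𝓘(ℝ, E) z) _ _
    rw [mpullback_apply, ← toCoord_eq_mfderiv hz]
    have : (toCoord x₀ z).IsInvertible :=
      ContinuousLinearMap.IsInvertible.of_inverse (g := ofCoord x₀ z)
        (ContinuousLinearMap.ext fun v => toCoord_ofCoord hz v)
        (ContinuousLinearMap.ext fun v => ofCoord_toCoord hz v)
    exact (this.inverse_apply_eq.mpr (toCoord_ofCoord hz u).symm).symm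
  rw [Filter.EventuallyEq.mlieBracket_vectorField_eq (hc u) (hc w), ← mpullback_mlieBracket
    (n := ∞) _ _ (contMDiffAt_chart hy)
    (by rw [minSmoothness_of_isRCLikeNormedField]; exact ENat.LEInfty.out)]
  · have : mlieBracket 𝓘(ℝ, E) (constVec u) (constVec w) (chartAt E x₀ y) = 0 := by
      rw [← mlieBracketWithin_univ, mlieBracketWithin_eq_lieBracketWithin]
      change fderivWithin ℝ (fun _ => w) univ _ u - fderivWithin ℝ (fun _ => u) univ _ w = 0
      simp
    rw [mpullback_apply, this, map_zero]
  · exact (contMDiffAt_vectorSpace_iff_contDiffAt.mpr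
      (contDiffAt_const (c := u))).mdifferentiableAt (n := ∞) (by simp)
  · exact (contMDiffAt_vectorSpace_iff_contDiffAt.mpr
      (contDiffAt_const (c := w))).mdifferentiableAt (n := ∞) (by simp)

variable {cov : CovariantDerivative 𝓘(ℝ, E) E (TangentSpace 𝓘(ℝ, E) : M → Type _)}

/-- The uniqueness half of the fundamental theorem of Riemannian geometry. Coordinate fields
commute, so zero torsion makes the connection coefficients symmetric; with metric compatibility, the
Koszul formula then determines them. -/
lemma toCoord_cov_constField (hcov : IsLeviCivita cov) (hy : y ∈ (chartAt E x₀).source)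
    (v : TangentSpace 𝓘(ℝ, E) y) (w : E) :
    toCoord x₀ y (cov (constField x₀ w) y v) =
      chris x₀ (chartAt E x₀ y) (toCoord x₀ y v) w := by
  have key : ∀ v w : E, toCoord x₀ y (cov (constField x₀ w) y (ofCoord x₀ y v)) =
      chris x₀ (chartAt E x₀ y) v w := by
    have hsymm : ∀ v w : E, toCoord x₀ y (cov (constField x₀ w) y (ofCoord x₀ y v)) =
        toCoord x₀ y (cov (constField x₀ v) y (ofCoord x₀ y w)) := by
      intro v w
      have h := cov.torsion_eq_zero_iff.mp hcov.torsion_free (mdifferentiableAt_constField hy v)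
        (mdifferentiableAt_constField hy w)
      rw [mlieBracket_constField hy, sub_eq_zero] at h
      exact congrArg _ h
    have hmet : ∀ v w z : E, fderiv ℝ (metricRep (E := E) x₀) (chartAt E x₀ y) v w z =
        metricRep x₀ (chartAt E x₀ y) (toCoord x₀ y (cov (constField x₀ w) y (ofCoord x₀ y v))) z +
        metricRep x₀ (chartAt E x₀ y) w
          (toCoord x₀ y (cov (constField x₀ z) y (ofCoord x₀ y v))) := by
      intro v w z
      have hG := (contDiffAt_metricRep (E := E) (chart_mem_target hy)).differentiableAt (by simp)
      have h := hcov.metric (constField x₀ w) (constField x₀ z) y (ofCoord x₀ y v)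
        (mdifferentiableAt_constField hy w) (mdifferentiableAt_constField hy z)
      rw [mvfderiv_eq_fderiv hy ((contMDiffAt_inner_constField hy w
        z).mdifferentiableAt (by simp)), toCoord_ofCoord hy] at h
      have e1 : ∀ z, z = toCoord x₀ y (constField x₀ z y) := fun z => (toCoord_ofCoord hy z).symm
      conv_rhs => enter [1, 2]; rw [e1 z]
      conv_rhs => enter [2, 1, 2]; rw [e1 w]
      rw [metricRep_chart hy, metricRep_chart hy, ← h]
      change _ = fderiv ℝ (fun p => metricRep x₀ p w z) (chartAt E x₀ y) v
      rw [fderiv_clm_apply (hG.clm_apply (differentiableAt_const w)) (differentiableAt_const z),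
        fderiv_clm_apply hG (differentiableAt_const w)]
      simp
    intro v w
    have hinv := isInvertible_metricRep (E := E) (chart_mem_target hy)
    refine hinv.injective ?_
    ext z
    rw [chris, metric_christoffel hinv, hmet, hmet, hmet, hsymm w v, hsymm z v, hsymm z w,
      metricRep_comm x₀ _ v, metricRep_comm x₀ _ w]
    ring
  rw [← key, ofCoord_toCoord hy]

lemma toCoord_cov' (hcov : IsLeviCivita cov) (hy : y ∈ (chartAt E x₀).source)
    {X : Π x : M, TangentSpace 𝓘(ℝ, E) x} (hX : MDifferentiableAt 𝓘(ℝ, E) 𝓘(ℝ, E).tangent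
      (fun y => (⟨y, X y⟩ : TangentBundle 𝓘(ℝ, E) M)) y) (v : TangentSpace 𝓘(ℝ, E) y) :
    toCoord x₀ y (cov X y v) = fderiv ℝ (fieldRep x₀ X) (chartAt E x₀ y) (toCoord x₀ y v)
      + chris x₀ (chartAt E x₀ y) (toCoord x₀ y v) (fieldRep x₀ X (chartAt E x₀ y)) := by
  rw [toCoord_cov cov hy hX, toCoord_cov_constField hcov hy, fieldRep_chart hy]

end SesquiHarmonic

namespace SesquiHarmonic

variable {E : Type*} [NormedAddCommGroup E] [NormedSpace ℝ E] [FiniteDimensional ℝ E]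
  {M : Type*} [TopologicalSpace M] [ChartedSpace E M] [IsManifold 𝓘(ℝ, E) ∞ M]

/-! ### Fields along maps in coordinates -/

section Along

variable {P : Type*} [NormedAddCommGroup P] [NormedSpace ℝ P] {x₀ : M} {q : P}

/-- The field `W` along the map `f` is smooth at `q`. -/
def SmoothAlongAt (f : P → M) (W : Π q : P, TangentSpace 𝓘(ℝ, E) (f q)) (q : P) : Prop :=
  ContMDiffAt 𝓘(ℝ, P) 𝓘(ℝ, E).tangent ∞
    (fun q => (⟨f q, W q⟩ : TangentBundle 𝓘(ℝ, E) M)) q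

/-- The coordinates of a field along a map. -/
def alongRep (x₀ : M) (f : P → M) (W : Π q : P, TangentSpace 𝓘(ℝ, E) (f q)) (q : P) : E :=
  toCoord x₀ (f q) (W q)

/-- The coordinates of a map. -/
def mapRep (x₀ : M) (f : P → M) (q : P) : E :=
  chartAt E x₀ (f q)

lemma eventually_mem_chart {f : P → M} (hf : ContinuousAt f q) (hq : f q ∈ (chartAt E x₀).source) :
    ∀ᶠ q' in 𝓝 q, f q' ∈ (chartAt E x₀).source :=
  hf.eventually_mem ((chartAt E x₀).open_source.mem_nhds hq)

lemma contMDiffAt_map_iff {f : P → M} (hf : ContinuousAt f q)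
    (hq : f q ∈ (chartAt E x₀).source) :
    ContMDiffAt 𝓘(ℝ, P) 𝓘(ℝ, E) ∞ f q ↔ ContDiffAt ℝ ∞ (mapRep (E := E) x₀ f) q := by
  rw [← contMDiffAt_iff_contDiffAt]
  constructor
  · intro h
    exact (contMDiffAt_chart hq).comp q h
  · intro h
    refine ((contMDiffAt_chart_symm (chart_mem_target hq)).comp q h).congr_of_eventuallyEq ?_
    filter_upwards [eventually_mem_chart hf hq] with z hz
    exact (chart_symm_chart hz).symm

lemma smoothAlongAt_iff {f : P → M} {W : Π q : P, TangentSpace 𝓘(ℝ, E) (f q)}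
    (hq : f q ∈ (chartAt E x₀).source) :
    SmoothAlongAt f W q ↔ ContMDiffAt 𝓘(ℝ, P) 𝓘(ℝ, E) ∞ f q ∧
      ContDiffAt ℝ ∞ (alongRep x₀ f W) q := by
  rw [SmoothAlongAt, Trivialization.contMDiffAt_iff (IB := 𝓘(ℝ, E)) (e := trivializationAt E
    (TangentSpace 𝓘(ℝ, E) : M → Type _) x₀) ((Trivialization.mem_source _).mpr (by exact hq))]
  refine and_congr_right fun hf => ?_
  rw [contMDiffAt_iff_contDiffAt]
  have h : (fun q => (trivializationAt E (TangentSpace 𝓘(ℝ, E) : M → Type _) x₀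
      ⟨f q, W q⟩).2) =ᶠ[𝓝 q] alongRep x₀ f W := by
    filter_upwards [eventually_mem_chart hf.continuousAt hq] with p hp
    rw [alongRep, toCoord_eq_trivializationAt hp]
  exact ⟨fun h' => h'.congr_of_eventuallyEq h.symm, fun h' => h'.congr_of_eventuallyEq h⟩

lemma SmoothAlongAt.map {f : P → M} {W : Π q : P, TangentSpace 𝓘(ℝ, E) (f q)}
    (h : SmoothAlongAt f W q) : ContMDiffAt 𝓘(ℝ, P) 𝓘(ℝ, E) ∞ f q :=
  ((smoothAlongAt_iff (mem_chart_source E (f q))).mp h).1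

lemma SmoothAlongAt.contDiffAt {f : P → M} {W : Π q : P, TangentSpace 𝓘(ℝ, E) (f q)}
    (h : SmoothAlongAt f W q) (hq : f q ∈ (chartAt E x₀).source) :
    ContDiffAt ℝ ∞ (alongRep x₀ f W) q :=
  ((smoothAlongAt_iff hq).mp h).2

lemma mapRep_mem {f : P → M} (hq : f q ∈ (chartAt E x₀).source) :
    mapRep (E := E) x₀ f q ∈ (chartAt E x₀).target := chart_mem_target hq

end Along

variable [RiemannianBundle (fun x : M => TangentSpace 𝓘(ℝ, E) x)]
   [IsContMDiffRiemannianBundle 𝓘(ℝ, E) ∞ E (fun x : M => TangentSpace 𝓘(ℝ, E) x)]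
  {cov : CovariantDerivative 𝓘(ℝ, E) E (TangentSpace 𝓘(ℝ, E) : M → Type _)}
  {x₀ : M}

/-- The covariant derivative of a field along a curve, in any chart. -/
lemma toCoord_covDerivAlong (hcov : IsLeviCivita cov) {γ : ℝ → M}
    {V : Π t : ℝ, TangentSpace 𝓘(ℝ, E) (γ t)} {t : ℝ} (hV : SmoothAlongAt γ V t)
    (ht : γ t ∈ (chartAt E x₀).source) :
    toCoord x₀ (γ t) (covDerivAlong cov γ V t) = deriv (alongRep x₀ γ V) t
      + chris x₀ (mapRep x₀ γ t) (deriv (mapRep x₀ γ) t) (alongRep x₀ γ V t) := by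
  set w := alongRep x₀ γ V t with hw
  have hy := mem_chart_source E (γ t)
  have hγ := hV.map.mdifferentiableAt (by simp)
  have hc : deriv (mapRep x₀ γ) t = toCoord x₀ (γ t) (velocity 𝓘(ℝ, E) γ t) :=
    (toCoord_velocity ht hγ).symm
  have hX := mdifferentiableAt_constField ht w
  have hXt : constField x₀ w (γ t) = V t := by
    rw [hw, alongRep, constField, ofCoord_toCoord ht]
  have e0 : (fun s => (trivializationAt E (TangentSpace 𝓘(ℝ, E) : M → Type _) (γ t)
      ⟨γ s, V s⟩).2) =ᶠ[𝓝 t] alongRep (γ t) γ V := by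
    filter_upwards [eventually_mem_chart hV.map.continuousAt hy] with p hp
    rw [alongRep, toCoord_eq_trivializationAt hp]
  have e1 : cov (FiberBundle.extend E (V t)) (γ t) =
      cov (constField (γ t) (toCoord (γ t) (γ t) (V t))) (γ t) :=
    cov.isCovariantDerivativeOnUniv.congr_of_eventuallyEq
      (FiberBundle.mdifferentiableAt_extend ..) (mdifferentiableAt_constField hy _)
      Filter.univ_mem (by
        filter_upwards [(chartAt E (γ t)).open_source.mem_nhds hy] with z hz
        exact extend_eq_constField _ hz)
  have e2 : covDerivAlong cov γ V t = ofCoord (γ t) (γ t) (deriv (alongRep (γ t) γ V) t)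
      + cov (constField (γ t) (toCoord (γ t) (γ t) (V t))) (γ t) (velocity 𝓘(ℝ, E) γ t) := by
    rw [covDerivAlong, e0.deriv_eq, e1, ofCoord_eq_symm hy]
  have hco : ∀ u : E, ContDiffOn ℝ ∞ (fun p => (toCoord (γ t) ((chartAt E (γ t)).symm p) ∘L
      ofCoord x₀ ((chartAt E (γ t)).symm p)) u)
      ((chartAt E (γ t)).target ∩ (chartAt E (γ t)).symm ⁻¹' (chartAt E x₀).source) := by
    intro u p hp
    have h1 := (chartAt E (γ t)).map_target hp.1
    have h2 := (contMDiffAt_field_iff le_rfl h1).mp (contMDiffAt_constField (x₀ := x₀) hp.2 u)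
    rw [(chartAt E (γ t)).right_inv hp.1] at h2
    exact h2.contDiffWithinAt
  have hopen := (chartAt E (γ t)).isOpen_inter_preimage_symm (chartAt E x₀).open_source
  have hmem : mapRep (γ t) γ t ∈ (chartAt E (γ t)).target ∩
      (chartAt E (γ t)).symm ⁻¹' (chartAt E x₀).source := by
    refine ⟨chart_mem_target hy, ?_⟩
    rw [mem_preimage, mapRep, chart_symm_chart hy]
    exact ht
  have hA := ((contDiffOn_clm_apply.mpr hco).contDiffAt (hopen.mem_nhds hmem)).differentiableAt
    (by simp)
  have hm0 := ((contMDiffAt_map_iff hV.map.continuousAt hy).mp hV.map).differentiableAt (by simp)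
  have hB := hA.hasFDerivAt.comp_hasDerivAt t hm0.hasDerivAt
  have hv := ((hV.contDiffAt ht).differentiableAt (by simp)).hasDerivAt
  -- `covDerivAlong` uses the chart at `γ t`, so the frame must be changed. Subtracting the constant
  -- `w`, the value at `t`, makes the factor vanish there, and the derivative of the transition
  -- matrix drops out of the product rule.
  have hprod := hB.clm_apply (hv.sub_const w)
  have hX0 := (mdifferentiableAt_field_iff hy).mp hX
  have hchain := hX0.hasFDerivAt.comp_hasDerivAt t hm0.hasDerivAt
  have hV0 := ((hV.contDiffAt hy).differentiableAt (by simp)).hasDerivAt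
  have hdiff : (fun s => (((fun p => toCoord (γ t) ((chartAt E (γ t)).symm p) ∘L
      ofCoord x₀ ((chartAt E (γ t)).symm p)) ∘ mapRep (γ t) γ) s) (alongRep x₀ γ V s - w)) =ᶠ[𝓝 t]
      fun s => alongRep (γ t) γ V s - fieldRep (γ t) (constField x₀ w) (mapRep (γ t) γ s) := by
    filter_upwards [eventually_mem_chart hV.map.continuousAt hy,
      eventually_mem_chart hV.map.continuousAt ht] with s hs hs'
    rw [mapRep, fieldRep_chart hs, Function.comp_apply, mapRep, chart_symm_chart hs, alongRep,
      alongRep, map_sub]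
    simp [ofCoord_toCoord hs', constField]
  have huniq := (hprod.congr_of_eventuallyEq hdiff.symm).unique (hV0.sub hchain)
  rw [show alongRep x₀ γ V t - w = 0 from sub_self _, map_zero, zero_add] at huniq
  simp only [Function.comp_apply, ContinuousLinearMap.comp_apply] at huniq
  have e3 := toCoord_cov cov hy hX (velocity 𝓘(ℝ, E) γ t)
  rw [toCoord_velocity hy hγ, hXt] at e3
  have hfin : toCoord (γ t) (γ t) (covDerivAlong cov γ V t) = toCoord (γ t) (γ t)
      (ofCoord x₀ (γ t) (deriv (alongRep x₀ γ V) t)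
        + cov (constField x₀ w) (γ t) (velocity 𝓘(ℝ, E) γ t)) := by
    rw [e2, map_add, map_add, toCoord_ofCoord hy, e3]
    rw [mapRep, chart_symm_chart hy] at huniq
    rw [huniq, show deriv (fun s => chartAt E (γ t) (γ s)) t = deriv (mapRep (γ t) γ) t from rfl]
    abel
  have hfin' := congrArg (ofCoord (γ t) (γ t)) hfin
  rw [ofCoord_toCoord hy, ofCoord_toCoord hy] at hfin'
  rw [hfin', map_add, toCoord_ofCoord ht, toCoord_cov_constField hcov ht, hc]
  rfl

end SesquiHarmonic

namespace SesquiHarmonic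

/-! ### Connections in coordinates -/

section Coordinates

variable {E : Type*} [NormedAddCommGroup E] [NormedSpace ℝ E]

/-- The curvature tensor of the connection with Christoffel symbols `Γ`. -/
def curvRep (Γ : E → E →L[ℝ] E →L[ℝ] E) (p u v w : E) : E :=
  fderiv ℝ Γ p u v w - fderiv ℝ Γ p v u w + Γ p u (Γ p v w) - Γ p v (Γ p u w)

lemma curvRep_swap (Γ : E → E →L[ℝ] E →L[ℝ] E) (p u v w : E) :
    curvRep Γ p u v w = -curvRep Γ p v u w := by
  simp only [curvRep]
  abel

lemma fderiv_apply₂ {P F H K : Type*} [NormedAddCommGroup P] [NormedSpace ℝ P]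
    [NormedAddCommGroup F] [NormedSpace ℝ F] [NormedAddCommGroup H] [NormedSpace ℝ H]
    [NormedAddCommGroup K] [NormedSpace ℝ K] {B : P → F →L[ℝ] H →L[ℝ] K} {a : P → F} {b : P → H}
    {p : P} (hB : DifferentiableAt ℝ B p) (ha : DifferentiableAt ℝ a p)
    (hb : DifferentiableAt ℝ b p) (u : P) :
    fderiv ℝ (fun q => B q (a q) (b q)) p u =
      fderiv ℝ B p u (a p) (b p) + B p (fderiv ℝ a p u) (b p) + B p (a p) (fderiv ℝ b p u) := by
  rw [fderiv_clm_apply (hB.clm_apply ha) hb, fderiv_clm_apply hB ha]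
  simp only [add_apply, ContinuousLinearMap.comp_apply, ContinuousLinearMap.flip_apply]
  abel

lemma fderiv_apply₁ {P F H : Type*} [NormedAddCommGroup P] [NormedSpace ℝ P]
    [NormedAddCommGroup F] [NormedSpace ℝ F] [NormedAddCommGroup H] [NormedSpace ℝ H]
    {B : P → F →L[ℝ] H} {a : P → F}
    {p : P} (hB : DifferentiableAt ℝ B p) (ha : DifferentiableAt ℝ a p) (u : P) :
    fderiv ℝ (fun q => B q (a q)) p u = fderiv ℝ B p u (a p) + B p (fderiv ℝ a p u) := by
  rw [fderiv_clm_apply hB ha]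
  simp only [add_apply, ContinuousLinearMap.comp_apply, ContinuousLinearMap.flip_apply]
  abel

/-- The first Bianchi identity. -/
lemma curvRep_bianchi {Γ : E → E →L[ℝ] E →L[ℝ] E} {p : E} (hΓ : DifferentiableAt ℝ Γ p)
    (hs : ∀ᶠ q in 𝓝 p, ∀ u w, Γ q u w = Γ q w u) (u v w : E) :
    curvRep Γ p u v w + curvRep Γ p v w u + curvRep Γ p w u v = 0 := by
  have hd : ∀ z u w, fderiv ℝ Γ p z u w = fderiv ℝ Γ p z w u := by
    intro z u w
    have h1 := fderiv_apply₂ hΓ (differentiableAt_const u) (differentiableAt_const w) z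
    have h2 := fderiv_apply₂ hΓ (differentiableAt_const w) (differentiableAt_const u) z
    have h3 : (fun q => Γ q u w) =ᶠ[𝓝 p] fun q => Γ q w u := hs.mono fun q hq => hq u w
    rw [h3.fderiv_eq, h2] at h1
    simpa using h1.symm
  have hs0 := hs.self_of_nhds
  simp only [curvRep]
  rw [hd u v w, hd v w u, hd w u v, hs0 v w, hs0 w u, hs0 u v]
  abel

/-- The curvature tensor of a metric connection is skew-symmetric. -/
lemma curvRep_metric {G : E → E →L[ℝ] E →L[ℝ] ℝ} {Γ : E → E →L[ℝ] E →L[ℝ] E} {p : E}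
    (hG : ContDiffAt ℝ ∞ G p) (hΓ : DifferentiableAt ℝ Γ p)
    (hm : ∀ᶠ q in 𝓝 p, ∀ u v w,
      fderiv ℝ G q u v w = G q (Γ q u v) w + G q v (Γ q u w)) (u v w z : E) :
    G p (curvRep Γ p u v w) z + G p w (curvRep Γ p u v z) = 0 := by
  have hGd := hG.differentiableAt (by simp)
  have hh : ContDiffAt ℝ ∞ (fun q => G q w z) p :=
    (hG.clm_apply contDiffAt_const).clm_apply contDiffAt_const
  -- The second derivative of the function G(w,z) is symmetric. Expanding it by metric
  -- compatibility, the mixed terms cancel on antisymmetrizing and the rest is the skew-symmetry of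
  -- the curvature.
  have hsymm : IsSymmSndFDerivAt ℝ (fun q => G q w z) p :=
    hh.isSymmSndFDerivAt (by rw [minSmoothness_of_isRCLikeNormedField]; exact ENat.LEInfty.out)
  have hev : ∀ᶠ q in 𝓝 p, DifferentiableAt ℝ G q :=
    ((hG.of_le (m := 1) (by simp)).eventually (by simp)).mono
      fun q hq => hq.differentiableAt (by simp)
  have h2 : ∀ v u, fderiv ℝ (fderiv ℝ (fun q => G q w z)) p u v =
      (G p (Γ p u (Γ p v w)) z + G p (Γ p v w) (Γ p u z)) + G p (fderiv ℝ Γ p u v w) z +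
      ((G p (Γ p u w) (Γ p v z) + G p w (Γ p u (Γ p v z))) + G p w (fderiv ℝ Γ p u v z)) := by
    intro v u
    have h3 : (fun q => fderiv ℝ (fun q => G q w z) q v) =ᶠ[𝓝 p]
        fun q => G q (Γ q v w) z + G q w (Γ q v z) := by
      filter_upwards [hm, hev] with q hq hq'
      rw [fderiv_apply₂ hq' (differentiableAt_const w) (differentiableAt_const z), ← hq]
      simp
    have hΓ1 : ∀ w : E, DifferentiableAt ℝ (fun q => Γ q v w) p := fun w =>
      (hΓ.clm_apply (differentiableAt_const v)).clm_apply (differentiableAt_const w)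
    have hΓ2 : ∀ w : E, fderiv ℝ (fun q => Γ q v w) p u = fderiv ℝ Γ p u v w := fun w => by
      rw [fderiv_apply₂ hΓ (differentiableAt_const v) (differentiableAt_const w)]
      simp
    have hdd : DifferentiableAt ℝ (fderiv ℝ (fun q => G q w z)) p :=
      (hh.fderiv_right (m := ∞) (by simp)).differentiableAt (by simp)
    have h4 := fderiv_apply₁ hdd (differentiableAt_const v) u
    rw [h3.fderiv_eq, fderiv_fun_add ((hGd.clm_apply (hΓ1 w)).clm_apply (differentiableAt_const z))
      ((hGd.clm_apply (differentiableAt_const w)).clm_apply (hΓ1 z)), add_apply,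
      fderiv_apply₂ hGd (hΓ1 w) (differentiableAt_const z),
      fderiv_apply₂ hGd (differentiableAt_const w) (hΓ1 z), hΓ2, hΓ2, hm.self_of_nhds,
      hm.self_of_nhds] at h4
    simp only [fderiv_fun_const, Pi.zero_apply, zero_apply, map_zero, add_zero] at h4
    rw [← h4]
  have h5 := hsymm u v
  rw [h2, h2] at h5
  simp only [curvRep, map_add, map_sub, add_apply, sub_apply]
  linarith

/-- The covariant derivative in direction `d`, in coordinates, of the field `v` along the map `c`. -/
def dcov {P : Type*} [NormedAddCommGroup P] [NormedSpace ℝ P] (Γ : E → E →L[ℝ] E →L[ℝ] E)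
    (c v : P → E) (d q : P) : E :=
  fderiv ℝ v q d + Γ (c q) (fderiv ℝ c q d) (v q)

/-- The commutator of covariant derivatives is the curvature tensor. -/
lemma dcov_dcov_sub {P : Type*} [NormedAddCommGroup P] [NormedSpace ℝ P]
    {Γ : E → E →L[ℝ] E →L[ℝ] E} {c v : P → E} {q : P} (hc : ContDiffAt ℝ ∞ c q)
    (hv : ContDiffAt ℝ ∞ v q) (hΓ : DifferentiableAt ℝ Γ (c q)) (a b : P) :
    dcov Γ c (dcov Γ c v b) a q - dcov Γ c (dcov Γ c v a) b q =
      curvRep Γ (c q) (fderiv ℝ c q a) (fderiv ℝ c q b) (v q) := by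
  have hsymm : ∀ f : P → E, ContDiffAt ℝ ∞ f q → IsSymmSndFDerivAt ℝ f q := fun f hf =>
    hf.isSymmSndFDerivAt (by rw [minSmoothness_of_isRCLikeNormedField]; exact ENat.LEInfty.out)
  have hdd : ∀ f : P → E, ContDiffAt ℝ ∞ f q → DifferentiableAt ℝ (fderiv ℝ f) q := fun f hf =>
    (hf.fderiv_right (m := ∞) (by simp)).differentiableAt (by simp)
  have hcd := hc.differentiableAt (by simp)
  have hvd := hv.differentiableAt (by simp)
  have hΓc : DifferentiableAt ℝ (fun q => Γ (c q)) q := hΓ.comp q hcd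
  have hΓ' : ∀ a, fderiv ℝ (fun q => Γ (c q)) q a = fderiv ℝ Γ (c q) (fderiv ℝ c q a) := by
    intro a
    rw [show (fun q => Γ (c q)) = Γ ∘ c from rfl, fderiv_comp q hΓ hcd]
    rfl
  have hf' : ∀ f : P → E, ContDiffAt ℝ ∞ f q → ∀ a b, fderiv ℝ (fun q => fderiv ℝ f q b) q a =
      fderiv ℝ (fderiv ℝ f) q a b := by
    intro f hf a b
    rw [fderiv_apply₁ (hdd f hf) (differentiableAt_const b)]
    simp
  -- The second derivatives of `c` and `v` enter symmetrically in `a` and `b`, so they cancel in the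
  -- commutator.
  have key : ∀ a b, fderiv ℝ (dcov Γ c v b) q a = fderiv ℝ (fderiv ℝ v) q a b +
      (fderiv ℝ Γ (c q) (fderiv ℝ c q a) (fderiv ℝ c q b) (v q) +
        Γ (c q) (fderiv ℝ (fderiv ℝ c) q a b) (v q) +
        Γ (c q) (fderiv ℝ c q b) (fderiv ℝ v q a)) := by
    intro a b
    have h1 : DifferentiableAt ℝ (fun q => fderiv ℝ c q b) q :=
      (hdd c hc).clm_apply (differentiableAt_const b)
    have h2 : DifferentiableAt ℝ (fun q => fderiv ℝ v q b) q :=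
      (hdd v hv).clm_apply (differentiableAt_const b)
    unfold dcov
    rw [fderiv_fun_add h2 ((hΓc.clm_apply h1).clm_apply hvd), add_apply,
      fderiv_apply₂ hΓc h1 hvd, hΓ', hf' c hc, hf' v hv]
  change (fderiv ℝ (dcov Γ c v b) q a + Γ (c q) (fderiv ℝ c q a) (dcov Γ c v b q)) -
    (fderiv ℝ (dcov Γ c v a) q b + Γ (c q) (fderiv ℝ c q b) (dcov Γ c v a q)) = _
  rw [key, key, hsymm c hc a b, hsymm v hv a b, curvRep]
  simp only [dcov, map_add]
  abel

end Coordinates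

/-! ### Christoffel symbols and curvature of the manifold in a chart -/

section ChrisRep

variable {E : Type*} [NormedAddCommGroup E] [NormedSpace ℝ E] [FiniteDimensional ℝ E]
  {M : Type*} [TopologicalSpace M] [ChartedSpace E M] [IsManifold 𝓘(ℝ, E) ∞ M]
  [RiemannianBundle (fun x : M => TangentSpace 𝓘(ℝ, E) x)]
  [IsContMDiffRiemannianBundle 𝓘(ℝ, E) ∞ E (fun x : M => TangentSpace 𝓘(ℝ, E) x)]
  {cov : CovariantDerivative 𝓘(ℝ, E) E (TangentSpace 𝓘(ℝ, E) : M → Type _)}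
  {x₀ : M} {p : E}

lemma fderiv_metricRep_comm (hp : p ∈ (chartAt E x₀).target) (z u w : E) :
    fderiv ℝ (metricRep (E := E) x₀) p z u w = fderiv ℝ (metricRep (E := E) x₀) p z w u := by
  have hG := (contDiffAt_metricRep (E := E) hp).differentiableAt (by simp)
  have h1 := fderiv_apply₂ hG (differentiableAt_const u) (differentiableAt_const w) z
  have h2 := fderiv_apply₂ hG (differentiableAt_const w) (differentiableAt_const u) z
  have h3 : (fun q => metricRep (E := E) x₀ q u w) = fun q => metricRep x₀ q w u :=
    funext fun q => metricRep_comm x₀ q u w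
  rw [h3, h2] at h1
  simpa using h1.symm

lemma chris_comm (hp : p ∈ (chartAt E x₀).target) (u w : E) :
    chris (E := E) x₀ p u w = chris x₀ p w u := by
  refine (isInvertible_metricRep (E := E) hp).injective (ContinuousLinearMap.ext fun z => ?_)
  rw [chris, metric_christoffel (isInvertible_metricRep hp),
    metric_christoffel (isInvertible_metricRep hp), fderiv_metricRep_comm hp z u w]
  ring

lemma fderiv_metricRep (hp : p ∈ (chartAt E x₀).target) (u v w : E) :
    fderiv ℝ (metricRep (E := E) x₀) p u v w =
      metricRep x₀ p (chris x₀ p u v) w + metricRep x₀ p v (chris x₀ p u w) := by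
  rw [metricRep_comm x₀ p v, chris, metric_christoffel (isInvertible_metricRep hp),
    metric_christoffel (isInvertible_metricRep hp), fderiv_metricRep_comm hp u v w,
    fderiv_metricRep_comm hp v u w, fderiv_metricRep_comm hp w u v]
  ring

lemma eventually_target (hp : p ∈ (chartAt E x₀).target) :
    ∀ᶠ q in 𝓝 p, q ∈ (chartAt E x₀).target := (chartAt E x₀).open_target.mem_nhds hp

/-- The curvature tensor in the chart at the given point. -/
lemma toCoord_curvature (hcov : IsLeviCivita cov) (x : M) (u v w : TangentSpace 𝓘(ℝ, E) x) :
    toCoord x x (curvature cov x u v w) =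
      curvRep (chris x) (chartAt E x x) (toCoord x x u) (toCoord x x v) (toCoord x x w) := by
  have hx := mem_chart_source E x
  have hext : ∀ u : TangentSpace 𝓘(ℝ, E) x, ∀ y ∈ (chartAt E x).source,
      (FiberBundle.extend E u : Π y : M, TangentSpace 𝓘(ℝ, E) y) =ᶠ[𝓝 y]
        constField x (toCoord x x u) := by
    intro u y hy
    filter_upwards [(chartAt E x).open_source.mem_nhds hy] with z hz
    exact extend_eq_constField _ hz
  have hcovext : ∀ u : TangentSpace 𝓘(ℝ, E) x, ∀ y ∈ (chartAt E x).source,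
      cov (FiberBundle.extend E u) y = cov (constField x (toCoord x x u)) y := by
    intro u y hy
    refine cov.isCovariantDerivativeOnUniv.congr_of_eventuallyEq ?_
      (mdifferentiableAt_constField hy _) Filter.univ_mem (hext u y hy)
    refine (mdifferentiableAt_constField hy (toCoord x x u)).congr_of_eventuallyEq ?_
    filter_upwards [hext u y hy] with z hz
    simp [hz]
  have hA : ∀ u v w : TangentSpace 𝓘(ℝ, E) x,
      toCoord x x (cov (fun y => cov (FiberBundle.extend E w) y (FiberBundle.extend E v y)) x u) =
      fderiv ℝ (chris (E := E) x) (chartAt E x x) (toCoord x x u) (toCoord x x v) (toCoord x x w) +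
      chris x (chartAt E x x) (toCoord x x u)
        (chris x (chartAt E x x) (toCoord x x v) (toCoord x x w)) := by
    intro u v w
    have hΓ := contDiffAt_chris (E := E) (chart_mem_target hx)
    have hrep : fieldRep x (fun y => cov (FiberBundle.extend E w) y (FiberBundle.extend E v y))
        =ᶠ[𝓝 (chartAt E x x)] fun p => chris x p (toCoord x x v) (toCoord x x w) := by
      filter_upwards [eventually_target (chart_mem_target hx)] with p hp
      have hy := (chartAt E x).map_target hp
      rw [fieldRep, hcovext w _ hy, extend_eq_constField v hy, toCoord_cov_constField hcov hy,
        (chartAt E x).right_inv hp, constField, toCoord_ofCoord hy]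
    have hΓd : DifferentiableAt ℝ (fun p => chris (E := E) x p (toCoord x x v) (toCoord x x w))
        (chartAt E x x) :=
      ((hΓ.clm_apply contDiffAt_const).clm_apply contDiffAt_const).differentiableAt (by simp)
    rw [toCoord_cov' hcov hx ((mdifferentiableAt_field_iff hx).mpr
      (hΓd.congr_of_eventuallyEq hrep)), hrep.fderiv_eq, hrep.eq_of_nhds,
      fderiv_apply₂ (hΓ.differentiableAt (by simp)) (differentiableAt_const _)
        (differentiableAt_const _)]
    simp
  have hbr : mlieBracket 𝓘(ℝ, E) (FiberBundle.extend E u) (FiberBundle.extend E v) x = 0 := by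
    rw [Filter.EventuallyEq.mlieBracket_vectorField_eq (hext u x hx) (hext v x hx),
      mlieBracket_constField hx]
  simp only [curvature]
  rw [map_sub, map_sub, hA, hA, hbr, map_zero, map_zero, curvRep]
  abel

end ChrisRep

end SesquiHarmonic

namespace SesquiHarmonic

/-! ### Calculus of fields along maps -/

section AlongCalculus

variable {E : Type*} [NormedAddCommGroup E] [NormedSpace ℝ E] [FiniteDimensional ℝ E]
  {M : Type*} [TopologicalSpace M] [ChartedSpace E M] [IsManifold 𝓘(ℝ, E) ∞ M]
  {P : Type*} [NormedAddCommGroup P] [NormedSpace ℝ P] {x₀ : M} {f : P → M} {q d : P}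

lemma ext_toCoord {y : M} (hy : y ∈ (chartAt E x₀).source) {u v : TangentSpace 𝓘(ℝ, E) y}
    (h : toCoord x₀ y u = toCoord x₀ y v) : u = v := by
  rw [← ofCoord_toCoord hy u, h, ofCoord_toCoord hy]

lemma contDiffAt_mapRep (hf : ContMDiffAt 𝓘(ℝ, P) 𝓘(ℝ, E) ∞ f q)
    (hq : f q ∈ (chartAt E x₀).source) : ContDiffAt ℝ ∞ (mapRep (E := E) x₀ f) q :=
  (contMDiffAt_map_iff hf.continuousAt hq).mp hf

/-- The velocity of `f` along a curve in the parameter space. -/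
lemma toCoord_velocity_comp {ℓ : ℝ → P} {r : ℝ} (hℓ : HasDerivAt ℓ d r)
    (hf : ContMDiffAt 𝓘(ℝ, P) 𝓘(ℝ, E) ∞ f (ℓ r)) (hq : f (ℓ r) ∈ (chartAt E x₀).source) :
    toCoord x₀ (f (ℓ r)) (velocity 𝓘(ℝ, E) (fun r => f (ℓ r)) r) =
      fderiv ℝ (mapRep x₀ f) (ℓ r) d := by
  have h1 := (contDiffAt_mapRep hf hq).differentiableAt (by simp)
  have h2 : MDifferentiableAt 𝓘(ℝ, ℝ) 𝓘(ℝ, E) (fun r => f (ℓ r)) r :=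
    (hf.mdifferentiableAt (by simp)).comp r
      (mdifferentiableAt_iff_differentiableAt.mpr hℓ.differentiableAt)
  rw [toCoord_velocity (γ := fun r => f (ℓ r)) hq h2]
  exact (h1.hasFDerivAt.comp_hasDerivAt r hℓ).deriv

lemma SmoothAlongAt.comp {W : Π q : P, TangentSpace 𝓘(ℝ, E) (f q)} {ℓ : ℝ → P} {r : ℝ}
    (hW : SmoothAlongAt f W (ℓ r)) (hℓ : ContDiffAt ℝ ∞ ℓ r) :
    SmoothAlongAt (fun r => f (ℓ r)) (fun r => W (ℓ r)) r :=
  ContMDiffAt.comp (g := fun q => (⟨f q, W q⟩ : TangentBundle 𝓘(ℝ, E) M)) r hW hℓ.contMDiffAt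

/-- Reduces smoothness of velocities, covariant derivatives and images under φ to their explicit
expressions in a single chart. -/
lemma smoothAlongAt_of_eventually_eq {Z : Π q : P, TangentSpace 𝓘(ℝ, E) (f q)}
    {z : P → E} (hf : ContMDiffAt 𝓘(ℝ, P) 𝓘(ℝ, E) ∞ f q) (hq : f q ∈ (chartAt E x₀).source)
    (hz : ContDiffAt ℝ ∞ z q)
    (h : ∀ᶠ q' in 𝓝 q, f q' ∈ (chartAt E x₀).source → toCoord x₀ (f q') (Z q') = z q') :
    SmoothAlongAt f Z q := by
  refine (smoothAlongAt_iff hq).mpr ⟨hf, hz.congr_of_eventuallyEq ?_⟩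
  filter_upwards [h, eventually_mem_chart hf.continuousAt hq] with q' h1 h2
  exact h1 h2

lemma SmoothAlongAt.add {V W : Π q : P, TangentSpace 𝓘(ℝ, E) (f q)} (hV : SmoothAlongAt f V q)
    (hW : SmoothAlongAt f W q) : SmoothAlongAt f (fun q => V q + W q) q :=
  have hq := mem_chart_source E (f q)
  smoothAlongAt_of_eventually_eq hV.map hq ((hV.contDiffAt hq).add (hW.contDiffAt hq))
    (Filter.Eventually.of_forall fun _ _ => map_add _ _ _)

lemma SmoothAlongAt.smul {a : P → ℝ} {V : Π q : P, TangentSpace 𝓘(ℝ, E) (f q)}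
    (ha : ContDiffAt ℝ ∞ a q) (hV : SmoothAlongAt f V q) :
    SmoothAlongAt f (fun q => a q • V q) q :=
  have hq := mem_chart_source E (f q)
  smoothAlongAt_of_eventually_eq hV.map hq (ha.smul (hV.contDiffAt hq))
    (Filter.Eventually.of_forall fun _ _ => map_smul _ _ _)

lemma smoothAlongAt_zero (hf : ContMDiffAt 𝓘(ℝ, P) 𝓘(ℝ, E) ∞ f q) :
    SmoothAlongAt f (fun q => (0 : TangentSpace 𝓘(ℝ, E) (f q))) q :=
  smoothAlongAt_of_eventually_eq hf (mem_chart_source E (f q)) (z := fun _ => 0) contDiffAt_const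
    (Filter.Eventually.of_forall fun _ _ => map_zero _)

variable [RiemannianBundle (fun x : M => TangentSpace 𝓘(ℝ, E) x)]

lemma inner_eq_metricRep {V W : Π q : P, TangentSpace 𝓘(ℝ, E) (f q)}
    (hq : f q ∈ (chartAt E x₀).source) : inner ℝ (V q) (W q) =
      metricRep x₀ (mapRep x₀ f q) (alongRep x₀ f V q) (alongRep x₀ f W q) :=
  (metricRep_chart hq _ _).symm

variable [IsContMDiffRiemannianBundle 𝓘(ℝ, E) ∞ E (fun x : M => TangentSpace 𝓘(ℝ, E) x)]
  {cov : CovariantDerivative 𝓘(ℝ, E) E (TangentSpace 𝓘(ℝ, E) : M → Type _)}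

lemma SmoothAlongAt.inner {V W : Π q : P, TangentSpace 𝓘(ℝ, E) (f q)} (hV : SmoothAlongAt f V q)
    (hW : SmoothAlongAt f W q) : ContDiffAt ℝ ∞ (fun q => (inner ℝ (V q) (W q) : ℝ)) q := by
  have hq := mem_chart_source E (f q)
  have hG := (contDiffAt_metricRep (E := E) (mapRep_mem hq)).comp q (contDiffAt_mapRep hV.map hq)
  refine ((hG.clm_apply (hV.contDiffAt hq)).clm_apply (hW.contDiffAt hq)).congr_of_eventuallyEq ?_
  filter_upwards [eventually_mem_chart hV.map.continuousAt hq] with q' h'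
  exact inner_eq_metricRep h'

/-- The covariant derivative of a field along a curve in the parameter space. -/
lemma toCoord_covDerivAlong_comp (hcov : IsLeviCivita cov)
    {W : Π q : P, TangentSpace 𝓘(ℝ, E) (f q)} {ℓ : ℝ → P} {r : ℝ} (hℓ : ContDiffAt ℝ ∞ ℓ r)
    (hd : HasDerivAt ℓ d r) (hW : SmoothAlongAt f W (ℓ r)) (hq : f (ℓ r) ∈ (chartAt E x₀).source) :
    toCoord x₀ (f (ℓ r)) (covDerivAlong cov (fun r => f (ℓ r)) (fun r => W (ℓ r)) r) =
      dcov (chris x₀) (mapRep x₀ f) (alongRep x₀ f W) d (ℓ r) := by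
  have h1 := (contDiffAt_mapRep hW.map hq).differentiableAt (by simp)
  have h2 := (hW.contDiffAt hq).differentiableAt (by simp)
  rw [toCoord_covDerivAlong (γ := fun r => f (ℓ r)) hcov (hW.comp hℓ) hq]
  have h3 : deriv (alongRep x₀ (fun r => f (ℓ r)) fun r => W (ℓ r)) r =
      fderiv ℝ (alongRep x₀ f W) (ℓ r) d := (h2.hasFDerivAt.comp_hasDerivAt r hd).deriv
  have h4 : deriv (mapRep (E := E) x₀ fun r => f (ℓ r)) r = fderiv ℝ (mapRep x₀ f) (ℓ r) d :=
    (h1.hasFDerivAt.comp_hasDerivAt r hd).deriv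
  rw [h3, h4]
  rfl

lemma contDiffAt_dcov {W : Π q : P, TangentSpace 𝓘(ℝ, E) (f q)} (hW : SmoothAlongAt f W q)
    (hq : f q ∈ (chartAt E x₀).source) (d : P) :
    ContDiffAt ℝ ∞ (dcov (chris x₀) (mapRep x₀ f) (alongRep x₀ f W) d) q := by
  have hc := contDiffAt_mapRep hW.map hq
  have hv := hW.contDiffAt hq
  have hΓ := (contDiffAt_chris (E := E) (mapRep_mem hq)).comp q hc
  exact ((hv.fderiv_right (m := ∞) (by simp)).clm_apply contDiffAt_const).add
    ((hΓ.clm_apply ((hc.fderiv_right (m := ∞) (by simp)).clm_apply contDiffAt_const)).clm_apply hv)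

/-! ### Fields along curves -/

variable {γ : ℝ → M} {V W : Π t : ℝ, TangentSpace 𝓘(ℝ, E) (γ t)} {t : ℝ}

lemma toCoord_covDerivAlong' (hcov : IsLeviCivita cov) (hV : SmoothAlongAt γ V t)
    (ht : γ t ∈ (chartAt E x₀).source) : toCoord x₀ (γ t) (covDerivAlong cov γ V t) =
      dcov (chris x₀) (mapRep x₀ γ) (alongRep x₀ γ V) 1 t :=
  toCoord_covDerivAlong_comp hcov (ℓ := id) contDiffAt_id (hasDerivAt_id t) hV ht

lemma smoothAlongAt_velocity (hγ : ∀ᶠ s in 𝓝 t, ContMDiffAt 𝓘(ℝ, ℝ) 𝓘(ℝ, E) ∞ γ s) :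
    SmoothAlongAt γ (velocity 𝓘(ℝ, E) γ) t := by
  have hq := mem_chart_source E (γ t)
  have hc := contDiffAt_mapRep hγ.self_of_nhds hq
  refine smoothAlongAt_of_eventually_eq hγ.self_of_nhds hq
    (((hc.fderiv_right (m := ∞) (by simp)).clm_apply (contDiffAt_const (c := (1 : ℝ)))))
    (hγ.mono fun s hs hs' => ?_)
  exact toCoord_velocity_comp (ℓ := id) (hasDerivAt_id s) hs hs'

lemma smoothAlongAt_covDerivAlong (hcov : IsLeviCivita cov)
    (hV : ∀ᶠ s in 𝓝 t, SmoothAlongAt γ V s) : SmoothAlongAt γ (covDerivAlong cov γ V) t :=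
  have hq := mem_chart_source E (γ t)
  smoothAlongAt_of_eventually_eq hV.self_of_nhds.map hq (contDiffAt_dcov hV.self_of_nhds hq 1)
    (hV.mono fun _ hs hs' => toCoord_covDerivAlong' hcov hs hs')

/-- The covariant derivative along a curve is metric. -/
lemma hasDerivAt_inner (hcov : IsLeviCivita cov) (hV : SmoothAlongAt γ V t)
    (hW : SmoothAlongAt γ W t) : HasDerivAt (fun s => (inner ℝ (V s) (W s) : ℝ))
      (inner ℝ (covDerivAlong cov γ V t) (W t) + inner ℝ (V t) (covDerivAlong cov γ W t)) t := by
  have hq := mem_chart_source E (γ t)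
  have hc := (contDiffAt_mapRep hV.map hq).differentiableAt (by simp)
  have hG := (contDiffAt_metricRep (E := E) (mapRep_mem hq)).differentiableAt (by simp)
  have hv := (hV.contDiffAt hq).differentiableAt (by simp)
  have hw := (hW.contDiffAt hq).differentiableAt (by simp)
  have heq : (fun s => (inner ℝ (V s) (W s) : ℝ)) =ᶠ[𝓝 t] fun s =>
      metricRep (γ t) (mapRep (γ t) γ s) (alongRep (γ t) γ V s) (alongRep (γ t) γ W s) := by
    filter_upwards [eventually_mem_chart hV.map.continuousAt hq] with q' h'
    exact inner_eq_metricRep h'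
  have hd := (((hV.inner hW).differentiableAt (by simp)).hasDerivAt)
  refine hd.congr_deriv ?_
  have hGc : DifferentiableAt ℝ (fun s => metricRep (γ t) (mapRep (E := E) (γ t) γ s)) t :=
    hG.comp t hc
  have hGc' : fderiv ℝ (fun s => metricRep (γ t) (mapRep (E := E) (γ t) γ s)) t 1 =
      fderiv ℝ (metricRep (γ t)) (mapRep (γ t) γ t) (fderiv ℝ (mapRep (γ t) γ) t 1) := by
    rw [show (fun s => metricRep (γ t) (mapRep (E := E) (γ t) γ s)) =
      metricRep (γ t) ∘ mapRep (E := E) (γ t) γ from rfl, fderiv_comp t hG hc]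
    rfl
  rw [heq.deriv_eq, ← fderiv_apply_one_eq_deriv, fderiv_apply₂ hGc hv hw, hGc',
    fderiv_metricRep (mapRep_mem hq), ← metricRep_chart hq, ← metricRep_chart hq,
    toCoord_covDerivAlong' hcov hV hq, toCoord_covDerivAlong' hcov hW hq, dcov, dcov]
  simp only [map_add, add_apply]
  simp only [mapRep, alongRep]
  ring

lemma covDerivAlong_add (hcov : IsLeviCivita cov) (hV : SmoothAlongAt γ V t)
    (hW : SmoothAlongAt γ W t) : covDerivAlong cov γ (fun s => V s + W s) t =
      covDerivAlong cov γ V t + covDerivAlong cov γ W t := by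
  have hq := mem_chart_source E (γ t)
  have hv := (hV.contDiffAt hq).differentiableAt (by simp)
  have hw := (hW.contDiffAt hq).differentiableAt (by simp)
  refine ext_toCoord hq ?_
  rw [map_add, toCoord_covDerivAlong' hcov (hV.add hW) hq, toCoord_covDerivAlong' hcov hV hq,
    toCoord_covDerivAlong' hcov hW hq]
  have h : alongRep (γ t) γ (fun s => V s + W s) =
      fun s => alongRep (γ t) γ V s + alongRep (γ t) γ W s := funext fun s => map_add _ _ _
  rw [h]
  simp only [dcov]
  rw [fderiv_fun_add hv hw]
  simp only [map_add, add_apply]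
  abel

lemma covDerivAlong_smul (hcov : IsLeviCivita cov) {a : ℝ → ℝ} (ha : ContDiffAt ℝ ∞ a t)
    (hV : SmoothAlongAt γ V t) : covDerivAlong cov γ (fun s => a s • V s) t =
      deriv a t • V t + a t • covDerivAlong cov γ V t := by
  have hq := mem_chart_source E (γ t)
  have hv := (hV.contDiffAt hq).differentiableAt (by simp)
  refine ext_toCoord hq ?_
  rw [map_add, map_smul, map_smul, toCoord_covDerivAlong' hcov (hV.smul ha) hq,
    toCoord_covDerivAlong' hcov hV hq]
  have h : alongRep (γ t) γ (fun s => a s • V s) =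
      fun s => a s • alongRep (γ t) γ V s := funext fun s => map_smul _ _ _
  rw [h]
  simp only [dcov]
  rw [fderiv_fun_smul (ha.differentiableAt (by simp)) hv]
  simp only [map_smul, smul_apply, add_apply, ContinuousLinearMap.smulRight_apply,
    fderiv_apply_one_eq_deriv, smul_add]
  rw [alongRep]
  abel

/-- The definition sees only the germ of the field at `t`; this allows an identity known on an open
set of parameters to be differentiated. -/
lemma covDerivAlong_congr {V W : Π t : ℝ, TangentSpace 𝓘(ℝ, E) (γ t)} (h : ∀ᶠ s in 𝓝 t, V s = W s) :
    covDerivAlong cov γ V t = covDerivAlong cov γ W t := by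
  rw [covDerivAlong, covDerivAlong, h.self_of_nhds]
  congr 2
  refine Filter.EventuallyEq.deriv_eq ?_
  filter_upwards [h] with s hs
  rw [hs]

/-! ### Two-parameter maps -/

variable {f : ℝ × ℝ → M} {q : ℝ × ℝ}

/-- The velocity in the second parameter. -/
def velT (f : ℝ × ℝ → M) (q : ℝ × ℝ) : TangentSpace 𝓘(ℝ, E) (f q) :=
  velocity 𝓘(ℝ, E) (fun t => f (q.1, t)) q.2

/-- The velocity in the first parameter. -/
def velS (f : ℝ × ℝ → M) (q : ℝ × ℝ) : TangentSpace 𝓘(ℝ, E) (f q) :=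
  velocity 𝓘(ℝ, E) (fun s => f (s, q.2)) q.1

/-- The covariant derivative in the second parameter. -/
def covT (cov : CovariantDerivative 𝓘(ℝ, E) E (TangentSpace 𝓘(ℝ, E) : M → Type _))
    (f : ℝ × ℝ → M) (W : Π q : ℝ × ℝ, TangentSpace 𝓘(ℝ, E) (f q)) (q : ℝ × ℝ) :
    TangentSpace 𝓘(ℝ, E) (f q) :=
  covDerivAlong cov (fun t => f (q.1, t)) (fun t => W (q.1, t)) q.2

/-- The covariant derivative in the first parameter. -/
def covS (cov : CovariantDerivative 𝓘(ℝ, E) E (TangentSpace 𝓘(ℝ, E) : M → Type _))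
    (f : ℝ × ℝ → M) (W : Π q : ℝ × ℝ, TangentSpace 𝓘(ℝ, E) (f q)) (q : ℝ × ℝ) :
    TangentSpace 𝓘(ℝ, E) (f q) :=
  covDerivAlong cov (fun s => f (s, q.2)) (fun s => W (s, q.2)) q.1

lemma hasDerivAt_prodMk_left (q : ℝ × ℝ) : HasDerivAt (fun s => (s, q.2)) ((1, 0) : ℝ × ℝ) q.1 :=
  (hasDerivAt_id q.1).prodMk (hasDerivAt_const q.1 q.2)

lemma hasDerivAt_prodMk_right (q : ℝ × ℝ) : HasDerivAt (fun t => (q.1, t)) ((0, 1) : ℝ × ℝ) q.2 :=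
  (hasDerivAt_const q.2 q.1).prodMk (hasDerivAt_id q.2)

lemma toCoord_velT (hf : ContMDiffAt 𝓘(ℝ, ℝ × ℝ) 𝓘(ℝ, E) ∞ f q)
    (hq : f q ∈ (chartAt E x₀).source) :
    toCoord x₀ (f q) (velT f q) = fderiv ℝ (mapRep (E := E) x₀ f) q (0, 1) :=
  toCoord_velocity_comp (ℓ := fun t => (q.1, t)) (hasDerivAt_prodMk_right q) hf hq

lemma toCoord_velS (hf : ContMDiffAt 𝓘(ℝ, ℝ × ℝ) 𝓘(ℝ, E) ∞ f q)
    (hq : f q ∈ (chartAt E x₀).source) :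
    toCoord x₀ (f q) (velS f q) = fderiv ℝ (mapRep (E := E) x₀ f) q (1, 0) :=
  toCoord_velocity_comp (ℓ := fun s => (s, q.2)) (hasDerivAt_prodMk_left q) hf hq

variable {W : Π q : ℝ × ℝ, TangentSpace 𝓘(ℝ, E) (f q)}

lemma toCoord_covT (hcov : IsLeviCivita cov) (hW : SmoothAlongAt f W q)
    (hq : f q ∈ (chartAt E x₀).source) : toCoord x₀ (f q) (covT cov f W q) =
      dcov (chris x₀) (mapRep (E := E) x₀ f) (alongRep x₀ f W) (0, 1) q :=
  toCoord_covDerivAlong_comp (ℓ := fun t => (q.1, t)) hcov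
    (contDiffAt_const.prodMk contDiffAt_id) (hasDerivAt_prodMk_right q) hW hq

lemma toCoord_covS (hcov : IsLeviCivita cov) (hW : SmoothAlongAt f W q)
    (hq : f q ∈ (chartAt E x₀).source) : toCoord x₀ (f q) (covS cov f W q) =
      dcov (chris x₀) (mapRep (E := E) x₀ f) (alongRep x₀ f W) (1, 0) q :=
  toCoord_covDerivAlong_comp (ℓ := fun s => (s, q.2)) hcov
    (contDiffAt_id.prodMk contDiffAt_const) (hasDerivAt_prodMk_left q) hW hq

lemma smoothAlongAt_velT (hf : ∀ᶠ q' in 𝓝 q, ContMDiffAt 𝓘(ℝ, ℝ × ℝ) 𝓘(ℝ, E) ∞ f q') :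
    SmoothAlongAt f (velT (E := E) f) q :=
  have hq := mem_chart_source E (f q)
  smoothAlongAt_of_eventually_eq hf.self_of_nhds hq
    (((contDiffAt_mapRep hf.self_of_nhds hq).fderiv_right (m := ∞) (by simp)).clm_apply
      contDiffAt_const) (hf.mono fun _ hs hs' => toCoord_velT hs hs')

lemma smoothAlongAt_velS (hf : ∀ᶠ q' in 𝓝 q, ContMDiffAt 𝓘(ℝ, ℝ × ℝ) 𝓘(ℝ, E) ∞ f q') :
    SmoothAlongAt f (velS (E := E) f) q :=
  have hq := mem_chart_source E (f q)
  smoothAlongAt_of_eventually_eq hf.self_of_nhds hq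
    (((contDiffAt_mapRep hf.self_of_nhds hq).fderiv_right (m := ∞) (by simp)).clm_apply
      contDiffAt_const) (hf.mono fun _ hs hs' => toCoord_velS hs hs')

lemma smoothAlongAt_covT (hcov : IsLeviCivita cov) (hW : ∀ᶠ q' in 𝓝 q, SmoothAlongAt f W q') :
    SmoothAlongAt f (covT cov f W) q :=
  have hq := mem_chart_source E (f q)
  smoothAlongAt_of_eventually_eq hW.self_of_nhds.map hq (contDiffAt_dcov hW.self_of_nhds hq _)
    (hW.mono fun _ hs hs' => toCoord_covT hcov hs hs')

/-- The covariant derivatives of the velocities agree. -/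
lemma covS_velT (hcov : IsLeviCivita cov)
    (hf : ∀ᶠ q' in 𝓝 q, ContMDiffAt 𝓘(ℝ, ℝ × ℝ) 𝓘(ℝ, E) ∞ f q') :
    covS cov f (velT f) q = covT cov f (velS f) q := by
  have hq := mem_chart_source E (f q)
  have hc := contDiffAt_mapRep hf.self_of_nhds hq
  refine ext_toCoord hq ?_
  rw [toCoord_covS hcov (smoothAlongAt_velT hf) hq, toCoord_covT hcov (smoothAlongAt_velS hf) hq]
  have e1 : alongRep (f q) f (velT f) =ᶠ[𝓝 q]
      fun q' => fderiv ℝ (mapRep (E := E) (f q) f) q' (0, 1) := by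
    filter_upwards [hf, eventually_mem_chart hf.self_of_nhds.continuousAt hq] with q' h1 h2
    exact toCoord_velT h1 h2
  have e2 : alongRep (f q) f (velS f) =ᶠ[𝓝 q]
      fun q' => fderiv ℝ (mapRep (E := E) (f q) f) q' (1, 0) := by
    filter_upwards [hf, eventually_mem_chart hf.self_of_nhds.continuousAt hq] with q' h1 h2
    exact toCoord_velS h1 h2
  have hdd : DifferentiableAt ℝ (fderiv ℝ (mapRep (E := E) (f q) f)) q :=
    (hc.fderiv_right (m := ∞) (by simp)).differentiableAt (by simp)
  have hsymm : IsSymmSndFDerivAt ℝ (mapRep (E := E) (f q) f) q :=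
    hc.isSymmSndFDerivAt (by rw [minSmoothness_of_isRCLikeNormedField]; exact ENat.LEInfty.out)
  rw [dcov, dcov, e1.fderiv_eq, e2.fderiv_eq, e1.eq_of_nhds, e2.eq_of_nhds,
    fderiv_apply₁ hdd (differentiableAt_const _), fderiv_apply₁ hdd (differentiableAt_const _),
    hsymm, chris_comm (mapRep_mem hq)]
  simp

lemma dcov_congr {Γ : E → E →L[ℝ] E →L[ℝ] E} {c v w : ℝ × ℝ → E} {d : ℝ × ℝ} (h : v =ᶠ[𝓝 q] w) :
    dcov Γ c v d q = dcov Γ c w d q := by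
  rw [dcov, dcov, h.fderiv_eq, h.eq_of_nhds]

/-- The commutator of covariant derivatives in the two parameters. -/
lemma covS_covT (hcov : IsLeviCivita cov) (hW : ∀ᶠ q' in 𝓝 q, SmoothAlongAt f W q') :
    covS cov f (covT cov f W) q = covT cov f (covS cov f W) q +
      curvature cov (f q) (velS f q) (velT f q) (W q) := by
  have hq := mem_chart_source E (f q)
  have hc := contDiffAt_mapRep hW.self_of_nhds.map hq
  have hS : ∀ᶠ q' in 𝓝 q, f q' ∈ (chartAt E (f q)).source :=
    eventually_mem_chart hW.self_of_nhds.map.continuousAt hq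
  have hsS : SmoothAlongAt f (covS cov f W) q :=
    smoothAlongAt_of_eventually_eq hW.self_of_nhds.map hq (contDiffAt_dcov hW.self_of_nhds hq _)
      (hW.mono fun _ hs hs' => toCoord_covS hcov hs hs')
  refine ext_toCoord hq ?_
  have e1 : alongRep (f q) f (covT cov f W) =ᶠ[𝓝 q]
      dcov (chris (f q)) (mapRep (f q) f) (alongRep (f q) f W) (0, 1) := by
    filter_upwards [hW, hS] with q' h1 h2
    exact toCoord_covT hcov h1 h2
  have e2 : alongRep (f q) f (covS cov f W) =ᶠ[𝓝 q]
      dcov (chris (f q)) (mapRep (f q) f) (alongRep (f q) f W) (1, 0) := by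
    filter_upwards [hW, hS] with q' h1 h2
    exact toCoord_covS hcov h1 h2
  have key := dcov_dcov_sub hc (hW.self_of_nhds.contDiffAt hq)
    ((contDiffAt_chris (E := E) (mapRep_mem hq)).differentiableAt (by simp)) (1, 0) (0, 1)
  rw [map_add, toCoord_covS hcov (smoothAlongAt_covT hcov hW) hq, toCoord_covT hcov hsS hq,
    toCoord_curvature hcov, toCoord_velS hW.self_of_nhds.map hq,
    toCoord_velT hW.self_of_nhds.map hq, dcov_congr e1, dcov_congr e2]
  rw [sub_eq_iff_eq_add'] at key
  exact key

end AlongCalculus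

end SesquiHarmonic

namespace SesquiHarmonic

/-! ### Linear algebra of Sasakian structures -/

section Algebra

variable {E : Type*} [NormedAddCommGroup E] [NormedSpace ℝ E]

/-- An almost contact metric structure on a vector space. -/
structure IsAlmostContact (g : E →L[ℝ] E →L[ℝ] ℝ) (P : E →L[ℝ] E) (X : E) : Prop where
  symm : ∀ u v, g u v = g v u
  pos : ∀ u, u ≠ 0 → 0 < g u u
  P_P : ∀ u, P (P u) = -u + g X u • X
  X_X : g X X = 1
  metric_P : ∀ u v, g (P u) (P v) = g u v - g X u * g X v

namespace IsAlmostContact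

variable {g : E →L[ℝ] E →L[ℝ] ℝ} {P : E →L[ℝ] E} {X : E}

lemma P_X (h : IsAlmostContact g P X) : P X = 0 := by
  by_contra hne
  have := h.pos _ hne
  rw [h.metric_P, h.X_X] at this
  norm_num at this

lemma X_P (h : IsAlmostContact g P X) (u : E) : g X (P u) = 0 := by
  have h1 := h.P_P (P u)
  rw [h.P_P u, map_add, map_neg, map_smul, h.P_X, smul_zero, add_zero, left_eq_add] at h1
  have h2 := congrArg (g X) h1
  simpa [h.X_X] using h2

lemma skew_P (h : IsAlmostContact g P X) (u v : E) : g (P u) v = -g u (P v) := by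
  have h1 := h.metric_P (P u) v
  rw [h.P_P, h.X_P] at h1
  simp only [map_add, map_neg, map_smul, add_apply, neg_apply, smul_apply, smul_eq_mul, h.X_P] at h1
  linarith

lemma eq_of_forall (h : IsAlmostContact g P X) {u v : E} (huv : ∀ z, g u z = g v z) : u = v := by
  by_contra hne
  have h1 := h.pos (u - v) (sub_ne_zero.mpr hne)
  simp only [map_sub, sub_apply] at h1
  have h2 := huv u
  have h3 := huv v
  linarith

/-- The pointwise linear algebra which computes the covariant derivatives of the structure tensors
of a Sasakian manifold. -/
lemma sasakian (h : IsAlmostContact g P X) {A : E → E → E} {B : E → E} (hA0 : ∀ u, A 0 u = 0)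
    (hA0' : ∀ u, A u 0 = 0) (hBn : ∀ u (a : ℝ), B (-u + a • X) = -B u + a • B X)
    (h1 : ∀ u w z, g (A u w) z + g w (A u z) = 0)
    (h2 : ∀ u w, A u (P w) + P (A u w) = g w (B u) • X + g X w • B u)
    (h3 : ∀ u w, g (B u) w - g (B w) u = 2 * g u (P w))
    (h4 : ∀ u w z, g (A u w) z + g (A w z) u + g (A z u) w = 0)
    (h5 : ∀ u w, A (P u) w - A (P w) u - P (A u w) + P (A w u) = -(2 * g u (P w)) • X) :
    (∀ u, B u = -P u) ∧ ∀ u w, A u w = g u w • X - g X w • u := by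
  have hs := h.symm
  -- Here `A u w` stands for (∇_u φ)w and `B u` for ∇_u ξ. The hypotheses `h1` and `h2` are the
  -- derivatives of the skewness of φ and of φ² = −1 + η ⊗ ξ, `h3` is the contact condition, `h4`
  -- says that the fundamental form is closed, and `h5` is normality. Pairing `h2` at w = ξ with ξ
  -- gives η(∇_u ξ) = 0.
  have hXB : ∀ u, g X (B u) = 0 := by
    intro u
    have := congrArg (g X) (h2 u X)
    simp only [h.P_X, hA0', map_add, map_zero, map_smul, smul_eq_mul, h.X_P, h.X_X] at this
    linarith
  have hAX : ∀ u, A u X = -P (B u) := by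
    intro u
    have e1 := h2 u X
    rw [h.P_X, hA0', zero_add, hXB, zero_smul, zero_add, h.X_X, one_smul] at e1
    have e2 : g X (A u X) = 0 := by
      have := h1 u X X
      rw [hs] at this
      linarith
    rw [← e1, h.P_P, e2]
    simp
  -- The contact condition with one argument ξ: the integral curves of ξ are geodesics.
  have hBX : ∀ u, g (B X) u = 0 := by
    intro u
    have := h3 u X
    rw [h.P_X, map_zero, hs, hXB] at this
    linarith
  have hAXu : ∀ w u, g (A X w) u = -g (P w) (B u) + g (P u) (B w) := by
    intro w u
    have e1 := h4 X w u
    have e2 := h1 w u X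
    rw [hAX] at e1 e2
    simp only [map_neg, neg_apply] at e1 e2
    have e3 := h.skew_P (B u) w
    have e4 := h.skew_P u (B w)
    have e5 := hs (B u) (P w)
    linarith
  -- Normality evaluated on (u, ξ), with ∇_ξ φ eliminated through `hAXu`.
  have hBP : ∀ u z, g (B (P u)) (P z) = -g (P u) z := by
    intro u z
    have e1 := congrArg (fun v => g v z) (h5 u X)
    simp only [h.P_X, hA0, hAX, map_zero, mul_zero, neg_zero, zero_smul, map_add, map_sub, map_neg,
      h.P_P, hXB, add_apply, neg_apply, sub_apply, zero_apply, zero_smul] at e1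
    have e2 := hAXu u (P z)
    have e3 := h.skew_P (A X u) z
    have e4 := h.skew_P (B (P u)) z
    have e5 := h3 (P u) (P z)
    rw [h.P_P z] at e2 e5
    simp only [map_add, map_neg, map_smul, add_apply, neg_apply, smul_apply, smul_eq_mul,
      hXB, hs _ X, h.X_P] at e2 e5
    have e6 := hs z (B u)
    have e7 := hs (P u) (B (P z))
    linarith
  -- P² = −1 + η ⊗ ξ removes P from both slots of `hBP`; the ξ-parts drop out because ∇_ξ ξ = 0 and
  -- η(∇_u ξ) = 0.
  have hB : ∀ u, B u = -P u := by
    intro u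
    refine h.eq_of_forall fun z => ?_
    have e1 := hBP (P u) (P z)
    have e2 : ∀ y, g (B u) (P y) = -g (P u) (P y) := by
      intro y
      have := hBP (P u) y
      rw [h.P_P, hBn] at this
      simp only [map_add, map_neg, map_smul, add_apply, neg_apply, smul_apply, smul_eq_mul, hBX]
        at this
      have e3 := h.skew_P (P u) y
      rw [h.P_P] at e3
      simp only [map_add, map_neg, map_smul, add_apply, neg_apply, smul_apply, smul_eq_mul] at e3
      linarith
    have e3 := e2 (P z)
    rw [h.P_P] at e3
    simp only [map_add, map_neg, map_smul, smul_eq_mul, hs _ X, hXB, h.X_P] at e3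
    simp only [map_neg, neg_apply]
    linarith
  refine ⟨hB, ?_⟩
  have hAX' : ∀ u z, g (A u X) z = -g u z + g X u * g X z := by
    intro u z
    rw [hAX, hB]
    simp [h.P_P]
  -- Closedness is used with P applied to one of the three vectors in turn. The identity `k`, from
  -- differentiating φ², and the skewness `sk` move P between slots, and normality `e5` eliminates
  -- the derivatives in the directions P u and P w. What survives is linear in the single unknown
  -- g((∇_z φ)u, Pw).
  have hd : ∀ z u w, g (A z u) (P w) = -(g X u * g z (P w)) := by
    intro z u w
    have e5 := congrArg (fun v => g v z) (h5 u w)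
    simp only [map_add, map_sub, add_apply, sub_apply, map_smul, smul_apply, smul_eq_mul,
      h.skew_P (A u w), h.skew_P (A w u)] at e5
    have k : ∀ u w z, g (A u (P w)) z - g (A u w) (P z)
        = -g w (P u) * g X z - g X w * g (P u) z := by
      intro u w z
      have := congrArg (fun v => g v z) (h2 u w)
      simp only [map_add, add_apply, map_smul, smul_apply, smul_eq_mul, h.skew_P (A u w), hB,
        map_neg, neg_apply] at this
      linarith
    have c1 := h4 (P u) w z
    have c2 := h4 (P w) u z
    have c3 := h4 (P z) u w
    have sk : ∀ u w z, g (A u w) z = -g (A u z) w := by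
      intro u w z
      have := h1 u w z
      rw [hs w] at this
      linarith
    have k1 := k u w z
    have k2 := k w u z
    have k3 := k u z w
    have k4 := k w z u
    have k5 := k z u w
    have k6 := k z w u
    have s1 := sk u w (P z)
    have s2 := sk w u (P z)
    have s3 := sk u z (P w)
    have s4 := sk w z (P u)
    have s5 := sk z u (P w)
    have s6 := sk z w (P u)
    have s7 := sk (P u) w z
    have s8 := sk (P w) u z
    have s9 := sk (P z) u w
    have s10 := sk w (P z) u
    have s11 := sk u (P z) w
    have s12 := sk z (P u) w
    have s13 := sk z (P w) u
    simp only [h.skew_P] at k1 k2 k3 k4 k5 k6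
    have t1 : g w (P u) = -g u (P w) := by rw [hs, h.skew_P]
    have t2 : g z (P u) = -g u (P z) := by rw [hs, h.skew_P]
    have t3 : g z (P w) = -g w (P z) := by rw [hs, h.skew_P]
    simp only [t1, t2, t3] at k1 k2 k3 k4 k5 k6 ⊢
    linarith
  intro u w
  refine h.eq_of_forall fun z => ?_
  -- P(Pz) equals −z up to a multiple of ξ, so `hd` gives every component of `A u w` once the
  -- ξ-component `e4` is known.
  have e1 := hd u w (P z)
  rw [h.P_P] at e1
  have e2 := h1 u w X
  have e3 := hAX' u w
  rw [hs w] at e2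
  simp only [map_add, map_neg, map_smul, smul_eq_mul, map_sub, sub_apply, smul_apply] at e1 ⊢
  rw [hs u X] at e1
  have e4 : g (A u w) X = g u w - g X u * g X w := by linarith
  rw [e4] at e1
  linarith

end IsAlmostContact

/-! ### Algebraic curvature tensors and their holomorphic sectional curvature -/

/-- The symmetries of a curvature tensor. -/
structure IsCurvatureLike (R : E → E → E → E → ℝ) : Prop where
  add₁ : ∀ u u' v w z, R (u + u') v w z = R u v w z + R u' v w z
  smul₁ : ∀ (a : ℝ) u v w z, R (a • u) v w z = a * R u v w z
  skew₁₂ : ∀ u v w z, R u v w z = -R v u w z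
  skew₃₄ : ∀ u v w z, R u v w z = -R u v z w
  bianchi : ∀ u v w z, R u v w z + R v w u z + R w u v z = 0

namespace IsCurvatureLike

variable {R : E → E → E → E → ℝ}

/-- The octahedron argument: a combination of the four Bianchi identities obtained by cyclically
permuting the four vectors. Linearity in the last three slots is deduced from this, which is why the
structure asks for it only in the first. -/
lemma pair_symm (h : IsCurvatureLike R) (u v w z : E) : R u v w z = R w z u v := by
  have b1 := h.bianchi u v w z
  have b2 := h.bianchi v w z u
  have b3 := h.bianchi w z u v
  have b4 := h.bianchi z u v w
  have s1 := h.skew₃₄ v w u z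
  have s2 := h.skew₃₄ w u v z
  have s3 := h.skew₁₂ w u z v
  have s4 := h.skew₃₄ u v z w
  have s5 := h.skew₁₂ z v w u
  have s6 := h.skew₃₄ v z w u
  have s7 := h.skew₃₄ w z v u
  have s8 := h.skew₁₂ u w z v
  have s9 := h.skew₃₄ z u w v
  have s10 := h.skew₁₂ v z u w
  linarith

lemma add₂ (h : IsCurvatureLike R) (u v v' w z : E) :
    R u (v + v') w z = R u v w z + R u v' w z := by
  rw [h.skew₁₂, h.add₁, h.skew₁₂ u v, h.skew₁₂ u v']
  ring

lemma add₃ (h : IsCurvatureLike R) (u v w w' z : E) :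
    R u v (w + w') z = R u v w z + R u v w' z := by
  rw [h.pair_symm, h.add₁, h.pair_symm u v, h.pair_symm u v]

lemma add₄ (h : IsCurvatureLike R) (u v w z z' : E) :
    R u v w (z + z') = R u v w z + R u v w z' := by
  rw [h.pair_symm, h.add₂, h.pair_symm u v, h.pair_symm u v]

lemma smul₂ (h : IsCurvatureLike R) (a : ℝ) (u v w z : E) : R u (a • v) w z = a * R u v w z := by
  rw [h.skew₁₂, h.smul₁, h.skew₁₂ u v]
  ring

lemma smul₃ (h : IsCurvatureLike R) (a : ℝ) (u v w z : E) : R u v (a • w) z = a * R u v w z := by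
  rw [h.pair_symm, h.smul₁, h.pair_symm u v]

lemma smul₄ (h : IsCurvatureLike R) (a : ℝ) (u v w z : E) : R u v w (a • z) = a * R u v w z := by
  rw [h.pair_symm, h.smul₂, h.pair_symm u v]

lemma neg₁ (h : IsCurvatureLike R) (u v w z : E) : R (-u) v w z = -R u v w z := by
  rw [← neg_one_smul ℝ u, h.smul₁]; ring

lemma neg₂ (h : IsCurvatureLike R) (u v w z : E) : R u (-v) w z = -R u v w z := by
  rw [← neg_one_smul ℝ v, h.smul₂]; ring

lemma neg₃ (h : IsCurvatureLike R) (u v w z : E) : R u v (-w) z = -R u v w z := by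
  rw [← neg_one_smul ℝ w, h.smul₃]; ring

lemma neg₄ (h : IsCurvatureLike R) (u v w z : E) : R u v w (-z) = -R u v w z := by
  rw [← neg_one_smul ℝ z, h.smul₄]; ring

variable {g : E →L[ℝ] E →L[ℝ] ℝ} {P : E →L[ℝ] E} {X : E}

/-- A curvature tensor of Kähler type, transverse to `X`, vanishes if its holomorphic sectional
curvature does. -/
lemma eq_zero_of_holomorphic (h : IsCurvatureLike R) (hP : IsAlmostContact g P X)
    (hX : ∀ u v z, R u v X z = 0)
    (hK : ∀ u v w z, R u v (P w) z + R u v w (P z) = 0)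
    (hH : ∀ u, R u (P u) (P u) u = 0) (u w z : E) : R w u u z = 0 := by
  have hX1 : ∀ u v w, R X u v w = 0 := fun u v w => by rw [h.pair_symm, hX]
  have hX2 : ∀ u v w, R u X v w = 0 := fun u v w => by rw [h.skew₁₂, hX1, neg_zero]
  have hX4 : ∀ u v w, R u v w X = 0 := fun u v w => by rw [h.skew₃₄, hX, neg_zero]
  have hJ34 : ∀ u v w z, R u v (P w) (P z) = R u v w z := by
    intro u v w z
    have := hK u v w (P z)
    rw [hP.P_P, h.add₄, h.neg₄, h.smul₄, hX4] at this
    linarith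
  have hJ12 : ∀ u v w z, R (P u) (P v) w z = R u v w z := by
    intro u v w z
    rw [h.pair_symm, hJ34, h.pair_symm]
  have hPP1 : ∀ u v w z, R (P (P u)) v w z = -R u v w z := by
    intro u v w z
    rw [hP.P_P, h.add₁, h.neg₁, h.smul₁, hX1]; ring
  have hPP2 : ∀ u v w z, R u (P (P v)) w z = -R u v w z := by
    intro u v w z
    rw [hP.P_P, h.add₂, h.neg₂, h.smul₂, hX2]; ring
  have hPP3 : ∀ u v w z, R u v (P (P w)) z = -R u v w z := by
    intro u v w z
    rw [hP.P_P, h.add₃, h.neg₃, h.smul₃, hX]; ring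
  -- Adding the hypothesis at x + y and x − y isolates the terms quadratic in each of x and y. `f1`
  -- to `f5` express them through R(x,y,y,x) and R(x,Py,Py,x), using invariance under P and the
  -- Bianchi identity.
  have key : ∀ x y, R x y y x = -3 * R x (P y) (P y) x := by
    intro x y
    have e1 := hH (x + y)
    have e2 := hH (x + -y)
    have e3 := hH x
    have e4 := hH y
    simp only [map_add, map_neg, h.add₁, h.add₂, h.add₃, h.add₄, h.neg₁, h.neg₂, h.neg₃, h.neg₄]
      at e1 e2
    have f1 : R y (P x) (P x) y = R x (P y) (P y) x := by
      rw [← hJ12, ← hJ34, hPP2, hPP3, h.skew₁₂, h.skew₃₄]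
      ring
    have f2 : R x (P y) (P x) y = R x (P y) (P y) x := by
      rw [← hJ34, hPP3, h.skew₃₄]
      ring
    have f3 : R y (P x) (P y) x = R x (P y) (P y) x := by
      rw [← hJ34, hPP3, h.skew₃₄, f1]
      ring
    have f4 : R x (P x) (P y) y = R x y y x + R x (P y) (P y) x := by
      have b := h.bianchi x (P x) (P y) y
      rw [hJ12 x y x y, h.skew₃₄ x y x y, h.skew₁₂ (P y) x (P x) y, f2] at b
      linarith
    have f5 : R y (P y) (P x) x = R x (P x) (P y) y := by
      rw [h.pair_symm, h.skew₁₂, h.skew₃₄]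
      ring
    linarith
  -- Applying `key` to y and then to Py, where P² acts as −1 inside R, gives R(x,y,y,x) = 9
  -- R(x,y,y,x).
  have hzero : ∀ x y, R x y y x = 0 := by
    intro x y
    have e1 := key x y
    have e2 := key x (P y)
    rw [hPP2, hPP3] at e2
    linarith
  -- Polarization of the vanishing sectional curvature in the outer vector.
  have e1 := hzero (w + z) u
  simp only [h.add₁, h.add₄, hzero] at e1
  have e2 : R z u u w = R w u u z := by
    rw [h.pair_symm, h.skew₁₂, h.skew₃₄]
    ring
  linarith

/-- The curvature of a Sasakian space form. -/
lemma sasakian_space_form (h : IsCurvatureLike R) (hP : IsAlmostContact g P X) {c : ℝ}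
    (hX : ∀ u v z, R u v X z = g X v * g u z - g X u * g v z)
    (hK : ∀ u v w z, R u v (P w) z + R u v w (P z) = -(g v w * g (P u) z) + g (P u) w * g v z
      + g u w * g (P v) z - g (P v) w * g u z)
    (hc : ∀ u, g X u = 0 → g u u = 1 → R u (P u) (P u) u = c) {u w : E} (hu : g X u = 0)
    (hw : g X w = 0) (z : E) : R w u u z = (c + 3) / 4 * (g u u * g w z - g w u * g u z)
      + 3 * (c - 1) / 4 * (g w (P u) * g (P u) z) := by
  -- The model curvature of constant φ-sectional curvature c. It shares with R the values on ξ and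
  -- the failure to commute with φ, so R − R₀ satisfies the hypotheses of `eq_zero_of_holomorphic`.
  set R₀ : E → E → E → E → ℝ := fun x y z w =>
    (c + 3) / 4 * (g y z * g x w - g x z * g y w) + (c - 1) / 4 * (g X x * g X z * g y w
      - g X y * g X z * g x w + g x z * g X y * g X w - g y z * g X x * g X w
      + g z (P y) * g (P x) w - g z (P x) * g (P y) w + 2 * g x (P y) * g (P z) w) with hR₀
  have hs := hP.symm
  have hsk := hP.skew_P
  have hsk' : ∀ a b, g a (P b) = -g b (P a) := fun a b => by rw [hs, hsk]
  have hT : IsCurvatureLike (fun x y z w => R x y z w - R₀ x y z w) := by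
    constructor
    · intro u u' v w z
      simp only [hR₀, h.add₁, map_add, add_apply]
      ring
    · intro a u v w z
      simp only [hR₀, h.smul₁, map_smul, smul_apply, smul_eq_mul]
      ring
    · intro u v w z
      simp only [hR₀]
      rw [h.skew₁₂, hsk' v u]
      ring
    · intro u v w z
      simp only [hR₀, hsk]
      have := h.skew₃₄ u v w z
      have e1 := hsk' w v
      have e2 := hsk' w u
      have e3 := hsk' z v
      have e4 := hsk' z u
      rw [this, e1, e2, e3, e4, hsk' z w]
      ring
    · intro u v w z
      have := h.bianchi u v w z
      simp only [hR₀, hsk]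
      rw [hs w u, hs v u, hs w v, hsk' w v, hsk' w u, hsk' v u]
      linarith
  have hTX : ∀ u v z, R u v X z - R₀ u v X z = 0 := by
    intro u v z
    simp only [hR₀, hX, hs _ X, hP.X_X, hP.X_P, hP.P_X, map_zero, zero_apply]
    ring
  have hTH : ∀ u, R u (P u) (P u) u - R₀ u (P u) (P u) u = 0 := by
    have hunit : ∀ u, g X u = 0 → g u u = 1 → R u (P u) (P u) u - R₀ u (P u) (P u) u = 0 := by
      intro u hu hu1
      rw [hc u hu hu1]
      have e0 : g u (P u) = 0 := by
        have := hsk' u u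
        linarith
      simp only [hR₀, hP.P_P, hP.X_P, hu, hsk, map_neg, hu1, e0,
        zero_smul, add_zero]
      ring
    intro u
    -- The hypothesis on c covers only unit vectors orthogonal to ξ. The ξ-component does not
    -- contribute, since R − R₀ is transverse and Pξ = 0, and homogeneity handles the length.
    set d := u + (-(g X u)) • X with hd
    have hXd : g X d = 0 := by
      simp [hd, hP.X_X]
    have hPd : P d = P u := by
      simp [hd, hP.P_X]
    have hTX1 : ∀ v w z, R X v w z - R₀ X v w z = 0 := fun v w z => by
      rw [hT.pair_symm, hTX]
    have hTX4 : ∀ v w z, R v w z X - R₀ v w z X = 0 := fun v w z => by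
      rw [hT.skew₃₄, hTX, neg_zero]
    have hud : R u (P u) (P u) u - R₀ u (P u) (P u) u = R d (P d) (P d) d - R₀ d (P d) (P d) d := by
      rw [hPd, hd, hT.add₁, hT.smul₁, hTX1, hT.add₄, hT.smul₄, hTX4]
      ring
    rw [hud]
    by_cases hd0 : d = 0
    · have := hT.smul₁ 0 d (P d) (P d) d
      rw [hd0, smul_zero, zero_mul] at this
      rw [hd0, this]
    · have hpos := hP.pos d hd0
      set r := Real.sqrt (g d d) with hr
      have hr0 : r ≠ 0 := (Real.sqrt_pos.mpr hpos).ne'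
      have hrr : r * r = g d d := Real.mul_self_sqrt hpos.le
      have e1 := hunit (r⁻¹ • d) (by simp [hXd]) (by
        simp only [map_smul, smul_apply, smul_eq_mul, ← hrr]
        field_simp)
      rw [map_smul, hT.smul₁, hT.smul₂, hT.smul₃, hT.smul₄] at e1
      simpa [hr0] using e1
  have hfin := hT.eq_zero_of_holomorphic hP hTX ?_ hTH u w z
  · have e0 : g u (P u) = 0 := by
      have := hsk' u u
      linarith
    simp only [hR₀, hu, hw, e0] at hfin
    rw [hsk' u w] at hfin
    linarith
  · intro u v w z
    have := hK u v w z
    simp only [hR₀, hP.X_P, hP.P_P, hsk, map_add, map_neg, map_smul, smul_eq_mul, hs _ X] at this ⊢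
    rw [hsk' w v, hsk' w u]
    have e1 := hs w u
    have e2 := hs w v
    rw [e1, e2]
    linarith

end IsCurvatureLike

end Algebra

end SesquiHarmonic

namespace SesquiHarmonic

/-! ### Sasakian structures in coordinates -/

section LocalSasakian

variable {E : Type*} [NormedAddCommGroup E] [NormedSpace ℝ E]

lemma isCurvatureLike_curvRep {G : E → E →L[ℝ] E →L[ℝ] ℝ} {Γ : E → E →L[ℝ] E →L[ℝ] E} {p : E}
    (hG : ContDiffAt ℝ ∞ G p) (hΓ : DifferentiableAt ℝ Γ p)
    (hs : ∀ᶠ q in 𝓝 p, ∀ u w, Γ q u w = Γ q w u)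
    (hm : ∀ᶠ q in 𝓝 p, ∀ u v w, fderiv ℝ G q u v w = G q (Γ q u v) w + G q v (Γ q u w))
    (hGs : ∀ u v, G p u v = G p v u) :
    IsCurvatureLike (fun u v w z => G p (curvRep Γ p u v w) z) where
  add₁ u u' v w z := by
    simp only [curvRep, map_add, map_sub, add_apply, sub_apply]
    ring
  smul₁ a u v w z := by
    simp only [curvRep, map_add, map_sub, map_smul, smul_apply, add_apply, sub_apply, smul_eq_mul]
    ring
  skew₁₂ u v w z := by
    rw [curvRep_swap, map_neg, neg_apply]
  skew₃₄ u v w z := by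
    have := curvRep_metric hG hΓ hm u v w z
    rw [hGs w] at this
    linarith
  bianchi u v w z := by
    have := curvRep_bianchi hΓ hs u v w
    rw [← add_apply, ← add_apply, ← map_add, ← map_add, this]
    simp

/-- A Sasakian structure `(G, P, X)` on an open subset of a vector space, with the Christoffel
symbols `Γ` of its Levi-Civita connection. -/
structure IsLocalSasakian (G : E → E →L[ℝ] E →L[ℝ] ℝ) (Γ : E → E →L[ℝ] E →L[ℝ] E)
    (P : E → E →L[ℝ] E) (X : E → E) (U : Set E) : Prop where
  isOpen : IsOpen U
  smooth_G : ∀ p ∈ U, ContDiffAt ℝ ∞ G p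
  smooth_Γ : ∀ p ∈ U, ContDiffAt ℝ ∞ Γ p
  smooth_P : ∀ p ∈ U, ContDiffAt ℝ ∞ P p
  smooth_X : ∀ p ∈ U, ContDiffAt ℝ ∞ X p
  almostContact : ∀ p ∈ U, IsAlmostContact (G p) (P p) (X p)
  symm : ∀ p ∈ U, ∀ u w, Γ p u w = Γ p w u
  metric : ∀ p ∈ U, ∀ u v w, fderiv ℝ G p u v w = G p (Γ p u v) w + G p v (Γ p u w)
  contact : ∀ p ∈ U, ∀ u w, fderiv ℝ (fun q => G q (X q) w) p u -
    fderiv ℝ (fun q => G q (X q) u) p w = 2 * G p u (P p w)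
  normal : ∀ p ∈ U, ∀ u w, fderiv ℝ P p (P p u) w - fderiv ℝ P p (P p w) u
    - P p (fderiv ℝ P p u w) + P p (fderiv ℝ P p w u) = -(2 * G p u (P p w)) • X p

namespace IsLocalSasakian

variable {G : E → E →L[ℝ] E →L[ℝ] ℝ} {Γ : E → E →L[ℝ] E →L[ℝ] E} {P : E → E →L[ℝ] E}
  {X : E → E} {U : Set E} {p : E}

lemma eventually_mem (h : IsLocalSasakian G Γ P X U) (hp : p ∈ U) : ∀ᶠ q in 𝓝 p, q ∈ U :=
  h.isOpen.mem_nhds hp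

lemma diff_G (h : IsLocalSasakian G Γ P X U) (hp : p ∈ U) : DifferentiableAt ℝ G p :=
  (h.smooth_G p hp).differentiableAt (by simp)

lemma diff_Γ (h : IsLocalSasakian G Γ P X U) (hp : p ∈ U) : DifferentiableAt ℝ Γ p :=
  (h.smooth_Γ p hp).differentiableAt (by simp)

lemma diff_P (h : IsLocalSasakian G Γ P X U) (hp : p ∈ U) : DifferentiableAt ℝ P p :=
  (h.smooth_P p hp).differentiableAt (by simp)

lemma diff_X (h : IsLocalSasakian G Γ P X U) (hp : p ∈ U) : DifferentiableAt ℝ X p :=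
  (h.smooth_X p hp).differentiableAt (by simp)

lemma fderiv_P_apply (h : IsLocalSasakian G Γ P X U) (hp : p ∈ U) (u w : E) :
    fderiv ℝ (fun q => P q w) p u = fderiv ℝ P p u w := by
  have := fderiv_apply₁ (h.diff_P hp) (differentiableAt_const w) u
  simpa using this

lemma diff_P_apply (h : IsLocalSasakian G Γ P X U) (hp : p ∈ U) (w : E) :
    DifferentiableAt ℝ (fun q => P q w) p := (h.diff_P hp).clm_apply (differentiableAt_const w)

lemma fderiv_inner (h : IsLocalSasakian G Γ P X U) (hp : p ∈ U) {a b : E → E}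
    (ha : DifferentiableAt ℝ a p) (hb : DifferentiableAt ℝ b p) (u : E) :
    fderiv ℝ (fun q => G q (a q) (b q)) p u =
      G p (fderiv ℝ a p u + Γ p u (a p)) (b p) + G p (a p) (fderiv ℝ b p u + Γ p u (b p)) := by
  rw [fderiv_apply₂ (h.diff_G hp) ha hb, h.metric p hp]
  simp only [map_add, add_apply]
  ring

lemma fderiv_eta (h : IsLocalSasakian G Γ P X U) (hp : p ∈ U) (u w : E) :
    fderiv ℝ (fun q => G q (X q) w) p u =
      G p (fderiv ℝ X p u + Γ p u (X p)) w + G p (X p) (Γ p u w) := by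
  rw [h.fderiv_inner hp (h.diff_X hp) (differentiableAt_const w)]
  simp

/-- By the contact condition the fundamental form g(u, φw) is dη, so its cyclic sum of derivatives
cancels by symmetry of the second derivatives of the coefficients of η. -/
lemma cyclic (h : IsLocalSasakian G Γ P X U) (hp : p ∈ U) (u w z : E) :
    fderiv ℝ (fun q => G q u (P q w)) p z + fderiv ℝ (fun q => G q w (P q z)) p u +
      fderiv ℝ (fun q => G q z (P q u)) p w = 0 := by
  have hη : ∀ w, ContDiffAt ℝ ∞ (fun q => G q (X q) w) p := fun w =>
    ((h.smooth_G p hp).clm_apply (h.smooth_X p hp)).clm_apply contDiffAt_const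
  have hsymm : ∀ w, IsSymmSndFDerivAt ℝ (fun q => G q (X q) w) p := fun w =>
    (hη w).isSymmSndFDerivAt (by rw [minSmoothness_of_isRCLikeNormedField]; exact ENat.LEInfty.out)
  have hdd : ∀ w, DifferentiableAt ℝ (fderiv ℝ (fun q => G q (X q) w)) p := fun w =>
    ((hη w).fderiv_right (m := ∞) (by simp)).differentiableAt (by simp)
  have key : ∀ u w z, fderiv ℝ (fun q => G q u (P q w)) p z =
      (1 / 2) * (fderiv ℝ (fderiv ℝ (fun q => G q (X q) w)) p z u -
        fderiv ℝ (fderiv ℝ (fun q => G q (X q) u)) p z w) := by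
    intro u w z
    have e : (fun q => G q u (P q w)) =ᶠ[𝓝 p] fun q => (1 / 2 : ℝ) *
        (fderiv ℝ (fun q => G q (X q) w) q u - fderiv ℝ (fun q => G q (X q) u) q w) := by
      filter_upwards [h.eventually_mem hp] with q hq
      rw [h.contact q hq]
      ring
    have d1 : ∀ u w, DifferentiableAt ℝ (fun q => fderiv ℝ (fun q => G q (X q) w) q u) p :=
      fun u w => (hdd w).clm_apply (differentiableAt_const u)
    rw [e.fderiv_eq, fderiv_const_mul ((d1 u w).fun_sub (d1 w u)), fderiv_fun_sub (d1 u w) (d1 w u)]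
    simp only [smul_apply, sub_apply, smul_eq_mul]
    rw [fderiv_apply₁ (hdd w) (differentiableAt_const u),
      fderiv_apply₁ (hdd u) (differentiableAt_const w)]
    simp
  rw [key, key, key, (hsymm w) z u, (hsymm z) u w, (hsymm u) w z]
  ring

/-- These are ∇ξ = −φ and (∇_uφ)w = g(u,w)ξ − η(w)u. The hypotheses of `IsAlmostContact.sasakian`
come from differentiating the almost contact identities and from contact, closedness and normality.
In the last three the symmetry of `Γ` lets partial derivatives be replaced by covariant ones. -/
lemma structure_equations (h : IsLocalSasakian G Γ P X U) (hp : p ∈ U) :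
    (∀ u, fderiv ℝ X p u + Γ p u (X p) = -P p u) ∧
      ∀ u w, fderiv ℝ P p u w + Γ p u (P p w) - P p (Γ p u w) =
        G p u w • X p - G p (X p) w • u := by
  have hac := h.almostContact p hp
  have hev := h.eventually_mem hp
  have hs := hac.symm
  refine IsAlmostContact.sasakian hac (A := fun u w => fderiv ℝ P p u w + Γ p u (P p w)
    - P p (Γ p u w)) (B := fun u => fderiv ℝ X p u + Γ p u (X p)) ?_ ?_ ?_ ?_ ?_ ?_ ?_ ?_
  · intro u
    simp
  · intro u
    simp
  · intro u a
    simp only [map_add, map_neg, map_smul, add_apply, neg_apply, smul_apply, smul_add, neg_add]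
    abel
  · intro u w z
    have e : (fun q => G q (P q w) z + G q w (P q z)) =ᶠ[𝓝 p] fun _ => (0 : ℝ) := by
      filter_upwards [hev] with q hq
      rw [(h.almostContact q hq).skew_P]
      ring
    have e1 : fderiv ℝ (fun q => G q (P q w) z + G q w (P q z)) p u = 0 := by
      rw [e.fderiv_eq]
      simp
    rw [fderiv_fun_add (((h.diff_G hp).clm_apply (h.diff_P_apply hp w)).clm_apply
      (differentiableAt_const z)) (((h.diff_G hp).clm_apply (differentiableAt_const w)).clm_apply
      (h.diff_P_apply hp z)), add_apply,
      h.fderiv_inner hp (h.diff_P_apply hp w) (differentiableAt_const z),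
      h.fderiv_inner hp (differentiableAt_const w) (h.diff_P_apply hp z),
      h.fderiv_P_apply hp, h.fderiv_P_apply hp] at e1
    have k1 := hac.skew_P (Γ p u w) z
    have k2 := hac.skew_P w (Γ p u z)
    simp only [map_add, map_sub, add_apply, sub_apply, fderiv_fun_const, Pi.zero_apply, zero_apply,
      zero_add] at e1 ⊢
    linarith
  · intro u w
    have e : (fun q => P q (P q w)) =ᶠ[𝓝 p] fun q => -w + G q (X q) w • X q := by
      filter_upwards [hev] with q hq
      exact (h.almostContact q hq).P_P w
    have hη : DifferentiableAt ℝ (fun q => G q (X q) w) p :=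
      ((h.diff_G hp).clm_apply (h.diff_X hp)).clm_apply (differentiableAt_const w)
    have e1 : fderiv ℝ (fun q => P q (P q w)) p u = fderiv ℝ (fun q => G q (X q) w) p u • X p
        + G p (X p) w • fderiv ℝ X p u := by
      rw [e.fderiv_eq, fderiv_const_add, fderiv_fun_smul hη (h.diff_X hp)]
      simp only [add_apply, smul_apply, ContinuousLinearMap.smulRight_apply]
      rw [add_comm]
    rw [fderiv_apply₁ (h.diff_P hp) (h.diff_P_apply hp w), h.fderiv_P_apply hp,
      h.fderiv_eta hp] at e1
    have k1 := hac.P_P w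
    have k2 := hac.P_P (Γ p u w)
    have e2 : fderiv ℝ P p u (P p w) = (G p (fderiv ℝ X p u + Γ p u (X p)) w
        + G p (X p) (Γ p u w)) • X p + G p (X p) w • fderiv ℝ X p u
        - P p (fderiv ℝ P p u w) := by
      rw [← e1]
      abel
    simp only [map_sub, map_add, e2, k1, k2, map_neg, map_smul, add_apply, hs w]
    module
  · intro u w
    have := h.contact p hp u w
    rw [h.fderiv_eta hp, h.fderiv_eta hp, h.symm p hp w u] at this
    linarith
  · intro u w z
    have key : ∀ u w z, fderiv ℝ (fun q => G q u (P q w)) p z =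
        G p (Γ p z u) (P p w) + G p u (fderiv ℝ P p z w + Γ p z (P p w)) := by
      intro u w z
      rw [h.fderiv_inner hp (differentiableAt_const u) (h.diff_P_apply hp w), h.fderiv_P_apply hp]
      simp
    have e := h.cyclic hp z w u
    rw [key, key, key] at e
    have k1 := hac.skew_P (Γ p u w) z
    have k2 := hac.skew_P (Γ p w z) u
    have k3 := hac.skew_P (Γ p z u) w
    have s1 := h.symm p hp u z
    have s2 := h.symm p hp w u
    have s3 := h.symm p hp z w
    simp only [map_add, map_sub, add_apply, sub_apply, s1, s2, s3, hs z, hs u (fderiv ℝ P p _ _),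
      hs w (fderiv ℝ P p _ _), hs u (Γ p _ (P p _)), hs w (Γ p _ (P p _))] at *
    linarith
  · intro u w
    rw [← h.normal p hp u w]
    have s1 := h.symm p hp (P p u) (P p w)
    have s2 := h.symm p hp (P p u) w
    have s3 := h.symm p hp (P p w) u
    have s4 := h.symm p hp u w
    simp only [map_add, map_sub, s1, s2, s3, s4]
    abel

/-- A vector field is a field along the identity map, so `dcov_dcov_sub` also yields the commutator
formula for vector fields. -/
lemma dcov_id (v : E → E) (d q : E) : dcov Γ id v d q = fderiv ℝ v q d + Γ q d (v q) := by
  simp [dcov]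

/-- Differentiating ∇ξ = −φ once more and inserting the formula for ∇φ; antisymmetrizing removes the
Christoffel term and the multiple of ξ. -/
lemma curvRep_X (h : IsLocalSasakian G Γ P X U) (hp : p ∈ U) (a b : E) :
    curvRep Γ p a b (X p) = G p (X p) b • a - G p (X p) a • b := by
  have key : ∀ a b, dcov Γ id (dcov Γ id X b) a p =
      -(G p a b • X p - G p (X p) b • a + P p (Γ p a b)) := by
    intro a b
    have e : dcov Γ id X b =ᶠ[𝓝 p] fun q => -P q b := by
      filter_upwards [h.eventually_mem hp] with q hq
      rw [dcov_id, (h.structure_equations hq).1]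
    rw [dcov_id, e.fderiv_eq, e.eq_of_nhds, ← (h.structure_equations hp).2, fderiv_fun_neg,
      neg_apply, h.fderiv_P_apply hp, map_neg]
    abel
  have := dcov_dcov_sub (c := id) (q := p) contDiffAt_id (h.smooth_X p hp) (h.diff_Γ hp) a b
  simp only [fderiv_id, id, ContinuousLinearMap.coe_id'] at this
  rw [← this, key, key, (h.almostContact p hp).symm b a, h.symm p hp b a]
  module

/-- The Ricci identity for φ. The coordinate field q ↦ φw with w constant is differentiated twice by
the structure equations; on antisymmetrizing, the second derivative of φw contributes the left side,
and the terms containing derivatives and products of `Γ` assemble to φ(R(a,b)w). -/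
lemma curvRep_P (h : IsLocalSasakian G Γ P X U) (hp : p ∈ U) (a b w : E) :
    curvRep Γ p a b (P p w) = P p (curvRep Γ p a b w) - G p b w • P p a + G p (P p a) w • b
      + G p a w • P p b - G p (P p b) w • a := by
  have hac := h.almostContact p hp
  have key : ∀ a b, dcov Γ id (dcov Γ id (fun q => P q w) b) a p =
      (G p (Γ p a b) w + G p b (Γ p a w)) • X p - G p b w • P p a
      - (-G p (P p a) w + G p (X p) (Γ p a w)) • b - G p (X p) w • Γ p a b
      + (G p a (Γ p b w) • X p - G p (X p) (Γ p b w) • a + P p (Γ p a (Γ p b w)))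
      + P p (fderiv ℝ Γ p a b w) := by
    intro a b
    have e : dcov Γ id (fun q => P q w) b =ᶠ[𝓝 p] fun q =>
        G q b w • X q - G q (X q) w • b + P q (Γ q b w) := by
      filter_upwards [h.eventually_mem hp] with q hq
      rw [dcov_id, h.fderiv_P_apply hq, ← (h.structure_equations hq).2]
      abel
    have d1 : DifferentiableAt ℝ (fun q => G q b w) p :=
      ((h.diff_G hp).clm_apply (differentiableAt_const b)).clm_apply (differentiableAt_const w)
    have d2 : DifferentiableAt ℝ (fun q => G q (X q) w) p :=
      ((h.diff_G hp).clm_apply (h.diff_X hp)).clm_apply (differentiableAt_const w)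
    have d3 : DifferentiableAt ℝ (fun q => Γ q b w) p :=
      ((h.diff_Γ hp).clm_apply (differentiableAt_const b)).clm_apply (differentiableAt_const w)
    have f1 : fderiv ℝ (fun q => G q b w) p a = G p (Γ p a b) w + G p b (Γ p a w) := by
      rw [h.fderiv_inner hp (differentiableAt_const b) (differentiableAt_const w)]
      simp
    have f3 : fderiv ℝ (fun q => Γ q b w) p a = fderiv ℝ Γ p a b w := by
      rw [fderiv_apply₂ (h.diff_Γ hp) (differentiableAt_const b) (differentiableAt_const w)]
      simp
    have k1 : fderiv ℝ X p a = -P p a - Γ p a (X p) := by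
      rw [← (h.structure_equations hp).1]
      abel
    have k2 : fderiv ℝ P p a (Γ p b w) = G p a (Γ p b w) • X p - G p (X p) (Γ p b w) • a
        - Γ p a (P p (Γ p b w)) + P p (Γ p a (Γ p b w)) := by
      rw [← (h.structure_equations hp).2]
      abel
    rw [dcov_id, e.fderiv_eq, e.eq_of_nhds, fderiv_fun_add ((d1.fun_smul (h.diff_X hp)).fun_sub
      (d2.fun_smul (differentiableAt_const b))) ((h.diff_P hp).clm_apply d3),
      fderiv_fun_sub (d1.fun_smul (h.diff_X hp)) (d2.fun_smul (differentiableAt_const b)),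
      fderiv_fun_smul d1 (h.diff_X hp), fderiv_fun_smul d2 (differentiableAt_const b)]
    simp only [add_apply, sub_apply, smul_apply, ContinuousLinearMap.smulRight_apply]
    rw [fderiv_apply₁ (h.diff_P hp) d3, f1, h.fderiv_eta hp, f3,
      (h.structure_equations hp).1, k1, k2]
    simp only [fderiv_fun_const, Pi.zero_apply, zero_apply, map_add, map_sub, map_smul, map_neg,
      neg_apply]
    module
  have := dcov_dcov_sub (c := id) (q := p) contDiffAt_id
    ((h.smooth_P p hp).clm_apply (contDiffAt_const (c := w))) (h.diff_Γ hp) a b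
  simp only [fderiv_id, id, ContinuousLinearMap.coe_id'] at this
  rw [← this, key, key, h.symm p hp b a, curvRep]
  simp only [map_add, map_sub]
  module

lemma isCurvatureLike (h : IsLocalSasakian G Γ P X U) (hp : p ∈ U) :
    IsCurvatureLike (fun u v w z => G p (curvRep Γ p u v w) z) :=
  isCurvatureLike_curvRep (h.smooth_G p hp) (h.diff_Γ hp)
    ((h.eventually_mem hp).mono fun q hq => h.symm q hq)
    ((h.eventually_mem hp).mono fun q hq => h.metric q hq) (h.almostContact p hp).symm

/-- The curvature of a Sasakian space form in coordinates. -/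
lemma curvRep_space_form (h : IsLocalSasakian G Γ P X U) (hp : p ∈ U) {c : ℝ}
    (hc : ∀ u, G p (X p) u = 0 → G p u u = 1 → G p (curvRep Γ p u (P p u) (P p u)) u = c)
    {u w : E} (hu : G p (X p) u = 0) (hw : G p (X p) w = 0) (z : E) :
    G p (curvRep Γ p w u u) z = (c + 3) / 4 * (G p u u * G p w z - G p w u * G p u z)
      + 3 * (c - 1) / 4 * (G p w (P p u) * G p (P p u) z) := by
  have hac := h.almostContact p hp
  refine IsCurvatureLike.sasakian_space_form (h.isCurvatureLike hp) hac ?_ ?_ hc hu hw z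
  · intro u v z
    rw [h.curvRep_X hp]
    simp
  · intro u v w z
    rw [h.curvRep_P hp]
    have := hac.skew_P (curvRep Γ p u v w) z
    simp only [map_add, map_sub, map_smul, add_apply, sub_apply, smul_apply, smul_eq_mul]
    linarith

end IsLocalSasakian

end LocalSasakian

end SesquiHarmonic

namespace SesquiHarmonic

/-! ### The Sasakian structure of the manifold read in charts -/

section SasakianManifold

variable {E : Type*} [NormedAddCommGroup E] [NormedSpace ℝ E] [FiniteDimensional ℝ E]
  {M : Type*} [TopologicalSpace M] [ChartedSpace E M] [IsManifold 𝓘(ℝ, E) ∞ M]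
  [RiemannianBundle (fun x : M => TangentSpace 𝓘(ℝ, E) x)]
  {cov : CovariantDerivative 𝓘(ℝ, E) E (TangentSpace 𝓘(ℝ, E) : M → Type _)} {x₀ : M}

namespace AlmostContactMetric

variable (S : AlmostContactMetric 𝓘(ℝ, E) M)

/-- From φ²ξ = 0 and the formula for φ² at φξ one gets φξ = η(φξ)ξ. Applying φ again gives η(φξ)φξ =
0, and either factor being zero suffices. This has to precede `η_eq_inner`, whose proof uses it. -/
lemma φ_ξ (x : M) : S.φ x (S.ξ x) = 0 := by
  have h1 : S.φ x (S.φ x (S.ξ x)) = 0 := by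
    rw [S.φ_φ, S.η_ξ]
    simp
  have h2 := S.φ_φ x (S.φ x (S.ξ x))
  rw [h1, map_zero] at h2
  have h3 := congrArg (S.φ x) h2
  rw [map_zero, map_add, map_neg, map_smul, h1] at h3
  have h4 : S.η x (S.φ x (S.ξ x)) = 0 ∨ S.φ x (S.ξ x) = 0 := by
    simpa [eq_comm (a := (0 : TangentSpace 𝓘(ℝ, E) x))] using h3
  rcases h4 with h4 | h4
  · rw [h4] at h2
    simpa using h2
  · exact h4

lemma η_eq_inner (x : M) (u : TangentSpace 𝓘(ℝ, E) x) : S.η x u = inner ℝ (S.ξ x) u := by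
  have h := S.metric_φ x (S.ξ x) u
  rw [S.φ_ξ, inner_zero_left, S.η_ξ] at h
  linarith

lemma inner_ξ_ξ (x : M) : inner ℝ (S.ξ x) (S.ξ x) = (1 : ℝ) := by
  rw [← S.η_eq_inner, S.η_ξ]

/-- The coordinates of the structure tensor. -/
def phiRep (x₀ : M) (p : E) : E →L[ℝ] E :=
  toCoord x₀ ((chartAt E x₀).symm p) ∘L S.φ ((chartAt E x₀).symm p) ∘L
    ofCoord x₀ ((chartAt E x₀).symm p)

lemma toCoord_φ {y : M} (hy : y ∈ (chartAt E x₀).source) (u : TangentSpace 𝓘(ℝ, E) y) :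
    toCoord x₀ y (S.φ y u) = S.phiRep x₀ (chartAt E x₀ y) (toCoord x₀ y u) := by
  simp only [phiRep, ContinuousLinearMap.comp_apply]
  rw [chart_symm_chart hy, ofCoord_toCoord hy]

variable [IsContMDiffRiemannianBundle 𝓘(ℝ, E) ∞ E (fun x : M => TangentSpace 𝓘(ℝ, E) x)]

lemma contMDiffAt_φ_constField {y : M} (hy : y ∈ (chartAt E x₀).source) (u : E) :
    ContMDiffAt 𝓘(ℝ, E) 𝓘(ℝ, E).tangent ∞
      (fun y => (⟨y, S.φ y (constField x₀ u y)⟩ : TangentBundle 𝓘(ℝ, E) M)) y :=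
  ContMDiffAt.clm_bundle_apply (E₁ := (TangentSpace 𝓘(ℝ, E) : M → Type _))
    (E₂ := (TangentSpace 𝓘(ℝ, E) : M → Type _)) (S.smooth_φ y) (contMDiffAt_constField hy u)

lemma contDiffAt_phiRep {p : E} (hp : p ∈ (chartAt E x₀).target) :
    ContDiffAt ℝ ∞ (S.phiRep x₀) p := by
  have h : ContDiffOn ℝ ∞ (S.phiRep x₀) (chartAt E x₀).target := by
    rw [contDiffOn_clm_apply]
    intro u q hq
    have hy := (chartAt E x₀).map_target hq
    have h := (contMDiffAt_field_iff le_rfl hy).mp (S.contMDiffAt_φ_constField hy u)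
    rw [(chartAt E x₀).right_inv hq] at h
    exact h.contDiffWithinAt
  exact h.contDiffAt ((chartAt E x₀).open_target.mem_nhds hp)

lemma contDiffAt_xiRep {p : E} (hp : p ∈ (chartAt E x₀).target) :
    ContDiffAt ℝ ∞ (fieldRep x₀ S.ξ) p := by
  have hy := (chartAt E x₀).map_target hp
  have h := (contMDiffAt_field_iff le_rfl hy).mp (S.smooth_ξ _)
  rwa [(chartAt E x₀).right_inv hp] at h

lemma isAlmostContact {y : M} (hy : y ∈ (chartAt E x₀).source) :
    IsAlmostContact (metricRep x₀ (chartAt E x₀ y)) (S.phiRep x₀ (chartAt E x₀ y))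
      (fieldRep x₀ S.ξ (chartAt E x₀ y)) where
  symm u v := metricRep_comm ..
  pos u hu := metricRep_pos (chart_mem_target hy) hu
  P_P u := by
    rw [← toCoord_ofCoord hy u, ← S.toCoord_φ hy, ← S.toCoord_φ hy, fieldRep_chart hy,
      metricRep_chart hy, S.φ_φ, ← S.η_eq_inner]
    simp only [map_add, map_neg, map_smul]
  X_X := by
    rw [fieldRep_chart hy, metricRep_chart hy, S.inner_ξ_ξ]
  metric_P u v := by
    rw [← toCoord_ofCoord hy u, ← toCoord_ofCoord hy v, ← S.toCoord_φ hy, ← S.toCoord_φ hy,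
      fieldRep_chart hy, metricRep_chart hy, metricRep_chart hy, metricRep_chart hy,
      metricRep_chart hy, S.metric_φ, S.η_eq_inner, S.η_eq_inner]

/-- The Lie bracket in coordinates. -/
lemma _root_.SesquiHarmonic.toCoord_mlieBracket (hcov : IsLeviCivita cov) {y : M}
    (hy : y ∈ (chartAt E x₀).source) {X Y : Π x : M, TangentSpace 𝓘(ℝ, E) x}
    (hX : SmoothFieldAt X y) (hY : SmoothFieldAt Y y) :
    toCoord x₀ y (mlieBracket 𝓘(ℝ, E) X Y y) =
      fderiv ℝ (fieldRep x₀ Y) (chartAt E x₀ y) (toCoord x₀ y (X y)) -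
        fderiv ℝ (fieldRep x₀ X) (chartAt E x₀ y) (toCoord x₀ y (Y y)) := by
  have hX' := ContMDiffAt.mdifferentiableAt hX (by simp)
  have hY' := ContMDiffAt.mdifferentiableAt hY (by simp)
  -- Zero torsion expresses the bracket as a difference of covariant derivatives, whose symmetric
  -- Christoffel terms cancel.
  have h := cov.torsion_eq_zero_iff.mp hcov.torsion_free hX' hY'
  rw [← h, map_sub, toCoord_cov' hcov hy hX', toCoord_cov' hcov hy hY', fieldRep_chart hy,
    fieldRep_chart hy, chris_comm (chart_mem_target hy) (toCoord x₀ y (X y))]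
  abel

lemma extDerivOneForm_constField (hS : S.IsSasakian) {y : M}
    (hy : y ∈ (chartAt E x₀).source) (u w : E) :
    extDerivOneForm S.η (constField x₀ u) (constField x₀ w) y =
      metricRep x₀ (chartAt E x₀ y) u (S.phiRep x₀ (chartAt E x₀ y) w) := by
  rw [hS.contact _ _ _ (contMDiffAt_constField hy u) (contMDiffAt_constField hy w),
    ← metricRep_chart hy, S.toCoord_φ hy]
  simp only [constField, toCoord_ofCoord hy]

lemma contact_coord (hS : S.IsSasakian) {y : M} (hy : y ∈ (chartAt E x₀).source) (u w : E) :
    fderiv ℝ (fun q => metricRep x₀ q (fieldRep x₀ S.ξ q) w) (chartAt E x₀ y) u -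
      fderiv ℝ (fun q => metricRep x₀ q (fieldRep x₀ S.ξ q) u) (chartAt E x₀ y) w =
      2 * metricRep x₀ (chartAt E x₀ y) u (S.phiRep x₀ (chartAt E x₀ y) w) := by
  have key : ∀ u w : E, mvfderiv 𝓘(ℝ, E) (fun y => S.η y (constField x₀ w y)) y
      (constField x₀ u y) =
      fderiv ℝ (fun q => metricRep x₀ q (fieldRep x₀ S.ξ q) w) (chartAt E x₀ y) u := by
    intro u w
    have hm : MDifferentiableAt 𝓘(ℝ, E) 𝓘(ℝ, ℝ) (fun y => S.η y (constField x₀ w y)) y := by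
      have : (fun y => S.η y (constField x₀ w y)) =
          fun y => (inner ℝ (S.ξ y) (constField x₀ w y) : ℝ) := funext fun y => S.η_eq_inner y _
      rw [this]
      have h : ContMDiffAt 𝓘(ℝ, E) 𝓘(ℝ, ℝ) ∞
          (fun y => (inner ℝ (S.ξ y) (constField x₀ w y) : ℝ)) y :=
        ContMDiffAt.inner_bundle (F := E) (E := fun x : M => TangentSpace 𝓘(ℝ, E) x)
          (S.smooth_ξ y) (contMDiffAt_constField hy w)
      exact h.mdifferentiableAt (by simp)
    rw [mvfderiv_eq_fderiv hy hm, constField, toCoord_ofCoord hy]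
    congr 1
    refine Filter.EventuallyEq.fderiv_eq ?_
    filter_upwards [(chartAt E x₀).open_target.mem_nhds (chart_mem_target hy)] with q hq
    have hz := (chartAt E x₀).map_target hq
    rw [S.η_eq_inner, ← metricRep_chart hz, (chartAt E x₀).right_inv hq, constField,
      toCoord_ofCoord hz, fieldRep]
  have h := S.extDerivOneForm_constField hS hy u w
  rw [extDerivOneForm, key, key, mlieBracket_constField hy, map_zero, sub_zero] at h
  linarith

/-- On constant coordinate fields [u,w] = 0, so the Nijenhuis tensor reduces to derivatives of the
matrix of φ; `contact` rewrites dη on the right. -/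
lemma normal_coord (hcov : IsLeviCivita cov) (hS : S.IsSasakian) {y : M}
    (hy : y ∈ (chartAt E x₀).source) (u w : E) :
    fderiv ℝ (S.phiRep x₀) (chartAt E x₀ y) (S.phiRep x₀ (chartAt E x₀ y) u) w -
      fderiv ℝ (S.phiRep x₀) (chartAt E x₀ y) (S.phiRep x₀ (chartAt E x₀ y) w) u -
      S.phiRep x₀ (chartAt E x₀ y) (fderiv ℝ (S.phiRep x₀) (chartAt E x₀ y) u w) +
      S.phiRep x₀ (chartAt E x₀ y) (fderiv ℝ (S.phiRep x₀) (chartAt E x₀ y) w u) =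
      -(2 * metricRep x₀ (chartAt E x₀ y) u (S.phiRep x₀ (chartAt E x₀ y) w)) •
        fieldRep x₀ S.ξ (chartAt E x₀ y) := by
  have h := congrArg (toCoord x₀ y) (hS.normal (constField x₀ u) (constField x₀ w) y
    (contMDiffAt_constField hy u) (contMDiffAt_constField hy w))
  have hd : DifferentiableAt ℝ (S.phiRep x₀) (chartAt E x₀ y) :=
    (S.contDiffAt_phiRep (chart_mem_target hy)).differentiableAt (by simp)
  have hc : ∀ u, toCoord x₀ y (constField x₀ u y) = u := fun u => toCoord_ofCoord hy u
  have hφ : ∀ u, fderiv ℝ (fieldRep x₀ fun y => S.φ y (constField x₀ u y)) (chartAt E x₀ y) =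
      (fderiv ℝ (S.phiRep x₀) (chartAt E x₀ y)).flip u := by
    intro u
    ext v
    change fderiv ℝ (fun p => S.phiRep x₀ p u) (chartAt E x₀ y) v = _
    rw [fderiv_apply₁ hd (differentiableAt_const u)]
    simp
  have h0 : ∀ u : E, fderiv ℝ (fieldRep x₀ (constField x₀ u)) (chartAt E x₀ y) = 0 := by
    intro u
    rw [(fieldRep_constField_eventuallyEq hy u).fderiv_eq]
    simp
  rw [nijenhuis, S.extDerivOneForm_constField hS hy, mlieBracket_constField hy] at h
  simp only [map_zero, map_add, map_sub, map_smul, S.toCoord_φ hy] at h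
  rw [toCoord_mlieBracket hcov hy (S.contMDiffAt_φ_constField hy u)
      (S.contMDiffAt_φ_constField hy w),
    toCoord_mlieBracket hcov hy (contMDiffAt_constField hy u) (S.contMDiffAt_φ_constField hy w),
    toCoord_mlieBracket hcov hy (S.contMDiffAt_φ_constField hy u) (contMDiffAt_constField hy w),
    hφ, hφ, h0, h0, S.toCoord_φ hy, S.toCoord_φ hy, hc, hc, ← fieldRep_chart hy] at h
  simp only [ContinuousLinearMap.flip_apply, zero_apply, zero_sub, sub_zero, map_neg] at h
  rw [← neg_mul, ← h]
  abel

lemma isLocalSasakian (hcov : IsLeviCivita cov) (hS : S.IsSasakian) (x₀ : M) :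
    IsLocalSasakian (metricRep x₀) (chris x₀) (S.phiRep x₀) (fieldRep x₀ S.ξ)
      (chartAt E x₀).target where
  isOpen := (chartAt E x₀).open_target
  smooth_G p hp := contDiffAt_metricRep hp
  smooth_Γ p hp := contDiffAt_chris hp
  smooth_P p hp := S.contDiffAt_phiRep hp
  smooth_X p hp := S.contDiffAt_xiRep hp
  almostContact p hp := by
    have := S.isAlmostContact ((chartAt E x₀).map_target hp)
    rwa [(chartAt E x₀).right_inv hp] at this
  symm p hp u w := chris_comm hp u w
  metric p hp u v w := fderiv_metricRep hp u v w
  contact p hp u w := by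
    have := S.contact_coord hS ((chartAt E x₀).map_target hp) u w
    rwa [(chartAt E x₀).right_inv hp] at this
  normal p hp u w := by
    have := S.normal_coord hcov hS ((chartAt E x₀).map_target hp) u w
    rwa [(chartAt E x₀).right_inv hp] at this

/-- The curvature tensor of a Sasakian space form. -/
lemma IsSasakianSpaceForm.inner_curvature {S : AlmostContactMetric 𝓘(ℝ, E) M} {c : ℝ}
    (hS : S.IsSasakianSpaceForm cov c) (hcov : IsLeviCivita cov) {x : M}
    {u w : TangentSpace 𝓘(ℝ, E) x} (hu : S.η x u = 0) (hw : S.η x w = 0)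
    (z : TangentSpace 𝓘(ℝ, E) x) :
    inner ℝ (curvature cov x w u u) z =
      (c + 3) / 4 * (inner ℝ u u * inner ℝ w z - inner ℝ w u * inner ℝ u z)
      + 3 * (c - 1) / 4 * (inner ℝ w (S.φ x u) * inner ℝ (S.φ x u) z) := by
  have hx := mem_chart_source E x
  rw [S.η_eq_inner, ← metricRep_chart hx, ← fieldRep_chart hx] at hu hw
  simp only [← metricRep_chart hx, toCoord_curvature hcov, S.toCoord_φ hx]
  refine (S.isLocalSasakian hcov hS.sasakian x).curvRep_space_form (chart_mem_target hx) ?_ hu hw _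
  intro v hv hv1
  have hv' : toCoord x x (ofCoord x x v) = v := toCoord_ofCoord hx v
  rw [← hv', fieldRep_chart hx, metricRep_chart hx, ← S.η_eq_inner] at hv
  rw [← hv', metricRep_chart hx, real_inner_self_eq_norm_sq] at hv1
  have := hS.phi_sectional x _ hv ((pow_eq_one_iff_of_nonneg (norm_nonneg _) two_ne_zero).mp hv1)
  rwa [← metricRep_chart hx, toCoord_curvature hcov, S.toCoord_φ hx, hv'] at this

end AlmostContactMetric

variable [IsContMDiffRiemannianBundle 𝓘(ℝ, E) ∞ E (fun x : M => TangentSpace 𝓘(ℝ, E) x)]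

/-- The symmetry of the Jacobi operator. -/
lemma inner_curvature_symm (hcov : IsLeviCivita cov) (x : M) (u v w : TangentSpace 𝓘(ℝ, E) x) :
    inner ℝ (curvature cov x u v v) w = inner ℝ u (curvature cov x w v v) := by
  have hx := mem_chart_source E x
  have hp := chart_mem_target hx
  have h := isCurvatureLike_curvRep (contDiffAt_metricRep (E := E) hp)
    ((contDiffAt_chris (E := E) hp).differentiableAt (by simp))
    ((eventually_target hp).mono fun q hq => chris_comm hq)
    ((eventually_target hp).mono fun q hq => fderiv_metricRep hq) (metricRep_comm x _)
  rw [real_inner_comm _ u]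
  simp only [← metricRep_chart hx, toCoord_curvature hcov]
  rw [h.pair_symm, h.skew₁₂, h.skew₃₄, neg_neg]

/-! ### Sasakian structures along curves -/

variable {S : AlmostContactMetric 𝓘(ℝ, E) M} {γ : ℝ → M}
  {V : Π t : ℝ, TangentSpace 𝓘(ℝ, E) (γ t)} {t : ℝ}

lemma SmoothAlongAt.φ (hV : SmoothAlongAt γ V t) :
    SmoothAlongAt γ (fun s => S.φ (γ s) (V s)) t := by
  have hq := mem_chart_source E (γ t)
  have hP := (S.contDiffAt_phiRep (mapRep_mem hq)).comp t (contDiffAt_mapRep hV.map hq)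
  exact smoothAlongAt_of_eventually_eq hV.map hq (hP.clm_apply (hV.contDiffAt hq))
    (Filter.Eventually.of_forall fun s hs => S.toCoord_φ hs _)

lemma smoothAlongAt_ξ (hγ : ContMDiffAt 𝓘(ℝ, ℝ) 𝓘(ℝ, E) ∞ γ t) :
    SmoothAlongAt γ (fun s => S.ξ (γ s)) t := by
  have hq := mem_chart_source E (γ t)
  exact smoothAlongAt_of_eventually_eq hγ hq
    ((S.contDiffAt_xiRep (mapRep_mem hq)).comp t (contDiffAt_mapRep hγ hq))
    (Filter.Eventually.of_forall fun s hs => (fieldRep_chart hs _).symm)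

/-- The first structure equation in the direction of the velocity; the chain rule turns the
derivative along the curve into that of the coordinate field of ξ. `covDerivAlong_φ` does the same
with the second equation. -/
lemma covDerivAlong_ξ (hcov : IsLeviCivita cov) (hS : S.IsSasakian)
    (hγ : ContMDiffAt 𝓘(ℝ, ℝ) 𝓘(ℝ, E) ∞ γ t) :
    covDerivAlong cov γ (fun s => S.ξ (γ s)) t = -S.φ (γ t) (velocity 𝓘(ℝ, E) γ t) := by
  have hq := mem_chart_source E (γ t)
  have hm := contDiffAt_mapRep hγ hq
  have hp := mapRep_mem (E := E) hq
  have h := S.isLocalSasakian hcov hS (γ t)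
  have e : alongRep (γ t) γ (fun s => S.ξ (γ s)) =ᶠ[𝓝 t]
      fun s => fieldRep (γ t) S.ξ (mapRep (γ t) γ s) := by
    filter_upwards [eventually_mem_chart hγ.continuousAt hq] with s hs
    exact (fieldRep_chart hs _).symm
  refine ext_toCoord hq ?_
  have hv : toCoord (γ t) (γ t) (velocity 𝓘(ℝ, E) γ t) = fderiv ℝ (mapRep (γ t) γ) t 1 :=
    toCoord_velocity_comp (ℓ := id) (hasDerivAt_id t) hγ hq
  rw [toCoord_covDerivAlong' hcov (smoothAlongAt_ξ hγ) hq, map_neg, S.toCoord_φ hq, dcov,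
    e.fderiv_eq, e.eq_of_nhds, hv]
  have hcomp : fderiv ℝ (fun s => fieldRep (γ t) S.ξ (mapRep (γ t) γ s)) t 1 =
      fderiv ℝ (fieldRep (γ t) S.ξ) (mapRep (γ t) γ t) (fderiv ℝ (mapRep (γ t) γ) t 1) := by
    rw [show (fun s => fieldRep (γ t) S.ξ (mapRep (γ t) γ s)) =
      fieldRep (γ t) S.ξ ∘ mapRep (γ t) γ from rfl,
      fderiv_comp t (h.diff_X hp) (hm.differentiableAt (by simp))]
    rfl
  rw [hcomp]
  exact (h.structure_equations hp).1 _

lemma covDerivAlong_φ (hcov : IsLeviCivita cov) (hS : S.IsSasakian) (hV : SmoothAlongAt γ V t) :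
    covDerivAlong cov γ (fun s => S.φ (γ s) (V s)) t =
      S.φ (γ t) (covDerivAlong cov γ V t) + inner ℝ (velocity 𝓘(ℝ, E) γ t) (V t) • S.ξ (γ t)
        - S.η (γ t) (V t) • velocity 𝓘(ℝ, E) γ t := by
  have hq := mem_chart_source E (γ t)
  have hm := contDiffAt_mapRep hV.map hq
  have hp := mapRep_mem (E := E) hq
  have h := S.isLocalSasakian hcov hS (γ t)
  have e : alongRep (γ t) γ (fun s => S.φ (γ s) (V s)) =ᶠ[𝓝 t]
      fun s => S.phiRep (γ t) (mapRep (γ t) γ s) (alongRep (γ t) γ V s) := by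
    filter_upwards [eventually_mem_chart hV.map.continuousAt hq] with s hs
    exact S.toCoord_φ hs _
  refine ext_toCoord hq ?_
  have hv : toCoord (γ t) (γ t) (velocity 𝓘(ℝ, E) γ t) = fderiv ℝ (mapRep (γ t) γ) t 1 :=
    toCoord_velocity_comp (ℓ := id) (hasDerivAt_id t) hV.map hq
  rw [toCoord_covDerivAlong' hcov hV.φ hq, map_sub, map_add, map_smul, map_smul, S.toCoord_φ hq,
    toCoord_covDerivAlong' hcov hV hq, S.η_eq_inner, ← metricRep_chart hq, ← metricRep_chart hq,
    dcov, e.fderiv_eq, e.eq_of_nhds, hv]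
  have hcomp : fderiv ℝ (fun s => S.phiRep (γ t) (mapRep (γ t) γ s)) t 1 =
      fderiv ℝ (S.phiRep (γ t)) (mapRep (γ t) γ t) (fderiv ℝ (mapRep (γ t) γ) t 1) := by
    rw [show (fun s => S.phiRep (γ t) (mapRep (γ t) γ s)) =
      S.phiRep (γ t) ∘ mapRep (γ t) γ from rfl,
      fderiv_comp t (h.diff_P hp) (hm.differentiableAt (by simp))]
    rfl
  rw [fderiv_apply₁ (B := fun s => S.phiRep (γ t) (mapRep (γ t) γ s))
    ((h.diff_P hp).comp t (hm.differentiableAt (by simp)))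
    ((hV.contDiffAt hq).differentiableAt (by simp)), hcomp, ← fieldRep_chart hq]
  have := (h.structure_equations hp).2 (fderiv ℝ (mapRep (γ t) γ) t 1) (alongRep (γ t) γ V t)
  simp only [mapRep, alongRep, dcov, map_add] at this ⊢
  rw [← sub_eq_zero] at this ⊢
  rw [← this]
  abel

end SasakianManifold

end SesquiHarmonic

namespace SesquiHarmonic

/-! ### The first variation -/

/-- Differentiation of a parametric integral over a compact interval. -/
lemma hasDerivAt_integral_param {e : ℝ × ℝ → ℝ} {a b ε : ℝ} (hab : a ≤ b) (hε : 0 < ε)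
    (he : ∀ q ∈ Ioo (-ε) ε ×ˢ Icc a b, ContDiffAt ℝ ∞ e q) :
    HasDerivAt (fun s => ∫ t in a..b, e (s, t)) (∫ t in a..b, fderiv ℝ e (0, t) (1, 0)) 0 := by
  -- Halving ε gives a compact rectangle, on which the continuous parameter derivative has the
  -- constant bound required for dominated convergence.
  have hsub : Icc (-(ε / 2)) (ε / 2) ⊆ Ioo (-ε) ε := fun s hs =>
    ⟨by linarith [hs.1], by linarith [hs.2]⟩
  have hcont : ∀ s ∈ Icc (-(ε / 2)) (ε / 2), ContinuousOn (fun t => e (s, t)) (Icc a b) :=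
    fun s hs t ht => ContinuousAt.continuousWithinAt
      (ContinuousAt.comp (g := e) (he (s, t) ⟨hsub hs, ht⟩).continuousAt (by fun_prop))
  have hd : ∀ q ∈ Ioo (-ε) ε ×ˢ Icc a b, ContinuousAt (fun q => fderiv ℝ e q (1, 0)) q :=
    fun q hq => (((he q hq).fderiv_right (m := ∞) (by simp)).clm_apply
      (contDiffAt_const (c := ((1 : ℝ), (0 : ℝ))))).continuousAt
  have hcomp : IsCompact (Icc (-(ε / 2)) (ε / 2) ×ˢ Icc a b) := isCompact_Icc.prod isCompact_Icc
  obtain ⟨C, hC⟩ := hcomp.exists_bound_of_continuousOn (f := fun q => fderiv ℝ e q (1, 0))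
    fun q hq => (hd q ⟨hsub hq.1, hq.2⟩).continuousWithinAt
  have h0 : (0 : ℝ) ∈ Icc (-(ε / 2)) (ε / 2) := ⟨by linarith, by linarith⟩
  have hI : Set.uIoc a b ⊆ Icc a b := by
    rw [uIoc_of_le hab]
    exact Ioc_subset_Icc_self
  have hs : Icc (-(ε / 2)) (ε / 2) ∈ 𝓝 (0 : ℝ) := Icc_mem_nhds (by linarith) (by linarith)
  refine (intervalIntegral.hasDerivAt_integral_of_dominated_loc_of_deriv_le
    (F := fun s t => e (s, t)) (F' := fun s t => fderiv ℝ e (s, t) (1, 0))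
    (bound := fun _ => C) hs ?_ ?_ ?_ ?_ ?_ ?_).2
  · filter_upwards [hs] with s hs
    exact ((hcont s hs).mono hI).aestronglyMeasurable measurableSet_uIoc
  · exact (hcont 0 h0).intervalIntegrable_of_Icc hab
  · refine ContinuousOn.aestronglyMeasurable (fun t ht => ?_) measurableSet_uIoc
    exact ContinuousAt.continuousWithinAt (ContinuousAt.comp (g := fun q => fderiv ℝ e q (1, 0))
      (hd (0, t) ⟨hsub h0, hI ht⟩) (by fun_prop))
  · exact Filter.Eventually.of_forall fun t ht s hs => hC (s, t) ⟨hs, hI ht⟩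
  · exact intervalIntegrable_const
  · refine Filter.Eventually.of_forall fun t ht s hs => ?_
    have h1 := ((he (s, t) ⟨hsub hs, hI ht⟩).differentiableAt (by simp)).hasFDerivAt
    exact h1.comp_hasDerivAt s (hasDerivAt_prodMk_left (s, t))

section FirstVariation

variable {E : Type*} [NormedAddCommGroup E] [NormedSpace ℝ E] [FiniteDimensional ℝ E]
  {M : Type*} [TopologicalSpace M] [ChartedSpace E M] [IsManifold 𝓘(ℝ, E) ∞ M]

/-- The Euler-Lagrange field of the energy. -/
def eulerLagrange (cov : CovariantDerivative 𝓘(ℝ, E) E (TangentSpace 𝓘(ℝ, E) : M → Type _))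
    (δ₁ δ₂ : ℝ) (γ : ℝ → M) (t : ℝ) : TangentSpace 𝓘(ℝ, E) (γ t) :=
  -(δ₁ • tension cov γ t) + δ₂ • (covDerivAlong cov γ (covDerivAlong cov γ (tension cov γ)) t
    + curvature cov (γ t) (tension cov γ t) (velocity 𝓘(ℝ, E) γ t) (velocity 𝓘(ℝ, E) γ t))

variable [RiemannianBundle (fun x : M => TangentSpace 𝓘(ℝ, E) x)]
  [IsContMDiffRiemannianBundle 𝓘(ℝ, E) ∞ E (fun x : M => TangentSpace 𝓘(ℝ, E) x)]
  {cov : CovariantDerivative 𝓘(ℝ, E) E (TangentSpace 𝓘(ℝ, E) : M → Type _)}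
  {δ₁ δ₂ : ℝ} {J : Set ℝ} {γ : ℝ → M} {a b ε : ℝ}

lemma smoothAlongAt_tension (hcov : IsLeviCivita cov) (hJ : IsOpen J)
    (hγ : ∀ t ∈ J, ContMDiffAt 𝓘(ℝ, ℝ) 𝓘(ℝ, E) ∞ γ t) {t : ℝ} (ht : t ∈ J) :
    SmoothAlongAt γ (tension cov γ) t :=
  smoothAlongAt_covDerivAlong hcov (Filter.eventually_of_mem (hJ.mem_nhds ht) fun _ hs =>
    smoothAlongAt_velocity (Filter.eventually_of_mem (hJ.mem_nhds hs) hγ))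

/-- The field whose product with the variation field is integrated to a boundary term. -/
def boundaryTerm (cov : CovariantDerivative 𝓘(ℝ, E) E (TangentSpace 𝓘(ℝ, E) : M → Type _))
    (δ₁ δ₂ : ℝ) (γ : ℝ → M) (V : Π t : ℝ, TangentSpace 𝓘(ℝ, E) (γ t)) (t : ℝ) : ℝ :=
  δ₁ * inner ℝ (V t) (velocity 𝓘(ℝ, E) γ t) +
    δ₂ * (inner ℝ (covDerivAlong cov γ V t) (tension cov γ t) -
      inner ℝ (V t) (covDerivAlong cov γ (tension cov γ) t))

lemma contDiffAt_boundaryTerm (hcov : IsLeviCivita cov) (hJ : IsOpen J)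
    (hγ : ∀ t ∈ J, ContMDiffAt 𝓘(ℝ, ℝ) 𝓘(ℝ, E) ∞ γ t)
    {V : Π t : ℝ, TangentSpace 𝓘(ℝ, E) (γ t)} (hV : ∀ t ∈ J, SmoothAlongAt γ V t) {t : ℝ}
    (ht : t ∈ J) : ContDiffAt ℝ ∞ (boundaryTerm cov δ₁ δ₂ γ V) t := by
  have hJt := hJ.mem_nhds ht
  have h1 := smoothAlongAt_velocity (Filter.eventually_of_mem hJt hγ)
  have h2 := smoothAlongAt_tension hcov hJ hγ ht
  have h3 := smoothAlongAt_covDerivAlong hcov (Filter.eventually_of_mem hJt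
    fun s hs => smoothAlongAt_tension hcov hJ hγ hs)
  have h4 := smoothAlongAt_covDerivAlong hcov (Filter.eventually_of_mem hJt hV)
  exact (contDiffAt_const.mul ((hV t ht).inner h1)).add
    (contDiffAt_const.mul ((h4.inner h2).sub ((hV t ht).inner h3)))

/-- The two integrations by parts in pointwise form: metric compatibility moves ∇_T from V to τ and
T, and self-adjointness of the Jacobi operator moves the curvature term. -/
lemma hasDerivAt_boundaryTerm (hcov : IsLeviCivita cov) (hJ : IsOpen J)
    (hγ : ∀ t ∈ J, ContMDiffAt 𝓘(ℝ, ℝ) 𝓘(ℝ, E) ∞ γ t)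
    {V : Π t : ℝ, TangentSpace 𝓘(ℝ, E) (γ t)} (hV : ∀ t ∈ J, SmoothAlongAt γ V t) {t : ℝ}
    (ht : t ∈ J) : HasDerivAt (boundaryTerm cov δ₁ δ₂ γ V)
      (δ₁ * inner ℝ (covDerivAlong cov γ V t) (velocity 𝓘(ℝ, E) γ t) +
        δ₂ * inner ℝ (covDerivAlong cov γ (covDerivAlong cov γ V) t + curvature cov (γ t) (V t)
          (velocity 𝓘(ℝ, E) γ t) (velocity 𝓘(ℝ, E) γ t)) (tension cov γ t) -
        inner ℝ (V t) (eulerLagrange cov δ₁ δ₂ γ t)) t := by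
  have hJt := hJ.mem_nhds ht
  have h1 := smoothAlongAt_velocity (Filter.eventually_of_mem hJt hγ)
  have h2 := smoothAlongAt_tension hcov hJ hγ ht
  have h3 := smoothAlongAt_covDerivAlong hcov (Filter.eventually_of_mem hJt
    fun s hs => smoothAlongAt_tension hcov hJ hγ hs)
  have h4 := smoothAlongAt_covDerivAlong hcov (Filter.eventually_of_mem hJt hV)
  refine (((hasDerivAt_inner hcov (hV t ht) h1).const_mul δ₁).add
    (((hasDerivAt_inner hcov h4 h2).sub (hasDerivAt_inner hcov (hV t ht) h3)).const_mul
      δ₂)).congr_deriv ?_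
  rw [eulerLagrange, ← tension]
  simp only [inner_add_left, inner_add_right, inner_neg_right, inner_smul_right,
    inner_curvature_symm hcov (γ t) (V t)]
  ring

end FirstVariation

section Variation

variable {E : Type*} [NormedAddCommGroup E] [NormedSpace ℝ E] [FiniteDimensional ℝ E]
  {M : Type*} [TopologicalSpace M] [ChartedSpace E M] [IsManifold 𝓘(ℝ, E) ∞ M]
  [RiemannianBundle (fun x : M => TangentSpace 𝓘(ℝ, E) x)]
  [IsContMDiffRiemannianBundle 𝓘(ℝ, E) ∞ E (fun x : M => TangentSpace 𝓘(ℝ, E) x)]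
  {cov : CovariantDerivative 𝓘(ℝ, E) E (TangentSpace 𝓘(ℝ, E) : M → Type _)}
  {δ₁ δ₂ : ℝ} {J : Set ℝ} {f : ℝ × ℝ → M} {ε : ℝ}

/-- The energy density of a family of curves. -/
def energyDensity (cov : CovariantDerivative 𝓘(ℝ, E) E (TangentSpace 𝓘(ℝ, E) : M → Type _))
    (δ₁ δ₂ : ℝ) (f : ℝ × ℝ → M) (q : ℝ × ℝ) : ℝ :=
  δ₁ * inner ℝ (velT (E := E) f q) (velT (E := E) f q)
    + δ₂ * inner ℝ (covT cov f (velT f) q) (covT cov f (velT f) q)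

variable {U : Set (ℝ × ℝ)}

lemma contDiffAt_energyDensity (hcov : IsLeviCivita cov) (hU : IsOpen U)
    (hf : ∀ q ∈ U, ContMDiffAt 𝓘(ℝ, ℝ × ℝ) 𝓘(ℝ, E) ∞ f q) {q : ℝ × ℝ} (hq : q ∈ U) :
    ContDiffAt ℝ ∞ (energyDensity cov δ₁ δ₂ f) q := by
  have h1 : ∀ q ∈ U, SmoothAlongAt f (velT (E := E) f) q := fun q hq =>
    smoothAlongAt_velT (Filter.eventually_of_mem (hU.mem_nhds hq) hf)
  have h2 := smoothAlongAt_covT hcov (Filter.eventually_of_mem (hU.mem_nhds hq) h1)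
  exact (contDiffAt_const.mul ((h1 q hq).inner (h1 q hq))).add
    (contDiffAt_const.mul (h2.inner h2))

/-- The variation field. -/
def variationField (f : ℝ × ℝ → M) (t : ℝ) : TangentSpace 𝓘(ℝ, E) (f (0, t)) :=
  velS (E := E) f (0, t)

/-- Identifies the first variation integrand: ∇_s T = ∇_T V, and commuting ∇_s with ∇_T in ∇_s∇_T T
produces R(V,T)T. The factor 1/2 compensates for the density being quadratic. -/
lemma hasDerivAt_boundaryTerm_variationField (hcov : IsLeviCivita cov) (hJ : IsOpen J) (hε : 0 < ε)
    (hf : ∀ q ∈ Ioo (-ε) ε ×ˢ J, ContMDiffAt 𝓘(ℝ, ℝ × ℝ) 𝓘(ℝ, E) ∞ f q) {t : ℝ} (ht : t ∈ J) :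
    HasDerivAt (boundaryTerm cov δ₁ δ₂ (fun t => f (0, t)) (variationField f))
      ((1 / 2) * fderiv ℝ (energyDensity cov δ₁ δ₂ f) (0, t) (1, 0) -
        inner ℝ (variationField f t) (eulerLagrange cov δ₁ δ₂ (fun t => f (0, t)) t)) t := by
  have hU : IsOpen (Ioo (-ε) ε ×ˢ J) := isOpen_Ioo.prod hJ
  have hmem : ∀ t ∈ J, ((0 : ℝ), t) ∈ Ioo (-ε) ε ×ˢ J := fun t ht => ⟨⟨by linarith, hε⟩, ht⟩
  have h1 : ∀ q ∈ Ioo (-ε) ε ×ˢ J, SmoothAlongAt f (velT (E := E) f) q := fun q hq =>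
    smoothAlongAt_velT (Filter.eventually_of_mem (hU.mem_nhds hq) hf)
  have h2 : ∀ q ∈ Ioo (-ε) ε ×ˢ J, SmoothAlongAt f (velS (E := E) f) q := fun q hq =>
    smoothAlongAt_velS (Filter.eventually_of_mem (hU.mem_nhds hq) hf)
  have h3 : ∀ q ∈ Ioo (-ε) ε ×ˢ J, SmoothAlongAt f (covT cov f (velT f)) q := fun q hq =>
    smoothAlongAt_covT hcov (Filter.eventually_of_mem (hU.mem_nhds hq) h1)
  have hline : ∀ t : ℝ, ContDiffAt ℝ ∞ (fun t : ℝ => ((0 : ℝ), t)) t := fun t =>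
    contDiffAt_const.prodMk contDiffAt_id
  have hline' : ContDiffAt ℝ ∞ (fun s : ℝ => (s, t)) 0 := contDiffAt_id.prodMk contDiffAt_const
  have hγ : ∀ t ∈ J, ContMDiffAt 𝓘(ℝ, ℝ) 𝓘(ℝ, E) ∞ (fun t => f (0, t)) t := fun t ht =>
    (hf _ (hmem t ht)).comp t (hline t).contMDiffAt
  have hV : ∀ t ∈ J, SmoothAlongAt (fun t => f (0, t)) (variationField (E := E) f) t := fun t ht =>
    (h2 _ (hmem t ht)).comp (hline t)
  refine (hasDerivAt_boundaryTerm hcov hJ hγ hV ht).congr_deriv ?_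
  have hUt := hU.mem_nhds (hmem t ht)
  have e1 : covS cov f (velT f) (0, t) = covT cov f (velS f) (0, t) :=
    covS_velT hcov (Filter.eventually_of_mem hUt hf)
  have e2 := covS_covT hcov (Filter.eventually_of_mem hUt h1)
  have e3 : covT cov f (covS cov f (velT f)) (0, t) =
      covDerivAlong cov (fun t => f (0, t))
        (covDerivAlong cov (fun t => f (0, t)) (variationField f)) t :=
    covDerivAlong_congr (Filter.eventually_of_mem (hJ.mem_nhds ht) fun s hs =>
      covS_velT (q := (0, s)) hcov (Filter.eventually_of_mem (hU.mem_nhds (hmem s hs)) hf))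
  have s1 := SmoothAlongAt.comp (ℓ := fun s => (s, t)) (h1 _ (hmem t ht)) hline'
  have s3 := SmoothAlongAt.comp (ℓ := fun s => (s, t)) (h3 _ (hmem t ht)) hline'
  have d1 := hasDerivAt_inner hcov s1 s1
  have d2 := hasDerivAt_inner hcov s3 s3
  have d3 := (d1.const_mul δ₁).add (d2.const_mul δ₂)
  have d4 := (((contDiffAt_energyDensity (δ₁ := δ₁) (δ₂ := δ₂) hcov hU hf
    (hmem t ht)).differentiableAt (by simp)).hasFDerivAt).comp_hasDerivAt 0
      (hasDerivAt_prodMk_left (0, t))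
  have d5 := d4.unique d3
  change _ = δ₁ * (inner ℝ (covS cov f (velT f) (0, t)) (velT f (0, t)) +
    inner ℝ (velT f (0, t)) (covS cov f (velT f) (0, t))) +
    δ₂ * (inner ℝ (covS cov f (covT cov f (velT f)) (0, t)) (covT cov f (velT f) (0, t)) +
    inner ℝ (covT cov f (velT f) (0, t)) (covS cov f (covT cov f (velT f)) (0, t))) at d5
  rw [real_inner_comm (covS cov f (velT f) (0, t)),
    real_inner_comm (covS cov f (covT cov f (velT f)) (0, t)), e2, e3, e1] at d5
  rw [d5]
  have k1 : velT (E := E) f (0, t) = velocity 𝓘(ℝ, E) (fun t => f (0, t)) t := rfl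
  have k2 : covT cov f (velT f) (0, t) = tension cov (fun t => f (0, t)) t := rfl
  have k3 : covT cov f (velS f) (0, t) =
    covDerivAlong cov (fun t => f (0, t)) (variationField f) t := rfl
  rw [k1, k2, k3]
  change _ = 1 / 2 * (δ₁ * (_ + _) + δ₂ * (inner ℝ (_ + curvature cov (f (0, t))
    (variationField f t) _ _) _ + inner ℝ (_ + curvature cov (f (0, t))
    (variationField f t) _ _) _)) - _
  ring

lemma velocity_eq_zero_of_eventually_const {β : ℝ → M} {s : ℝ} {x : M}
    (h : ∀ᶠ r in 𝓝 s, β r = x) : velocity 𝓘(ℝ, E) β s = 0 := by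
  have h' : β =ᶠ[𝓝 s] fun _ => x := h
  rw [velocity, h'.mfderiv_eq]
  exact congrFun (congrArg DFunLike.coe (mfderiv_const (I := 𝓘(ℝ, ℝ)) (I' := 𝓘(ℝ, E)) (c := x)
    (x := s))) 1

/-- The first variation formula. -/
theorem hasDerivAt_interpolatingEnergy (hcov : IsLeviCivita cov) (hJ : IsOpen J) (hε : 0 < ε)
    {γ : ℝ → M} {a b : ℝ} (hab : a < b) (hI : Icc a b ⊆ J) {Γ : ℝ → ℝ → M}
    (hΓ : IsVariation 𝓘(ℝ, E) J γ a b ε Γ) :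
    ContinuousOn (fun t => (inner ℝ (variationField (E := E) (fun q : ℝ × ℝ => Γ q.1 q.2) t)
      (eulerLagrange cov δ₁ δ₂ (Γ 0) t) : ℝ)) J ∧
    HasDerivAt (fun s => interpolatingEnergy cov δ₁ δ₂ a b (Γ s))
      (2 * ∫ t in a..b, (inner ℝ (variationField (E := E) (fun q : ℝ × ℝ => Γ q.1 q.2) t)
        (eulerLagrange cov δ₁ δ₂ (Γ 0) t) : ℝ)) 0 := by
  set f : ℝ × ℝ → M := fun q => Γ q.1 q.2 with hf_def
  have hU : IsOpen (Ioo (-ε) ε ×ˢ J) := isOpen_Ioo.prod hJ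
  have hmem : ∀ t ∈ J, ((0 : ℝ), t) ∈ Ioo (-ε) ε ×ˢ J := fun t ht => ⟨⟨by linarith, hε⟩, ht⟩
  have hf : ∀ q ∈ Ioo (-ε) ε ×ˢ J, ContMDiffAt 𝓘(ℝ, ℝ × ℝ) 𝓘(ℝ, E) ∞ f q := fun q hq =>
    hΓ.smooth.contMDiffAt (hU.mem_nhds hq)
  have he : ∀ q ∈ Ioo (-ε) ε ×ˢ J, ContDiffAt ℝ ∞ (energyDensity cov δ₁ δ₂ f) q := fun q hq =>
    contDiffAt_energyDensity hcov hU hf hq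
  have hB := fun t (ht : t ∈ J) =>
    hasDerivAt_boundaryTerm_variationField (δ₁ := δ₁) (δ₂ := δ₂) hcov hJ hε hf ht
  have hline : ∀ t : ℝ, ContDiffAt ℝ ∞ (fun t : ℝ => ((0 : ℝ), t)) t := fun t =>
    contDiffAt_const.prodMk contDiffAt_id
  have hγ : ∀ t ∈ J, ContMDiffAt 𝓘(ℝ, ℝ) 𝓘(ℝ, E) ∞ (fun t => f (0, t)) t := fun t ht =>
    (hf _ (hmem t ht)).comp t (hline t).contMDiffAt
  have hV : ∀ t ∈ J, SmoothAlongAt (fun t => f (0, t)) (variationField (E := E) f) t := fun t ht =>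
    (smoothAlongAt_velS (Filter.eventually_of_mem (hU.mem_nhds (hmem t ht)) hf)).comp (hline t)
  have hBs : ∀ t ∈ J, ContDiffAt ℝ ∞
      (boundaryTerm cov δ₁ δ₂ (fun t => f (0, t)) (variationField f)) t := fun t ht =>
    contDiffAt_boundaryTerm hcov hJ hγ hV ht
  have hcB : ContinuousOn (deriv (boundaryTerm cov δ₁ δ₂ (fun t => f (0, t))
      (variationField f))) J := fun t ht =>
    ((((hBs t ht).fderiv_right (m := ∞) (by simp)).clm_apply
      (contDiffAt_const (c := (1 : ℝ)))).continuousAt).continuousWithinAt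
  have hce : ContinuousOn (fun t => fderiv ℝ (energyDensity cov δ₁ δ₂ f) (0, t) (1, 0)) J := by
    intro t ht
    have := ((he _ (hmem t ht)).fderiv_right (m := ∞) (by simp)).clm_apply
      (contDiffAt_const (c := ((1 : ℝ), (0 : ℝ))))
    exact (ContinuousAt.comp (g := fun q => fderiv ℝ (energyDensity cov δ₁ δ₂ f) q (1, 0))
      this.continuousAt (by fun_prop)).continuousWithinAt
  have heq : ∀ t ∈ J, inner ℝ (variationField (E := E) f t) (eulerLagrange cov δ₁ δ₂ (Γ 0) t) =
      (1 / 2) * fderiv ℝ (energyDensity cov δ₁ δ₂ f) (0, t) (1, 0) -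
        deriv (boundaryTerm cov δ₁ δ₂ (fun t => f (0, t)) (variationField f)) t := by
    intro t ht
    rw [(hB t ht).deriv]
    change _ = _ - (_ - inner ℝ (variationField f t) (eulerLagrange cov δ₁ δ₂ (Γ 0) t))
    ring
  have hzero : ∀ t ∈ J, t ∉ Icc a b → boundaryTerm cov δ₁ δ₂ (fun t => f (0, t))
      (variationField f) t = 0 := by
    have hV0 : ∀ t ∈ J, t ∉ Icc a b → variationField (E := E) f t = 0 := by
      intro t ht htI
      refine velocity_eq_zero_of_eventually_const (x := γ t) ?_
      filter_upwards [Ioo_mem_nhds (show -ε < 0 by linarith) hε] with s hs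
      exact hΓ.support s hs t ht htI
    intro t ht htI
    have h1 : covDerivAlong cov (fun t => f (0, t)) (variationField (E := E) f) t = 0 := by
      have h2 : covDerivAlong cov (fun t => f (0, t)) (variationField (E := E) f) t =
          covDerivAlong cov (fun t => f (0, t)) (fun s => (0 : ℝ) • variationField f s) t := by
        refine covDerivAlong_congr ?_
        filter_upwards [hJ.mem_nhds ht, isClosed_Icc.isOpen_compl.mem_nhds htI] with s hs hs'
        rw [hV0 s hs hs', smul_zero]
      rw [h2, covDerivAlong_smul hcov contDiffAt_const (hV t ht)]
      simp
    rw [boundaryTerm, h1, hV0 t ht htI]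
    simp
  -- At an endpoint the boundary term vanishes by continuity: `J` is open, so the endpoint is a
  -- limit of points of `J` outside `[a, b]`, where the variation is constant.
  have hend : ∀ x ∈ J, (∃ᶠ t in 𝓝 x, t ∈ J ∧ t ∉ Icc a b) → boundaryTerm cov δ₁ δ₂
      (fun t => f (0, t)) (variationField f) x = 0 := by
    intro x hx hfr
    by_contra hne
    have := (hBs x hx).continuousAt.eventually_ne hne
    obtain ⟨t, ht, ht'⟩ := (hfr.and_eventually this).exists
    exact ht' (hzero t ht.1 ht.2)
  have ha : boundaryTerm cov δ₁ δ₂ (fun t => f (0, t)) (variationField f) a = 0 := by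
    refine hend a (hI (left_mem_Icc.mpr hab.le)) ?_
    have : ∃ᶠ t in 𝓝 a, t < a := (frequently_lt_nhds a)
    refine (this.and_eventually (hJ.mem_nhds (hI (left_mem_Icc.mpr hab.le)))).mono ?_
    exact fun t ht => ⟨ht.2, fun h => absurd h.1 (not_le.mpr ht.1)⟩
  have hb : boundaryTerm cov δ₁ δ₂ (fun t => f (0, t)) (variationField f) b = 0 := by
    refine hend b (hI (right_mem_Icc.mpr hab.le)) ?_
    have : ∃ᶠ t in 𝓝 b, b < t := (frequently_gt_nhds b)
    refine (this.and_eventually (hJ.mem_nhds (hI (right_mem_Icc.mpr hab.le)))).mono ?_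
    exact fun t ht => ⟨ht.2, fun h => absurd h.2 (not_le.mpr ht.1)⟩
  have hint : ∫ t in a..b, deriv (boundaryTerm cov δ₁ δ₂ (fun t => f (0, t))
      (variationField f)) t = 0 := by
    rw [intervalIntegral.integral_eq_sub_of_hasDerivAt (f := boundaryTerm cov δ₁ δ₂
      (fun t => f (0, t)) (variationField f)), ha, hb, sub_zero]
    · intro t ht
      rw [uIcc_of_le hab.le] at ht
      exact ((hBs t (hI ht)).differentiableAt (by simp)).hasDerivAt
    · exact (hcB.mono hI).intervalIntegrable_of_Icc hab.le
  refine ⟨((continuousOn_const.mul hce).sub hcB).congr heq, ?_⟩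
  have hmain := hasDerivAt_integral_param (e := energyDensity cov δ₁ δ₂ f) hab.le hε
    fun q hq => he q ⟨hq.1, hI hq.2⟩
  have hfin : ∫ t in a..b, fderiv ℝ (energyDensity cov δ₁ δ₂ f) (0, t) (1, 0) =
      2 * ∫ t in a..b, (inner ℝ (variationField (E := E) f t)
        (eulerLagrange cov δ₁ δ₂ (Γ 0) t) : ℝ) := by
    have h1 : ∫ t in a..b, (inner ℝ (variationField (E := E) f t)
        (eulerLagrange cov δ₁ δ₂ (Γ 0) t) : ℝ) = ∫ t in a..b,
        ((1 / 2) * fderiv ℝ (energyDensity cov δ₁ δ₂ f) (0, t) (1, 0) -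
          deriv (boundaryTerm cov δ₁ δ₂ (fun t => f (0, t)) (variationField f)) t) := by
      refine intervalIntegral.integral_congr fun t ht => ?_
      rw [uIcc_of_le hab.le] at ht
      exact heq t (hI ht)
    rw [h1, intervalIntegral.integral_sub
      (((hce.mono hI).intervalIntegrable_of_Icc hab.le).const_mul _)
      ((hcB.mono hI).intervalIntegrable_of_Icc hab.le), hint,
      intervalIntegral.integral_const_mul]
    ring
  rw [← hfin]
  refine hmain.congr_of_eventuallyEq ?_
  filter_upwards [Ioo_mem_nhds (show -ε < 0 by linarith) hε] with s hs
  have hcont : ∀ g : ℝ × ℝ → ℝ, (∀ q ∈ Ioo (-ε) ε ×ˢ J, ContDiffAt ℝ ∞ g q) →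
      IntervalIntegrable (fun t => g (s, t)) MeasureTheory.volume a b := by
    intro g hg
    refine ContinuousOn.intervalIntegrable_of_Icc hab.le fun t ht => ?_
    exact (ContinuousAt.comp (g := g) (hg (s, t) ⟨hs, hI ht⟩).continuousAt
      (by fun_prop)).continuousWithinAt
  have h1 : ∀ q ∈ Ioo (-ε) ε ×ˢ J, SmoothAlongAt f (velT (E := E) f) q := fun q hq =>
    smoothAlongAt_velT (Filter.eventually_of_mem (hU.mem_nhds hq) hf)
  have h3 : ∀ q ∈ Ioo (-ε) ε ×ˢ J, SmoothAlongAt f (covT cov f (velT f)) q := fun q hq =>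
    smoothAlongAt_covT hcov (Filter.eventually_of_mem (hU.mem_nhds hq) h1)
  simp only [energyDensity]
  rw [intervalIntegral.integral_add
    ((hcont _ fun q hq => (h1 q hq).inner (h1 q hq)).const_mul _)
    ((hcont _ fun q hq => (h3 q hq).inner (h3 q hq)).const_mul _),
    intervalIntegral.integral_const_mul, intervalIntegral.integral_const_mul]
  simp only [real_inner_self_eq_norm_sq]
  rfl

end Variation

end SesquiHarmonic

namespace SesquiHarmonic

/-! ### From the first variation to the Euler-Lagrange equation -/

section Critical

variable {E : Type*} [NormedAddCommGroup E] [NormedSpace ℝ E] [FiniteDimensional ℝ E]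
  {M : Type*} [TopologicalSpace M] [ChartedSpace E M] [IsManifold 𝓘(ℝ, E) ∞ M]
  {cov : CovariantDerivative 𝓘(ℝ, E) E (TangentSpace 𝓘(ℝ, E) : M → Type _)}
  {δ₁ δ₂ : ℝ} {J : Set ℝ} {γ γ' : ℝ → M} {a b ε : ℝ} {t : ℝ}

/-! ### Locality

Tangent vectors at different points are compared as elements of the model space. -/

lemma velocity_congr (h : γ' =ᶠ[𝓝 t] γ) :
    (velocity 𝓘(ℝ, E) γ' t : E) = (velocity 𝓘(ℝ, E) γ t : E) := by
  have := h.mfderiv_eq (I := 𝓘(ℝ, ℝ)) (I' := 𝓘(ℝ, E))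
  exact congrFun (congrArg DFunLike.coe this) 1

lemma covDerivAlong_congr' {V' : Π t : ℝ, TangentSpace 𝓘(ℝ, E) (γ' t)}
    {V : Π t : ℝ, TangentSpace 𝓘(ℝ, E) (γ t)} (h : γ' =ᶠ[𝓝 t] γ)
    (hV : ∀ᶠ s in 𝓝 t, (V' s : E) = (V s : E)) :
    (covDerivAlong cov γ' V' t : E) = (covDerivAlong cov γ V t : E) := by
  -- The base point is made an ordinary argument, so that `γ' t` can be rewritten to `γ t` without a
  -- type mismatch between tangent spaces.
  set A : M → E → E → E → E := fun x d w v =>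
    (trivializationAt E (TangentSpace 𝓘(ℝ, E) : M → Type _) x).symm x d +
      cov (FiberBundle.extend E (show TangentSpace 𝓘(ℝ, E) x from w)) x v
  set B : M → M → E → E := fun x y w =>
    (trivializationAt E (TangentSpace 𝓘(ℝ, E) : M → Type _) x
      ⟨y, (show TangentSpace 𝓘(ℝ, E) y from w)⟩).2
  have e1 : (fun s => B (γ' t) (γ' s) (V' s)) =ᶠ[𝓝 t] fun s => B (γ t) (γ s) (V s) := by
    filter_upwards [h, hV] with s hs hs'
    rw [hs, hs', h.eq_of_nhds]
  change A (γ' t) (deriv (fun s => B (γ' t) (γ' s) (V' s)) t) (V' t) (velocity 𝓘(ℝ, E) γ' t) =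
    A (γ t) (deriv (fun s => B (γ t) (γ s) (V s)) t) (V t) (velocity 𝓘(ℝ, E) γ t)
  rw [e1.deriv_eq, hV.self_of_nhds, velocity_congr h, h.eq_of_nhds]

/-- A variation starts at `γ` only for parameters in `J`, so `Γ 0` and `γ` may differ as functions.
The field is built from germs, and `J` is open, so agreement on `J` is enough. -/
lemma eulerLagrange_congr (hJ : IsOpen J) (h : ∀ t ∈ J, γ' t = γ t) (ht : t ∈ J) :
    (eulerLagrange cov δ₁ δ₂ γ' t : E) = (eulerLagrange cov δ₁ δ₂ γ t : E) := by
  have h0 : ∀ t ∈ J, γ' =ᶠ[𝓝 t] γ := fun t ht => Filter.eventually_of_mem (hJ.mem_nhds ht) h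
  have h1 : ∀ t ∈ J, (velocity 𝓘(ℝ, E) γ' t : E) = (velocity 𝓘(ℝ, E) γ t : E) := fun t ht =>
    velocity_congr (h0 t ht)
  have h2 : ∀ t ∈ J, (tension cov γ' t : E) = (tension cov γ t : E) := fun t ht =>
    covDerivAlong_congr' (h0 t ht) (Filter.eventually_of_mem (hJ.mem_nhds ht) h1)
  have h3 : ∀ t ∈ J, (covDerivAlong cov γ' (tension cov γ') t : E) =
      (covDerivAlong cov γ (tension cov γ) t : E) := fun t ht =>
    covDerivAlong_congr' (h0 t ht) (Filter.eventually_of_mem (hJ.mem_nhds ht) h2)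
  have h4 : (covDerivAlong cov γ' (covDerivAlong cov γ' (tension cov γ')) t : E) =
      (covDerivAlong cov γ (covDerivAlong cov γ (tension cov γ)) t : E) :=
    covDerivAlong_congr' (h0 t ht) (Filter.eventually_of_mem (hJ.mem_nhds ht) h3)
  set A : M → E → E → E → E := fun x d w v =>
    (fun d w v : TangentSpace 𝓘(ℝ, E) x => -(δ₁ • w) + δ₂ • (d + curvature cov x w v v)) d w v
  change A (γ' t) (covDerivAlong cov γ' (covDerivAlong cov γ' (tension cov γ')) t)
    (tension cov γ' t) (velocity 𝓘(ℝ, E) γ' t) = A (γ t)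
    (covDerivAlong cov γ (covDerivAlong cov γ (tension cov γ)) t)
    (tension cov γ t) (velocity 𝓘(ℝ, E) γ t)
  rw [h4, h2 t ht, h1 t ht, h t ht]

lemma alongRep_eulerLagrange_congr (hJ : IsOpen J) (h : ∀ t ∈ J, γ' t = γ t) (ht : t ∈ J)
    (x₀ : M) : alongRep x₀ γ' (eulerLagrange cov δ₁ δ₂ γ') t =
      alongRep x₀ γ (eulerLagrange cov δ₁ δ₂ γ) t := by
  set B : M → E → E := fun y w => toCoord x₀ y (show TangentSpace 𝓘(ℝ, E) y from w)
  change B (γ' t) (eulerLagrange cov δ₁ δ₂ γ' t) = B (γ t) (eulerLagrange cov δ₁ δ₂ γ t)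
  rw [eulerLagrange_congr hJ h ht, h t ht]

/-! ### Existence of variations -/

/-- The variation of a curve in a chart in a constant direction. -/
lemma exists_isVariation (hγ : ∀ t ∈ J, ContMDiffAt 𝓘(ℝ, ℝ) 𝓘(ℝ, E) ∞ γ t)
    {x₀ : M} (hI : Icc a b ⊆ J) (hsrc : ∀ t ∈ Icc a b, γ t ∈ (chartAt E x₀).source) {χ : ℝ → ℝ}
    (hχ : ContDiff ℝ ∞ χ) (hχ1 : ∀ t, |χ t| ≤ 1) (hχ0 : ∀ t, t ∉ Icc a b → χ t = 0) (v : E) :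
    ∃ ε > 0, ∃ Γ : ℝ → ℝ → M, IsVariation 𝓘(ℝ, E) J γ a b ε Γ ∧
      ∀ t ∈ J, γ t ∈ (chartAt E x₀).source →
        toCoord x₀ (Γ 0 t) (variationField (E := E) (fun q : ℝ × ℝ => Γ q.1 q.2) t) = χ t • v := by
  classical
  have hK : IsCompact ((fun t => chartAt E x₀ (γ t)) '' Icc a b) := by
    refine isCompact_Icc.image_of_continuousOn fun t ht => ContinuousAt.continuousWithinAt ?_
    exact (contMDiffAt_chart (hsrc t ht)).continuousAt.comp (hγ t (hI ht)).continuousAt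
  -- A tube of radius δ about the compact coordinate image stays in the chart. As |χ| ≤ 1,
  -- displacements by sχv stay inside it for |s| < δ/(‖v‖ + 1), where the 1 allows v = 0.
  obtain ⟨δ, hδ, hsub⟩ := hK.exists_thickening_subset_open (chartAt E x₀).open_target (by
    rintro _ ⟨t, ht, rfl⟩
    exact chart_mem_target (hsrc t ht))
  have hε : 0 < δ / (‖v‖ + 1) := div_pos hδ (by positivity)
  have htgt : ∀ s ∈ Ioo (-(δ / (‖v‖ + 1))) (δ / (‖v‖ + 1)), ∀ t, γ t ∈ (chartAt E x₀).source →
      chartAt E x₀ (γ t) + (s * χ t) • v ∈ (chartAt E x₀).target := by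
    intro s hs t ht
    by_cases htI : t ∈ Icc a b
    · refine hsub (Metric.mem_thickening_iff.mpr ⟨_, ⟨t, htI, rfl⟩, ?_⟩)
      rw [dist_eq_norm, add_sub_cancel_left, norm_smul, Real.norm_eq_abs, abs_mul]
      have h1 : |s| < δ / (‖v‖ + 1) := abs_lt.mpr hs
      have h2 : |s| * (‖v‖ + 1) < δ := (lt_div_iff₀ (by positivity)).mp h1
      calc |s| * |χ t| * ‖v‖ ≤ |s| * 1 * (‖v‖ + 1) := by
            gcongr
            · exact hχ1 t
            · linarith
        _ < δ := by linarith
    · rw [hχ0 t htI, mul_zero, zero_smul, add_zero]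
      exact chart_mem_target ht
  -- Outside the chart the curve is left unchanged. The two branches agree wherever χ vanishes,
  -- hence off `[a, b]`, so the glued map is smooth.
  set Γ : ℝ → ℝ → M := fun s t => if γ t ∈ (chartAt E x₀).source then
    (chartAt E x₀).symm (chartAt E x₀ (γ t) + (s * χ t) • v) else γ t with hΓ
  have hconst : ∀ s t, χ t = 0 → Γ s t = γ t := by
    intro s t ht
    simp only [hΓ, ht, mul_zero, zero_smul, add_zero]
    split_ifs with h
    · exact chart_symm_chart h
    · rfl
  refine ⟨_, hε, Γ, ⟨?_, ?_, fun s _ t _ ht => hconst s t (hχ0 t ht)⟩, ?_⟩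
  · rintro ⟨s, t⟩ ⟨hs, ht⟩
    refine ContMDiffAt.contMDiffWithinAt ?_
    have hγ2 : ContMDiffAt 𝓘(ℝ, ℝ × ℝ) 𝓘(ℝ, E) ∞ (fun q : ℝ × ℝ => γ q.2) (s, t) :=
      ContMDiffAt.comp (g := γ) (s, t) (hγ t ht) contDiffAt_snd.contMDiffAt
    by_cases htI : t ∈ Icc a b
    · have hsrc' := hsrc t htI
      have h1 : ContDiffAt ℝ ∞ (fun q : ℝ × ℝ => chartAt E x₀ (γ q.2) + (q.1 * χ q.2) • v)
          (s, t) :=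
        (contDiffAt_mapRep hγ2 hsrc').add ((contDiffAt_fst.mul
          (ContDiffAt.comp (g := χ) (s, t) hχ.contDiffAt contDiffAt_snd)).smul contDiffAt_const)
      have h2 := ContMDiffAt.comp (g := (chartAt E x₀).symm) (s, t)
        (contMDiffAt_chart_symm (htgt s hs t hsrc')) h1.contMDiffAt
      refine h2.congr_of_eventuallyEq ?_
      filter_upwards [eventually_mem_chart hγ2.continuousAt hsrc'] with q hq
      exact if_pos hq
    · refine hγ2.congr_of_eventuallyEq ?_
      have : ∀ᶠ q : ℝ × ℝ in 𝓝 (s, t), q.2 ∈ (Icc a b)ᶜ :=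
        continuousAt_snd.eventually_mem (isClosed_Icc.isOpen_compl.mem_nhds htI)
      filter_upwards [this] with q hq
      exact hconst _ _ (hχ0 _ hq)
  · intro t _
    simp only [hΓ, zero_mul, zero_smul, add_zero]
    split_ifs with h
    · exact chart_symm_chart h
    · rfl
  · intro t ht hsrc'
    have h0 : Γ 0 t = γ t := by
      simp only [hΓ, zero_mul, zero_smul, add_zero, if_pos hsrc']
      exact chart_symm_chart hsrc'
    have hs0 : Γ 0 t ∈ (chartAt E x₀).source := by rwa [h0]
    have hd : ContDiffAt ℝ ∞ (fun s : ℝ => chartAt E x₀ (γ t) + (s * χ t) • v) 0 := by fun_prop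
    have hm : MDifferentiableAt 𝓘(ℝ, ℝ) 𝓘(ℝ, E) (fun s => Γ s t) 0 := by
      have h1 : ContMDiffAt 𝓘(ℝ, ℝ) 𝓘(ℝ, E) ∞
          (fun s : ℝ => (chartAt E x₀).symm (chartAt E x₀ (γ t) + (s * χ t) • v)) 0 := by
        refine ContMDiffAt.comp (g := (chartAt E x₀).symm) 0 (contMDiffAt_chart_symm ?_)
          hd.contMDiffAt
        exact htgt 0 ⟨by linarith, hε⟩ t hsrc'
      have h2 : (fun s => Γ s t) =
          fun s : ℝ => (chartAt E x₀).symm (chartAt E x₀ (γ t) + (s * χ t) • v) :=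
        funext fun s => if_pos hsrc'
      rw [h2]
      exact h1.mdifferentiableAt (by simp)
    have hvel := toCoord_velocity (x₀ := x₀) (γ := fun s => Γ s t) (t := 0) hs0 hm
    have heq : (fun s => chartAt E x₀ (Γ s t)) =ᶠ[𝓝 0]
        fun s : ℝ => chartAt E x₀ (γ t) + (s * χ t) • v := by
      filter_upwards [Ioo_mem_nhds (show -(δ / (‖v‖ + 1)) < 0 by linarith) hε] with s hs
      simp only [hΓ, if_pos hsrc']
      exact (chartAt E x₀).right_inv (htgt s hs t hsrc')
    rw [heq.deriv_eq] at hvel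
    refine hvel.trans ?_
    have := (((hasDerivAt_id (0 : ℝ)).mul_const (χ t)).smul_const v).const_add (chartAt E x₀ (γ t))
    simpa using this.deriv

variable [RiemannianBundle (fun x : M => TangentSpace 𝓘(ℝ, E) x)]
  [IsContMDiffRiemannianBundle 𝓘(ℝ, E) ∞ E (fun x : M => TangentSpace 𝓘(ℝ, E) x)]

/-- The Euler-Lagrange equation of interpolating sesqui-harmonic curves. -/
theorem isInterpolatingSesquiHarmonic_iff (hcov : IsLeviCivita cov) (hJ : IsOpen J)
    (hγ : ContMDiffOn 𝓘(ℝ, ℝ) 𝓘(ℝ, E) ∞ γ J) :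
    IsInterpolatingSesquiHarmonic cov δ₁ δ₂ J γ ↔ ∀ t ∈ J, eulerLagrange cov δ₁ δ₂ γ t = 0 := by
  have hγ' : ∀ t ∈ J, ContMDiffAt 𝓘(ℝ, ℝ) 𝓘(ℝ, E) ∞ γ t := fun t ht =>
    hγ.contMDiffAt (hJ.mem_nhds ht)
  constructor
  · intro h t₀ ht₀
    by_contra hne
    set x₀ := γ t₀ with hx₀
    set v := alongRep x₀ γ (eulerLagrange cov δ₁ δ₂ γ) t₀ with hv
    -- The Euler-Lagrange field is paired with its own value at `t₀`, frozen in coordinates, so that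
    -- g(t₀) is the square of its norm there.
    set g : ℝ → ℝ := fun t => metricRep x₀ (mapRep x₀ γ t) v
      (alongRep x₀ γ (eulerLagrange cov δ₁ δ₂ γ) t) with hg
    have hsrc0 : γ t₀ ∈ (chartAt E x₀).source := mem_chart_source E (γ t₀)
    have hg0 : 0 < g t₀ := by
      simp only [hg, hv]
      rw [← inner_eq_metricRep hsrc0]
      exact real_inner_self_pos.mpr hne
    obtain ⟨ρ, hρ, hball⟩ := Metric.nhds_basis_closedBall.mem_iff.mp (Filter.inter_mem
      (hJ.mem_nhds ht₀) (eventually_mem_chart (hγ' t₀ ht₀).continuousAt hsrc0))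
    -- Testing criticality with the variation in direction χv, supported in the closed ball of the
    -- bump.
    have key : ∀ (χ : ContDiffBump t₀), χ.rOut ≤ ρ →
        ContinuousOn (fun t => χ t * g t) (Metric.closedBall t₀ χ.rOut) ∧
        ∫ t in (t₀ - χ.rOut)..(t₀ + χ.rOut), χ t * g t = 0 := by
      intro χ hχρ
      have hIcc : Icc (t₀ - χ.rOut) (t₀ + χ.rOut) = Metric.closedBall t₀ χ.rOut :=
        (Real.closedBall_eq_Icc).symm
      have hsub : Icc (t₀ - χ.rOut) (t₀ + χ.rOut) ⊆ Metric.closedBall t₀ ρ := by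
        rw [hIcc]
        exact Metric.closedBall_subset_closedBall hχρ
      have hlt : t₀ - χ.rOut < t₀ + χ.rOut := by linarith [χ.rOut_pos]
      have hI : Icc (t₀ - χ.rOut) (t₀ + χ.rOut) ⊆ J := fun t ht => (hball (hsub ht)).1
      obtain ⟨ε, hε, Γ, hΓ, hfield⟩ := exists_isVariation hγ' hI
        (fun t ht => (hball (hsub ht)).2) χ.contDiff
        (fun t => abs_le.mpr ⟨by linarith [χ.nonneg (x := t)], χ.le_one⟩) (fun t ht => by
          rw [hIcc, Metric.mem_closedBall, not_le] at ht
          exact χ.zero_of_le_dist ht.le) v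
      obtain ⟨hcont, hder⟩ := hasDerivAt_interpolatingEnergy (δ₁ := δ₁) (δ₂ := δ₂) hcov hJ hε hlt
        hI hΓ
      have heq : ∀ t ∈ Icc (t₀ - χ.rOut) (t₀ + χ.rOut),
          (inner ℝ (variationField (E := E) (fun q : ℝ × ℝ => Γ q.1 q.2) t)
            (eulerLagrange cov δ₁ δ₂ (Γ 0) t) : ℝ) = χ t * g t := by
        intro t ht
        have htJ := hI ht
        have ht0 := hΓ.initial t htJ
        have hs : γ t ∈ (chartAt E x₀).source := (hball (hsub ht)).2
        have hs' : Γ 0 t ∈ (chartAt E x₀).source := by rwa [ht0]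
        have e1 := inner_eq_metricRep (f := Γ 0) (x₀ := x₀)
          (V := variationField (E := E) (fun q : ℝ × ℝ => Γ q.1 q.2))
          (W := eulerLagrange cov δ₁ δ₂ (Γ 0)) hs'
        refine e1.trans ?_
        rw [alongRep_eulerLagrange_congr hJ hΓ.initial htJ, alongRep, hfield t htJ hs, mapRep,
          ht0, map_smul, smul_apply, smul_eq_mul]
        rfl
      constructor
      · rw [← hIcc]
        exact (hcont.mono hI).congr fun t ht => (heq t ht).symm
      · have h0 := hder.unique (h _ _ hlt hI ε hε Γ hΓ)
        rw [← intervalIntegral.integral_congr (f := fun t => (inner ℝ (variationField (E := E)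
          (fun q : ℝ × ℝ => Γ q.1 q.2) t) (eulerLagrange cov δ₁ δ₂ (Γ 0) t) : ℝ))]
        · linarith
        · intro t ht
          rw [uIcc_of_le hlt.le] at ht
          exact heq t ht
    -- The first variation formula provides continuity of χg. Since χ ≥ 0, positivity of χg near
    -- `t₀` forces that of g.
    have hpos : ∀ᶠ t in 𝓝 t₀, 0 < g t := by
      set χ : ContDiffBump t₀ := ⟨ρ / 2, ρ, by linarith, by linarith⟩
      have hc := ((key χ le_rfl).1).continuousAt (Metric.closedBall_mem_nhds t₀ hρ)
      have hχ0 : χ t₀ * g t₀ = g t₀ := by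
        rw [χ.one_of_mem_closedBall (Metric.mem_closedBall_self χ.rIn_pos.le), one_mul]
      have := hc.eventually (lt_mem_nhds (a := 0) (show 0 < χ t₀ * g t₀ by rwa [hχ0]))
      filter_upwards [this] with t ht
      by_contra hle
      exact absurd ht (not_lt.mpr (mul_nonpos_of_nonneg_of_nonpos χ.nonneg (not_lt.mp hle)))
    obtain ⟨σ, hσ, hσball⟩ := Metric.nhds_basis_ball.mem_iff.mp hpos
    -- A second bump, supported where g > 0, makes ∫ χg positive and contradicts `key`.
    set χ : ContDiffBump t₀ := ⟨min ρ σ / 2, min ρ σ, by positivity, by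
      linarith [lt_min hρ hσ]⟩ with hχ
    obtain ⟨hc, hint⟩ := key χ (min_le_left _ _)
    have hlt : t₀ - χ.rOut < t₀ + χ.rOut := by linarith [χ.rOut_pos]
    rw [Real.closedBall_eq_Icc] at hc
    have := intervalIntegral.intervalIntegral_pos_of_pos_on
      (hc.intervalIntegrable_of_Icc hlt.le) (fun t ht => by
        have ht' : t ∈ Metric.ball t₀ χ.rOut := by rwa [Real.ball_eq_Ioo]
        exact mul_pos (χ.pos_of_mem_ball ht')
          (hσball (Metric.ball_subset_ball (min_le_right _ _) ht'))) hlt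
    exact this.ne' hint
  · intro h a b hab hI ε hε Γ hΓ
    have hder := (hasDerivAt_interpolatingEnergy (δ₁ := δ₁) (δ₂ := δ₂) hcov hJ hε hab hI hΓ).2
    have hzero : ∫ t in a..b, (inner ℝ (variationField (E := E) (fun q : ℝ × ℝ => Γ q.1 q.2) t)
        (eulerLagrange cov δ₁ δ₂ (Γ 0) t) : ℝ) = 0 := by
      refine (intervalIntegral.integral_congr (g := fun _ => (0 : ℝ)) fun t ht => ?_).trans
        intervalIntegral.integral_zero
      rw [uIcc_of_le hab.le] at ht
      have e1 := eulerLagrange_congr (cov := cov) (δ₁ := δ₁) (δ₂ := δ₂) hJ hΓ.initial (hI ht)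
      rw [h t (hI ht)] at e1
      have e2 : eulerLagrange cov δ₁ δ₂ (Γ 0) t = 0 := e1
      simp only [e2, inner_zero_right]
    rw [hzero, mul_zero] at hder
    exact hder

end Critical

end SesquiHarmonic

namespace SesquiHarmonic

/-! ### The Euler-Lagrange equation in a Frenet frame -/

section Frenet

variable {E : Type*} [NormedAddCommGroup E] [NormedSpace ℝ E] [FiniteDimensional ℝ E]
  {M : Type*} [TopologicalSpace M] [ChartedSpace E M] [IsManifold 𝓘(ℝ, E) ∞ M]
  [RiemannianBundle (fun x : M => TangentSpace 𝓘(ℝ, E) x)]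

/-- The first four vectors of a Frenet frame and the first three curvatures of a unit speed curve,
continued by zero if the osculating order is smaller than four. -/
structure IsFrenetQuadruple
    (cov : CovariantDerivative 𝓘(ℝ, E) E (TangentSpace 𝓘(ℝ, E) : M → Type _)) (J : Set ℝ)
    (γ : ℝ → M) (E₂ E₃ E₄ : Π t : ℝ, TangentSpace 𝓘(ℝ, E) (γ t)) (κ₁ κ₂ κ₃ : ℝ → ℝ) : Prop where
  smooth : ∀ t ∈ J, ContMDiffAt 𝓘(ℝ, ℝ) 𝓘(ℝ, E) ∞ γ t
  smooth₂ : ∀ t ∈ J, SmoothAlongAt γ E₂ t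
  smooth₃ : ∀ t ∈ J, SmoothAlongAt γ E₃ t
  smooth_κ₁ : ∀ t ∈ J, ContDiffAt ℝ ∞ κ₁ t
  smooth_κ₂ : ∀ t ∈ J, ContDiffAt ℝ ∞ κ₂ t
  nonneg₁ : ∀ t ∈ J, 0 ≤ κ₁ t
  nonneg₂ : ∀ t ∈ J, 0 ≤ κ₂ t
  nonneg₃ : ∀ t ∈ J, 0 ≤ κ₃ t
  deriv₁ : ∀ t ∈ J, tension cov γ t = κ₁ t • E₂ t
  deriv₂ : ∀ t ∈ J, covDerivAlong cov γ E₂ t = -(κ₁ t • velocity 𝓘(ℝ, E) γ t) + κ₂ t • E₃ t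
  deriv₃ : ∀ t ∈ J, covDerivAlong cov γ E₃ t = -(κ₂ t • E₂ t) + κ₃ t • E₄ t
  inner₁₁ : ∀ t ∈ J, inner ℝ (velocity 𝓘(ℝ, E) γ t) (velocity 𝓘(ℝ, E) γ t) = (1 : ℝ)
  inner₁₂ : ∀ t ∈ J, inner ℝ (velocity 𝓘(ℝ, E) γ t) (E₂ t) = (0 : ℝ)
  inner₁₃ : ∀ t ∈ J, inner ℝ (velocity 𝓘(ℝ, E) γ t) (E₃ t) = (0 : ℝ)
  inner₁₄ : ∀ t ∈ J, inner ℝ (velocity 𝓘(ℝ, E) γ t) (E₄ t) = (0 : ℝ)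
  inner₂₂ : ∀ t ∈ J, inner ℝ (E₂ t) (E₂ t) = (1 : ℝ)
  inner₂₃ : ∀ t ∈ J, inner ℝ (E₂ t) (E₃ t) = (0 : ℝ)
  inner₂₄ : ∀ t ∈ J, inner ℝ (E₂ t) (E₄ t) = (0 : ℝ)
  inner₃₄ : ∀ t ∈ J, inner ℝ (E₃ t) (E₄ t) = (0 : ℝ)
  three : (∀ t ∈ J, inner ℝ (E₃ t) (E₃ t) = (1 : ℝ)) ∨ ∀ t ∈ J, κ₂ t = 0 ∧ E₃ t = 0
  four : (∀ t ∈ J, inner ℝ (E₄ t) (E₄ t) = (1 : ℝ)) ∨ ∀ t ∈ J, κ₃ t = 0 ∧ E₄ t = 0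

variable [IsContMDiffRiemannianBundle 𝓘(ℝ, E) ∞ E (fun x : M => TangentSpace 𝓘(ℝ, E) x)]
  {cov : CovariantDerivative 𝓘(ℝ, E) E (TangentSpace 𝓘(ℝ, E) : M → Type _)}
  {J : Set ℝ} {γ : ℝ → M} {E₂ E₃ E₄ : Π t : ℝ, TangentSpace 𝓘(ℝ, E) (γ t)} {κ₁ κ₂ κ₃ : ℝ → ℝ}
  {t : ℝ}

lemma ContDiffAt.deriv_real {g : ℝ → ℝ} (h : ContDiffAt ℝ ∞ g t) : ContDiffAt ℝ ∞ (deriv g) t :=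
  (h.fderiv_right (m := ∞) (by simp)).clm_apply (contDiffAt_const (c := (1 : ℝ)))

namespace IsFrenetQuadruple

lemma smoothAlongAt_velocity (h : IsFrenetQuadruple cov J γ E₂ E₃ E₄ κ₁ κ₂ κ₃) (hJ : IsOpen J)
    (ht : t ∈ J) : SmoothAlongAt γ (velocity 𝓘(ℝ, E) γ) t :=
  SesquiHarmonic.smoothAlongAt_velocity (Filter.eventually_of_mem (hJ.mem_nhds ht) h.smooth)

/-- The bitension part of the Euler-Lagrange field. -/
lemma covDerivAlong_covDerivAlong_tension (h : IsFrenetQuadruple cov J γ E₂ E₃ E₄ κ₁ κ₂ κ₃)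
    (hcov : IsLeviCivita cov) (hJ : IsOpen J) (ht : t ∈ J) :
    covDerivAlong cov γ (covDerivAlong cov γ (tension cov γ)) t =
      (-(3 * κ₁ t * deriv κ₁ t)) • velocity 𝓘(ℝ, E) γ t +
      (deriv (deriv κ₁) t - κ₁ t ^ 3 - κ₁ t * κ₂ t ^ 2) • E₂ t +
      (2 * deriv κ₁ t * κ₂ t + κ₁ t * deriv κ₂ t) • E₃ t + (κ₁ t * κ₂ t * κ₃ t) • E₄ t := by
  have e1 : ∀ t ∈ J, covDerivAlong cov γ (tension cov γ) t = deriv κ₁ t • E₂ t +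
      ((-(κ₁ t * κ₁ t)) • velocity 𝓘(ℝ, E) γ t + (κ₁ t * κ₂ t) • E₃ t) := by
    intro t ht
    rw [covDerivAlong_congr (Filter.eventually_of_mem (hJ.mem_nhds ht) h.deriv₁),
      covDerivAlong_smul hcov (h.smooth_κ₁ t ht) (h.smooth₂ t ht), h.deriv₂ t ht]
    module
  have s1 := ContDiffAt.deriv_real (h.smooth_κ₁ t ht)
  have s2 := h.smooth_κ₁ t ht
  have s3 := h.smooth_κ₂ t ht
  have v1 := h.smoothAlongAt_velocity hJ ht
  have v2 := h.smooth₂ t ht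
  have v3 := h.smooth₃ t ht
  have d1 := s2.differentiableAt (by simp)
  have d2 := s3.differentiableAt (by simp)
  have t1 : covDerivAlong cov γ (velocity 𝓘(ℝ, E) γ) t = κ₁ t • E₂ t := h.deriv₁ t ht
  rw [covDerivAlong_congr (Filter.eventually_of_mem (hJ.mem_nhds ht) e1),
    covDerivAlong_add hcov (v2.smul s1) ((v1.smul (s2.mul s2).neg).add (v3.smul (s2.mul s3))),
    covDerivAlong_add hcov (v1.smul (s2.mul s2).neg) (v3.smul (s2.mul s3)),
    covDerivAlong_smul hcov s1 v2, covDerivAlong_smul hcov (s2.mul s2).neg v1,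
    covDerivAlong_smul hcov (s2.mul s3) v3, t1, h.deriv₂ t ht, h.deriv₃ t ht]
  have k1 : deriv (fun s => -(κ₁ s * κ₁ s)) t = -(2 * κ₁ t * deriv κ₁ t) := by
    rw [deriv.fun_neg, deriv_fun_mul d1 d1]
    ring
  have k2 : deriv (fun s => κ₁ s * κ₂ s) t = deriv κ₁ t * κ₂ t + κ₁ t * deriv κ₂ t :=
    deriv_fun_mul d1 d2
  change deriv (deriv κ₁) t • E₂ t + _ + (deriv (fun s => -(κ₁ s * κ₁ s)) t • _ + _ +
    (deriv (fun s => κ₁ s * κ₂ s) t • _ + _)) = _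
  rw [k1, k2]
  module

variable {S : AlmostContactMetric 𝓘(ℝ, E) M} {c : ℝ}

lemma inner_φ_self (x : M) (u : TangentSpace 𝓘(ℝ, E) x) : inner ℝ (S.φ x u) u = (0 : ℝ) := by
  have hx := mem_chart_source E x
  have h := (S.isAlmostContact hx).skew_P (toCoord x x u) (toCoord x x u)
  rw [metricRep_comm x _ (toCoord x x u), ← S.toCoord_φ hx, metricRep_chart hx] at h
  linarith

lemma inner_self_φ (x : M) (u : TangentSpace 𝓘(ℝ, E) x) : inner ℝ u (S.φ x u) = (0 : ℝ) := by
  rw [real_inner_comm, inner_φ_self]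

/-- Differentiating η(T) = 0 gives η(τ) = g(φT, T), which is zero because φ is skew. Hence the
curvature formula for vectors orthogonal to ξ applies to τ. -/
lemma η_tension (h : IsFrenetQuadruple cov J γ E₂ E₃ E₄ κ₁ κ₂ κ₃) (hcov : IsLeviCivita cov)
    (hS : S.IsSasakian) (hJ : IsOpen J) (hL : S.IsLegendreOn γ J) (ht : t ∈ J) :
    S.η (γ t) (tension cov γ t) = 0 := by
  have h1 := hasDerivAt_inner hcov (smoothAlongAt_ξ (S := S) (h.smooth t ht))
    (h.smoothAlongAt_velocity hJ ht)
  have h2 : (fun s => (inner ℝ (S.ξ (γ s)) (velocity 𝓘(ℝ, E) γ s) : ℝ)) =ᶠ[𝓝 t] fun _ => 0 := by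
    filter_upwards [hJ.mem_nhds ht] with s hs
    rw [← S.η_eq_inner, hL s hs]
  have h3 := h1.unique ((hasDerivAt_const t (0 : ℝ)).congr_of_eventuallyEq h2)
  rw [covDerivAlong_ξ hcov hS (h.smooth t ht), inner_neg_left, inner_φ_self, neg_zero,
    zero_add] at h3
  rw [S.η_eq_inner]
  exact h3

/-- The Euler-Lagrange field of a Legendre curve in a Sasakian space form. -/
lemma eulerLagrange_eq (h : IsFrenetQuadruple cov J γ E₂ E₃ E₄ κ₁ κ₂ κ₃) (hcov : IsLeviCivita cov)
    (hS : S.IsSasakianSpaceForm cov c) (hJ : IsOpen J) (hL : S.IsLegendreOn γ J) (δ₁ δ₂ : ℝ)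
    (ht : t ∈ J) :
    eulerLagrange cov δ₁ δ₂ γ t =
      -(δ₁ • κ₁ t • E₂ t) + δ₂ • ((-(3 * κ₁ t * deriv κ₁ t)) • velocity 𝓘(ℝ, E) γ t +
      (deriv (deriv κ₁) t - κ₁ t ^ 3 - κ₁ t * κ₂ t ^ 2) • E₂ t +
      (2 * deriv κ₁ t * κ₂ t + κ₁ t * deriv κ₂ t) • E₃ t + (κ₁ t * κ₂ t * κ₃ t) • E₄ t +
      κ₁ t • (((c + 3) / 4) • E₂ t + (3 * (c - 1) / 4 *
        inner ℝ (S.φ (γ t) (velocity 𝓘(ℝ, E) γ t)) (E₂ t)) •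
          S.φ (γ t) (velocity 𝓘(ℝ, E) γ t))) := by
  have hcurv : curvature cov (γ t) (tension cov γ t) (velocity 𝓘(ℝ, E) γ t)
      (velocity 𝓘(ℝ, E) γ t) = κ₁ t • (((c + 3) / 4) • E₂ t + (3 * (c - 1) / 4 *
        inner ℝ (S.φ (γ t) (velocity 𝓘(ℝ, E) γ t)) (E₂ t)) •
          S.φ (γ t) (velocity 𝓘(ℝ, E) γ t)) := by
    refine ext_inner_right ℝ fun z => ?_
    rw [hS.inner_curvature hcov (hL t ht) (h.η_tension hcov hS.sasakian hJ hL ht), h.deriv₁ t ht]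
    simp only [inner_add_left, inner_smul_left, h.inner₁₁ t ht, RCLike.conj_to_real]
    rw [real_inner_comm (velocity 𝓘(ℝ, E) γ t) (E₂ t), h.inner₁₂ t ht,
      real_inner_comm (S.φ (γ t) (velocity 𝓘(ℝ, E) γ t)) (E₂ t)]
    ring
  rw [eulerLagrange, h.covDerivAlong_covDerivAlong_tension hcov hJ ht, hcurv, h.deriv₁ t ht]

lemma const_of_hasDerivAt_zero (hJ : IsOpen J) (hJc : IsPreconnected J) {g : ℝ → ℝ}
    (hg : ∀ t ∈ J, HasDerivAt g 0 t) {s : ℝ} (hs : s ∈ J) (ht : t ∈ J) : g s = g t :=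
  hJ.is_const_of_deriv_eq_zero hJc (fun t ht => (hg t ht).differentiableAt.differentiableWithinAt)
    (fun t ht => (hg t ht).deriv) hs ht

/-- The geodesic curvature of an interpolating sesqui-harmonic Legendre curve is constant. -/
lemma curvature_const (h : IsFrenetQuadruple cov J γ E₂ E₃ E₄ κ₁ κ₂ κ₃) (hcov : IsLeviCivita cov)
    (hS : S.IsSasakianSpaceForm cov c) (hJ : IsOpen J) (hJc : IsPreconnected J)
    (hL : S.IsLegendreOn γ J) {δ₁ δ₂ : ℝ} (hδ : δ₂ ≠ 0)
    (hEL : ∀ t ∈ J, eulerLagrange cov δ₁ δ₂ γ t = 0) {s : ℝ} (hs : s ∈ J) (ht : t ∈ J) :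
    κ₁ s = κ₁ t := by
  -- The T-component of the equation is −3δ₂κ₁κ₁', because E₂, E₃, E₄ and φT are orthogonal to T.
  -- Working with κ₁² avoids dividing by κ₁; nonnegativity then recovers κ₁.
  have h1 : ∀ t ∈ J, HasDerivAt (fun t => κ₁ t ^ 2) 0 t := by
    intro t ht
    have e := congrArg (fun v => (inner ℝ (velocity 𝓘(ℝ, E) γ t) v : ℝ))
      ((h.eulerLagrange_eq hcov hS hJ hL δ₁ δ₂ ht).symm.trans (hEL t ht))
    simp only [inner_add_right, inner_smul_right, inner_neg_right, inner_self_φ, inner_zero_right,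
      h.inner₁₁ t ht, h.inner₁₂ t ht, h.inner₁₃ t ht, h.inner₁₄ t ht] at e
    have e' : κ₁ t * deriv κ₁ t = 0 := by
      have : δ₂ * (κ₁ t * deriv κ₁ t) = 0 := by linarith
      exact (mul_eq_zero.mp this).resolve_left hδ
    refine ((((h.smooth_κ₁ t ht).differentiableAt (by simp)).hasDerivAt).fun_pow 2).congr_deriv ?_
    simp only [Nat.cast_ofNat, Nat.add_one_sub_one, pow_one]
    linarith
  exact (pow_left_inj₀ (h.nonneg₁ s hs) (h.nonneg₁ t ht) two_ne_zero).mp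
    (const_of_hasDerivAt_zero hJ hJc h1 hs ht)

/-- The Euler-Lagrange equation of a Legendre curve with constant geodesic curvature `K ≠ 0`. -/
lemma eulerLagrange_eq_zero_iff (h : IsFrenetQuadruple cov J γ E₂ E₃ E₄ κ₁ κ₂ κ₃)
    (hcov : IsLeviCivita cov) (hS : S.IsSasakianSpaceForm cov c) (hJ : IsOpen J)
    (hL : S.IsLegendreOn γ J) {δ₁ δ₂ : ℝ} (hδ : δ₂ ≠ 0) {K : ℝ} (hK : K ≠ 0)
    (hκ : ∀ t ∈ J, κ₁ t = K) (ht : t ∈ J) :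
    eulerLagrange cov δ₁ δ₂ γ t = 0 ↔ ((c + 3) / 4 - δ₁ / δ₂ - K ^ 2 - κ₂ t ^ 2) • E₂ t +
      deriv κ₂ t • E₃ t + (κ₂ t * κ₃ t) • E₄ t + (3 * (c - 1) / 4 *
        inner ℝ (S.φ (γ t) (velocity 𝓘(ℝ, E) γ t)) (E₂ t)) •
          S.φ (γ t) (velocity 𝓘(ℝ, E) γ t) = 0 := by
  have d1 : ∀ t ∈ J, deriv κ₁ t = 0 := by
    intro t ht
    have : κ₁ =ᶠ[𝓝 t] fun _ => K := Filter.eventually_of_mem (hJ.mem_nhds ht) hκ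
    rw [this.deriv_eq, deriv_const]
  have d2 : deriv (deriv κ₁) t = 0 := by
    have : deriv κ₁ =ᶠ[𝓝 t] fun _ => 0 := Filter.eventually_of_mem (hJ.mem_nhds ht) d1
    rw [this.deriv_eq, deriv_const]
  have key : eulerLagrange cov δ₁ δ₂ γ t = (δ₂ * K) • (((c + 3) / 4 - δ₁ / δ₂ - K ^ 2 - κ₂ t ^ 2) •
      E₂ t + deriv κ₂ t • E₃ t + (κ₂ t * κ₃ t) • E₄ t + (3 * (c - 1) / 4 *
        inner ℝ (S.φ (γ t) (velocity 𝓘(ℝ, E) γ t)) (E₂ t)) •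
          S.φ (γ t) (velocity 𝓘(ℝ, E) γ t)) := by
    rw [h.eulerLagrange_eq hcov hS hJ hL δ₁ δ₂ ht, d1 t ht, d2, hκ t ht]
    have hm : δ₁ = δ₂ * (δ₁ / δ₂) := by field_simp
    conv_lhs => rw [hm]
    module
  rw [key, smul_eq_zero_iff_right (mul_ne_zero hδ hK)]

/-- From ∇_T(φT) = κ₁φE₂ + ξ, both terms are orthogonal to E₂: φ is skew, and E₂ is a multiple of τ
as κ₁ ≠ 0. The T-part of ∇_T E₂ is killed by g(φT,T) = 0, leaving only its E₃-part. -/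
lemma hasDerivAt_inner_φ (h : IsFrenetQuadruple cov J γ E₂ E₃ E₄ κ₁ κ₂ κ₃)
    (hcov : IsLeviCivita cov) (hS : S.IsSasakian) (hJ : IsOpen J)
    (hL : S.IsLegendreOn γ J) (hκ : κ₁ t ≠ 0) (ht : t ∈ J) :
    HasDerivAt (fun t => (inner ℝ (S.φ (γ t) (velocity 𝓘(ℝ, E) γ t)) (E₂ t) : ℝ))
      (κ₂ t * inner ℝ (S.φ (γ t) (velocity 𝓘(ℝ, E) γ t)) (E₃ t)) t := by
  have v1 := h.smoothAlongAt_velocity hJ ht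
  refine (hasDerivAt_inner hcov (SmoothAlongAt.φ (S := S) v1) (h.smooth₂ t ht)).congr_deriv ?_
  have e1 := h.η_tension hcov hS hJ hL ht
  rw [h.deriv₁ t ht, map_smul, smul_eq_zero_iff_right hκ, S.η_eq_inner] at e1
  have t1 : covDerivAlong cov γ (velocity 𝓘(ℝ, E) γ) t = κ₁ t • E₂ t := h.deriv₁ t ht
  rw [covDerivAlong_φ hcov hS v1, hL t ht, h.inner₁₁ t ht, t1, h.deriv₂ t ht]
  simp only [map_smul, one_smul, zero_smul, sub_zero, inner_add_left, inner_smul_left, inner_φ_self,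
    inner_add_right, inner_neg_right, inner_smul_right, e1]
  simp

/-- The Frenet equations of an interpolating sesqui-harmonic Legendre curve that is not a
geodesic. -/
lemma frenet_equations (h : IsFrenetQuadruple cov J γ E₂ E₃ E₄ κ₁ κ₂ κ₃)
    (hcov : IsLeviCivita cov) (hS : S.IsSasakianSpaceForm cov c) (hJ : IsOpen J)
    (hL : S.IsLegendreOn γ J) {δ₁ δ₂ : ℝ} (hδ : δ₂ ≠ 0) {K : ℝ} (hK : K ≠ 0)
    (hκ : ∀ t ∈ J, κ₁ t = K) (hEL : ∀ t ∈ J, eulerLagrange cov δ₁ δ₂ γ t = 0) (ht : t ∈ J) :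
    K ^ 2 + κ₂ t ^ 2 = (c + 3) / 4 + 3 * (c - 1) / 4 *
      inner ℝ (S.φ (γ t) (velocity 𝓘(ℝ, E) γ t)) (E₂ t) ^ 2 - δ₁ / δ₂ ∧
    deriv κ₂ t = -(3 * (c - 1) / 4 * inner ℝ (S.φ (γ t) (velocity 𝓘(ℝ, E) γ t)) (E₂ t) *
      inner ℝ (S.φ (γ t) (velocity 𝓘(ℝ, E) γ t)) (E₃ t)) := by
  have e := (h.eulerLagrange_eq_zero_iff hcov hS hJ hL hδ hK hκ ht).mp (hEL t ht)
  constructor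
  · have e2 := congrArg (fun v => (inner ℝ (E₂ t) v : ℝ)) e
    simp only [inner_add_right, inner_smul_right, inner_zero_right, h.inner₂₂ t ht, h.inner₂₃ t ht,
      h.inner₂₄ t ht] at e2
    rw [real_inner_comm (S.φ (γ t) (velocity 𝓘(ℝ, E) γ t)) (E₂ t)] at e2
    linarith
  · rcases h.three with h3 | h3
    · have e3 := congrArg (fun v => (inner ℝ (E₃ t) v : ℝ)) e
      simp only [inner_add_right, inner_smul_right, inner_zero_right, h3 t ht, h.inner₃₄ t ht] at e3
      rw [real_inner_comm (E₂ t) (E₃ t), h.inner₂₃ t ht,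
        real_inner_comm (S.φ (γ t) (velocity 𝓘(ℝ, E) γ t)) (E₃ t)] at e3
      linarith
    -- Osculating order two: there is no third vector to pair with, and both sides are zero.
    · have : κ₂ =ᶠ[𝓝 t] fun _ => 0 :=
        Filter.eventually_of_mem (hJ.mem_nhds ht) fun s hs => (h3 s hs).1
      rw [this.deriv_eq, deriv_const, (h3 t ht).2, inner_zero_right]
      ring

/-- The structure of an interpolating sesqui-harmonic Legendre curve that is not a geodesic. -/
lemma structure_of_eulerLagrange (h : IsFrenetQuadruple cov J γ E₂ E₃ E₄ κ₁ κ₂ κ₃)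
    (hcov : IsLeviCivita cov) (hS : S.IsSasakianSpaceForm cov c) (hc : c ≠ 1) (hJ : IsOpen J)
    (hJc : IsPreconnected J) (hL : S.IsLegendreOn γ J)
    (h0 : ¬ ∀ t ∈ J, inner ℝ (S.φ (γ t) (velocity 𝓘(ℝ, E) γ t)) (E₂ t) = (0 : ℝ))
    (h1 : ¬ ∀ t ∈ J, inner ℝ (S.φ (γ t) (velocity 𝓘(ℝ, E) γ t)) (E₂ t) = (1 : ℝ))
    (h1' : ¬ ∀ t ∈ J, inner ℝ (S.φ (γ t) (velocity 𝓘(ℝ, E) γ t)) (E₂ t) = (-1 : ℝ))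
    {δ₁ δ₂ : ℝ} (hδ : δ₂ ≠ 0) {K : ℝ} (hK : 0 < K)
    (hκ : ∀ t ∈ J, κ₁ t = K) (hEL : ∀ t ∈ J, eulerLagrange cov δ₁ δ₂ γ t = 0) :
    ∃ f g K₂ K₃ : ℝ, f ≠ 0 ∧ f ^ 2 + g ^ 2 = 1 ∧ 0 < K₂ ∧ 0 < K₃ ∧
      (∀ t ∈ J, κ₂ t = K₂ ∧ κ₃ t = K₃ ∧
        S.φ (γ t) (velocity 𝓘(ℝ, E) γ t) = f • E₂ t + g • E₄ t) ∧
      K ^ 2 + K₂ ^ 2 = (c + 3) / 4 + 3 * (c - 1) / 4 * f ^ 2 - δ₁ / δ₂ ∧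
      K₂ * K₃ = -(3 * (c - 1) / 4 * (f * g)) := by
  set f : ℝ → ℝ := fun t => inner ℝ (S.φ (γ t) (velocity 𝓘(ℝ, E) γ t)) (E₂ t) with hf
  set e : ℝ → ℝ := fun t => inner ℝ (S.φ (γ t) (velocity 𝓘(ℝ, E) γ t)) (E₃ t) with he
  have hc' : c - 1 ≠ 0 := sub_ne_zero.mpr hc
  have hfre := fun t (ht : t ∈ J) => h.frenet_equations hcov hS hJ hL hδ hK.ne' hκ hEL ht
  have hdf : ∀ t ∈ J, HasDerivAt f (κ₂ t * e t) t := fun t ht =>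
    h.hasDerivAt_inner_φ hcov hS.sasakian hJ hL (by rw [hκ t ht]; exact hK.ne') ht
  have hdκ : ∀ t ∈ J, HasDerivAt κ₂ (deriv κ₂ t) t := fun t ht =>
    ((h.smooth_κ₂ t ht).differentiableAt (by simp)).hasDerivAt
  -- Differentiating the E₂-equation and inserting κ₂' from the E₃-equation gives the same quantity
  -- with opposite signs; c ≠ 1 is needed to cancel the factor.
  have hprod : ∀ t ∈ J, f t * (κ₂ t * e t) = 0 := by
    intro t ht
    have d1 : HasDerivAt (fun t => K ^ 2 + κ₂ t ^ 2) (2 * κ₂ t * deriv κ₂ t) t := by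
      simpa using ((hdκ t ht).fun_pow 2).const_add (K ^ 2)
    have d2 : HasDerivAt (fun t => (c + 3) / 4 + 3 * (c - 1) / 4 * f t ^ 2 - δ₁ / δ₂)
        (3 * (c - 1) / 4 * (2 * f t * (κ₂ t * e t))) t := by
      simpa using ((((hdf t ht).fun_pow 2).const_mul (3 * (c - 1) / 4)).const_add
        ((c + 3) / 4)).sub_const (δ₁ / δ₂)
    have heq : (fun t => K ^ 2 + κ₂ t ^ 2) =ᶠ[𝓝 t]
        fun t => (c + 3) / 4 + 3 * (c - 1) / 4 * f t ^ 2 - δ₁ / δ₂ :=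
      Filter.eventually_of_mem (hJ.mem_nhds ht) fun s hs => (hfre s hs).1
    have d3 := d1.unique (d2.congr_of_eventuallyEq heq)
    have d4 : deriv κ₂ t = -(3 * (c - 1) / 4 * f t * e t) := (hfre t ht).2
    rw [d4] at d3
    have d5 : 3 * (c - 1) * (f t * (κ₂ t * e t)) = 0 := by linarith
    exact (mul_eq_zero.mp d5).resolve_left (mul_ne_zero three_ne_zero hc')
  obtain ⟨t₀, ht₀, hft₀⟩ : ∃ t₀ ∈ J, f t₀ ≠ 0 := by
    by_contra! hcon
    exact h0 hcon
  -- Now ff' = 0, so f² is constant. Being nonzero at `t₀`, f is nonzero everywhere, so f' = 0.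
  have hfsq : ∀ t ∈ J, f t ^ 2 = f t₀ ^ 2 := fun t ht =>
    const_of_hasDerivAt_zero (g := fun t => f t ^ 2) hJ hJc (fun s hs => by
      have d1 := (hdf s hs).fun_pow 2
      refine d1.congr_deriv ?_
      have := hprod s hs
      simp only [Nat.cast_ofNat, Nat.add_one_sub_one, pow_one]
      linarith) ht ht₀
  have hfne : ∀ t ∈ J, f t ≠ 0 := by
    intro t ht h0
    have := hfsq t ht
    rw [h0] at this
    exact hft₀ (by simpa using this.symm)
  have hfc : ∀ t ∈ J, f t = f t₀ := fun t ht =>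
    const_of_hasDerivAt_zero hJ hJc (fun s hs => (hdf s hs).congr_deriv
      ((mul_eq_zero.mp (hprod s hs)).resolve_left (hfne s hs))) ht ht₀
  have hκ₂c : ∀ t ∈ J, κ₂ t = κ₂ t₀ := by
    intro t ht
    have e1 := (hfre t ht).1
    have e2 := (hfre t₀ ht₀).1
    have e3 := hfsq t ht
    simp only [hf] at e3
    rw [e3, ← e2] at e1
    exact (pow_left_inj₀ (h.nonneg₂ t ht) (h.nonneg₂ t₀ ht₀) two_ne_zero).mp (by linarith)
  have hdκ0 : ∀ t ∈ J, deriv κ₂ t = 0 := by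
    intro t ht
    have : κ₂ =ᶠ[𝓝 t] fun _ => κ₂ t₀ := Filter.eventually_of_mem (hJ.mem_nhds ht) hκ₂c
    rw [this.deriv_eq, deriv_const]
  -- Once f is constant, not being identically 1 or −1 excludes these values altogether.
  have hne1 : f t₀ ^ 2 ≠ 1 := by
    intro hsq
    rcases sq_eq_sq_iff_eq_or_eq_neg.mp (hsq.trans (one_pow 2).symm) with h2 | h2
    · exact h1 fun t ht => (hfc t ht).trans h2
    · exact h1' fun t ht => (hfc t ht).trans h2
  set a : ℝ := 3 * (c - 1) / 4 * f t₀ with ha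
  have ha0 : a ≠ 0 := mul_ne_zero (by positivity) hft₀
  -- Solving the vector equation for φT, whose coefficient a is nonzero. The E₃-term is gone since
  -- κ₂' = 0, and the E₂-coefficient equals −a f by the E₂-equation.
  have hvec : ∀ t ∈ J, S.φ (γ t) (velocity 𝓘(ℝ, E) γ t) =
      f t₀ • E₂ t + (-(κ₂ t₀ * κ₃ t / a)) • E₄ t := by
    intro t ht
    have e1 := (h.eulerLagrange_eq_zero_iff hcov hS hJ hL hδ hK.ne' hκ ht).mp (hEL t ht)
    have e2 := (hfre t ht).1
    have e3 : (inner ℝ (S.φ (γ t) (velocity 𝓘(ℝ, E) γ t)) (E₂ t) : ℝ) = f t₀ := hfc t ht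
    rw [e3] at e1 e2
    have e4 : (c + 3) / 4 - δ₁ / δ₂ - K ^ 2 - κ₂ t ^ 2 = -(a * f t₀) := by
      rw [ha]
      linarith
    rw [e4, hdκ0 t ht, hκ₂c t ht, ← ha] at e1
    have e5 : a • S.φ (γ t) (velocity 𝓘(ℝ, E) γ t) =
        a • (f t₀ • E₂ t + (-(κ₂ t₀ * κ₃ t / a)) • E₄ t) := by
      have e6 : a * -(κ₂ t₀ * κ₃ t / a) = -(κ₂ t₀ * κ₃ t) := by field_simp
      rw [smul_add, smul_smul, smul_smul, e6, ← sub_eq_zero, ← e1]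
      module
    exact smul_right_injective _ ha0 e5
  have hnorm : ∀ t ∈ J, f t₀ ^ 2 + (-(κ₂ t₀ * κ₃ t / a)) ^ 2 * inner ℝ (E₄ t) (E₄ t) = 1 := by
    intro t ht
    have e1 := S.metric_φ (γ t) (velocity 𝓘(ℝ, E) γ t) (velocity 𝓘(ℝ, E) γ t)
    rw [hL t ht, h.inner₁₁ t ht, hvec t ht] at e1
    simp only [inner_add_left, inner_add_right, inner_smul_left, inner_smul_right,
      real_inner_comm (E₂ t) (E₄ t), h.inner₂₂ t ht, h.inner₂₄ t ht, RCLike.conj_to_real] at e1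
    linarith
  -- If E₄ were zero, |φT| = 1 would give f² = 1. The same argument below shows that κ₂ and κ₃ do
  -- not vanish.
  have h4 : ∀ t ∈ J, inner ℝ (E₄ t) (E₄ t) = (1 : ℝ) := by
    rcases h.four with h4 | h4
    · exact h4
    · have := hnorm t₀ ht₀
      rw [(h4 t₀ ht₀).2, inner_zero_left, mul_zero, add_zero] at this
      exact absurd this hne1
  have hnorm' : ∀ t ∈ J, f t₀ ^ 2 + (-(κ₂ t₀ * κ₃ t / a)) ^ 2 = 1 := by
    intro t ht
    have := hnorm t ht
    rwa [h4 t ht, mul_one] at this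
  have hpos : κ₂ t₀ ≠ 0 ∧ κ₃ t₀ ≠ 0 := by
    constructor
    all_goals
      intro h2
      have := hnorm' t₀ ht₀
      rw [h2] at this
      simp only [zero_mul, mul_zero, zero_div, neg_zero] at this
      exact hne1 (by linarith)
  have hκ₃c : ∀ t ∈ J, κ₃ t = κ₃ t₀ := by
    intro t ht
    have e1 := hnorm' t ht
    rw [← hnorm' t₀ ht₀] at e1
    have e2 : (κ₂ t₀ / a) ^ 2 * κ₃ t ^ 2 = (κ₂ t₀ / a) ^ 2 * κ₃ t₀ ^ 2 := by
      linear_combination e1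
    have e3 := mul_left_cancel₀ (pow_ne_zero 2 (div_ne_zero hpos.1 ha0)) e2
    exact (pow_left_inj₀ (h.nonneg₃ t ht) (h.nonneg₃ t₀ ht₀) two_ne_zero).mp e3
  refine ⟨f t₀, -(κ₂ t₀ * κ₃ t₀ / a), κ₂ t₀, κ₃ t₀, hft₀, hnorm' t₀ ht₀,
    lt_of_le_of_ne (h.nonneg₂ t₀ ht₀) (Ne.symm hpos.1),
    lt_of_le_of_ne (h.nonneg₃ t₀ ht₀) (Ne.symm hpos.2), fun t ht => ⟨hκ₂c t ht, hκ₃c t ht, ?_⟩,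
    (hfre t₀ ht₀).1, ?_⟩
  · rw [hvec t ht, hκ₃c t ht]
  · have : 3 * (c - 1) / 4 * (f t₀ * -(κ₂ t₀ * κ₃ t₀ / a)) = -(κ₂ t₀ * κ₃ t₀) * (a / a) := by
      rw [ha]
      ring
    rw [this, div_self ha0]
    ring

end IsFrenetQuadruple

end Frenet

end SesquiHarmonic

namespace SesquiHarmonic

/-! ### The classification of Legendre curves -/

section Main

variable {E : Type*} [NormedAddCommGroup E] [NormedSpace ℝ E] [FiniteDimensional ℝ E]
  {M : Type*} [TopologicalSpace M] [ChartedSpace E M] [IsManifold 𝓘(ℝ, E) ∞ M]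
  [RiemannianBundle (fun x : M => TangentSpace 𝓘(ℝ, E) x)]
  [IsContMDiffRiemannianBundle 𝓘(ℝ, E) ∞ E (fun x : M => TangentSpace 𝓘(ℝ, E) x)]
  {cov : CovariantDerivative 𝓘(ℝ, E) E (TangentSpace 𝓘(ℝ, E) : M → Type _)}
  {J : Set ℝ} {γ : ℝ → M} {S : AlmostContactMetric 𝓘(ℝ, E) M} {c : ℝ}

/-- The first four vectors of a Frenet frame, continued by zero. -/
lemma IsFrenetCurveOn.isFrenetQuadruple {r : ℕ} {F : ℕ → Π t : ℝ, TangentSpace 𝓘(ℝ, E) (γ t)}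
    {k : ℕ → ℝ → ℝ} (h : IsFrenetCurveOn cov J γ r F k) (hcov : IsLeviCivita cov) (hJ : IsOpen J)
    (hr : 2 ≤ r) :
    IsFrenetQuadruple cov J γ (F 2) (if 3 ≤ r then F 3 else fun _ => 0)
      (if 4 ≤ r then F 4 else fun _ => 0) (k 1) (if 3 ≤ r then k 2 else fun _ => 0)
      (if 4 ≤ r then k 3 else fun _ => 0) := by
  have hγ : ∀ t ∈ J, ContMDiffAt 𝓘(ℝ, ℝ) 𝓘(ℝ, E) ∞ γ t := fun t ht =>
    h.smooth.contMDiffAt (hJ.mem_nhds ht)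
  have hF : ∀ i ∈ Icc 1 r, ∀ t ∈ J, SmoothAlongAt γ (F i) t := fun i hi t ht =>
    (h.smooth_frame i hi).contMDiffAt (hJ.mem_nhds ht)
  have hk : ∀ i ∈ Ico 1 r, ∀ t ∈ J, ContDiffAt ℝ ∞ (k i) t := fun i hi t ht =>
    (h.smooth_curvature i hi).contDiffAt (hJ.mem_nhds ht)
  have horth : ∀ t ∈ J, ∀ i j, 1 ≤ i → i ≤ r → 1 ≤ j → j ≤ r →
      inner ℝ (F i t) (F j t) = if i = j then (1 : ℝ) else 0 := fun t ht i j h1 h2 h3 h4 =>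
    h.orthonormal t ht i ⟨h1, h2⟩ j ⟨h3, h4⟩
  have hv := fun t (ht : t ∈ J) => (h.frame_one t ht).symm
  have horth₁ : ∀ t ∈ J, ∀ j, 1 ≤ j → j ≤ r →
      inner ℝ (velocity 𝓘(ℝ, E) γ t) (F j t) = if 1 = j then (1 : ℝ) else 0 := by
    intro t ht j h1 h2
    rw [hv t ht]
    exact horth t ht 1 j le_rfl (by omega) h1 h2
  have hD := h.frenet
  constructor
  · exact hγ
  · exact hF 2 ⟨by omega, hr⟩
  · intro t ht
    split_ifs with h3
    · exact hF 3 ⟨by omega, h3⟩ t ht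
    · exact smoothAlongAt_zero (hγ t ht)
  · exact hk 1 ⟨le_rfl, by omega⟩
  · intro t ht
    split_ifs with h3
    · exact hk 2 ⟨by omega, by omega⟩ t ht
    · exact contDiffAt_const
  · exact h.curvature_nonneg 1 ⟨le_rfl, by omega⟩
  · intro t ht
    split_ifs with h3
    · exact h.curvature_nonneg 2 ⟨by omega, by omega⟩ t ht
    · exact le_rfl
  · intro t ht
    split_ifs with h3
    · exact h.curvature_nonneg 3 ⟨by omega, by omega⟩ t ht
    · exact le_rfl
  · intro t ht
    have e1 := hD t ht 1 ⟨le_rfl, by omega⟩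
    rw [covDerivAlong_congr (Filter.eventually_of_mem (hJ.mem_nhds ht) h.frame_one)] at e1
    rw [tension, e1, if_pos rfl, if_neg (by omega), zero_add]
  · intro t ht
    rw [hD t ht 2 ⟨by omega, hr⟩, if_neg (by omega), hv t ht]
    by_cases h3 : 3 ≤ r
    · rw [if_neg (by omega), if_pos h3, if_pos h3]
    · rw [if_pos (by omega), if_neg h3, if_neg h3, zero_smul]
  · intro t ht
    by_cases h3 : 3 ≤ r
    · rw [if_pos h3, if_pos h3, hD t ht 3 ⟨by omega, h3⟩, if_neg (by omega)]
      by_cases h4 : 4 ≤ r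
      · rw [if_neg (by omega), if_pos h4, if_pos h4]
      · rw [if_pos (by omega), if_neg h4, if_neg h4, zero_smul]
    · rw [if_neg h3, if_neg h3, if_neg (by omega), if_neg (by omega)]
      have e1 : covDerivAlong cov γ (fun _ => 0) t =
          covDerivAlong cov γ (fun s => (0 : ℝ) • velocity 𝓘(ℝ, E) γ s) t :=
        covDerivAlong_congr (Filter.Eventually.of_forall fun s => (zero_smul ℝ _).symm)
      rw [e1, covDerivAlong_smul hcov contDiffAt_const
        (smoothAlongAt_velocity (Filter.eventually_of_mem (hJ.mem_nhds ht) hγ))]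
      simp
  · intro t ht
    have := horth₁ t ht 1 le_rfl (by omega)
    rwa [h.frame_one t ht, if_pos rfl] at this
  · intro t ht
    rw [horth₁ t ht 2 (by omega) hr, if_neg (by omega)]
  · intro t ht
    split_ifs with h3
    · rw [horth₁ t ht 3 (by omega) h3, if_neg (by omega)]
    · exact inner_zero_right _
  · intro t ht
    split_ifs with h3
    · rw [horth₁ t ht 4 (by omega) h3, if_neg (by omega)]
    · exact inner_zero_right _
  · intro t ht
    rw [horth t ht 2 2 (by omega) hr (by omega) hr, if_pos rfl]
  · intro t ht
    split_ifs with h3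
    · rw [horth t ht 2 3 (by omega) hr (by omega) h3, if_neg (by omega)]
    · exact inner_zero_right _
  · intro t ht
    split_ifs with h3
    · rw [horth t ht 2 4 (by omega) hr (by omega) h3, if_neg (by omega)]
    · exact inner_zero_right _
  · intro t ht
    by_cases h4 : 4 ≤ r
    · rw [if_pos h4, if_pos (by omega), horth t ht 3 4 (by omega) (by omega) (by omega) h4,
        if_neg (by omega)]
    · rw [if_neg h4]
      exact inner_zero_right _
  · by_cases h3 : 3 ≤ r
    · left
      intro t ht
      rw [if_pos h3, horth t ht 3 3 (by omega) h3 (by omega) h3, if_pos rfl]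
    · right
      intro t ht
      rw [if_neg h3, if_neg h3]
      exact ⟨rfl, rfl⟩
  · by_cases h3 : 4 ≤ r
    · left
      intro t ht
      rw [if_pos h3, horth t ht 4 4 (by omega) h3 (by omega) h3, if_pos rfl]
    · right
      intro t ht
      rw [if_neg h3, if_neg h3]
      exact ⟨rfl, rfl⟩

/-- A Legendre geodesic solves the Euler-Lagrange equation. -/
lemma eulerLagrange_of_isGeodesicOn (hcov : IsLeviCivita cov) (hS : S.IsSasakianSpaceForm cov c)
    (hJ : IsOpen J) (hγ : ∀ t ∈ J, ContMDiffAt 𝓘(ℝ, ℝ) 𝓘(ℝ, E) ∞ γ t) (hL : S.IsLegendreOn γ J)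
    (hgeo : IsGeodesicOn cov γ J) (δ₁ δ₂ : ℝ) {t : ℝ} (ht : t ∈ J) :
    eulerLagrange cov δ₁ δ₂ γ t = 0 := by
  have hzero : ∀ V : Π t : ℝ, TangentSpace 𝓘(ℝ, E) (γ t), (∀ t ∈ J, V t = 0) → ∀ t ∈ J,
      covDerivAlong cov γ V t = 0 := by
    intro V hV t ht
    have e1 : covDerivAlong cov γ V t =
        covDerivAlong cov γ (fun s => (0 : ℝ) • velocity 𝓘(ℝ, E) γ s) t :=
      covDerivAlong_congr (Filter.eventually_of_mem (hJ.mem_nhds ht) fun s hs => by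
        rw [hV s hs, zero_smul])
    rw [e1, covDerivAlong_smul hcov contDiffAt_const
      (smoothAlongAt_velocity (Filter.eventually_of_mem (hJ.mem_nhds ht) hγ))]
    simp
  have hcurv : curvature cov (γ t) (0 : TangentSpace 𝓘(ℝ, E) (γ t)) (velocity 𝓘(ℝ, E) γ t)
      (velocity 𝓘(ℝ, E) γ t) = 0 := by
    refine ext_inner_right ℝ fun z => ?_
    rw [hS.inner_curvature hcov (hL t ht) (map_zero _)]
    simp
  rw [eulerLagrange, hzero _ (hzero _ hgeo) t ht, hgeo t ht, hcurv]
  simp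

/-- The argument of f + ig, shifted by 2π when negative. The coordinate axes are excluded because
neither coordinate vanishes. -/
lemma exists_angle {f g : ℝ} (hf : f ≠ 0) (hg : g ≠ 0) (hfg : f ^ 2 + g ^ 2 = 1) :
    ∃ α ∈ Ioo 0 (2 * Real.pi) \ {Real.pi / 2, Real.pi, 3 * Real.pi / 2},
      Real.cos α = f ∧ Real.sin α = g := by
  set z : ℂ := ⟨f, g⟩ with hz
  have hnorm : ‖z‖ = 1 := by
    rw [Complex.norm_eq_sqrt_sq_add_sq, hz, hfg, Real.sqrt_one]
  have hz0 : z ≠ 0 := by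
    intro h
    rw [h] at hnorm
    simp at hnorm
  have hcos : Real.cos z.arg = f := by
    rw [Complex.cos_arg hz0, hnorm, div_one]
  have hsin : Real.sin z.arg = g := by
    rw [Complex.sin_arg, hnorm, div_one]
  obtain ⟨α, hα, hcα, hsα⟩ : ∃ α ∈ Ico 0 (2 * Real.pi), Real.cos α = f ∧ Real.sin α = g := by
    rcases le_or_gt 0 z.arg with h | h
    · exact ⟨z.arg, ⟨h, by linarith [Complex.arg_le_pi z, Real.pi_pos]⟩, hcos, hsin⟩
    · exact ⟨z.arg + 2 * Real.pi, ⟨by linarith [Complex.neg_pi_lt_arg z, Real.pi_pos],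
        by linarith⟩, by rw [Real.cos_add_two_pi, hcos], by rw [Real.sin_add_two_pi, hsin]⟩
  refine ⟨α, ⟨⟨lt_of_le_of_ne hα.1 ?_, hα.2⟩, ?_⟩, hcα, hsα⟩
  · intro h
    rw [← h, Real.sin_zero] at hsα
    exact hg hsα.symm
  · rintro (h | h | h)
    · rw [h, Real.cos_pi_div_two] at hcα
      exact hf hcα.symm
    · rw [h, Real.sin_pi] at hsα
      exact hg hsα.symm
    · rw [h, show 3 * Real.pi / 2 = Real.pi / 2 + Real.pi by ring, Real.cos_add_pi,
        Real.cos_pi_div_two, neg_zero] at hcα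
      exact hf hcα.symm

/-- The characterization of interpolating sesqui-harmonic Legendre curves in Sasakian space
forms. -/
theorem isInterpolatingSesquiHarmonic_legendre (hcov : IsLeviCivita cov)
    (hS : S.IsSasakianSpaceForm cov c) (hc : c ≠ 1) (hJo : IsOpen J) (hJc : IsPreconnected J)
    {r : ℕ} {F : ℕ → Π t : ℝ, TangentSpace 𝓘(ℝ, E) (γ t)} {k : ℕ → ℝ → ℝ}
    (hγ : IsFrenetCurveOn cov J γ r F k) (hr : 2 ≤ r) (hL : S.IsLegendreOn γ J)
    (h0 : ¬ ∀ t ∈ J, inner ℝ (S.φ (γ t) (F 1 t)) (F 2 t) = (0 : ℝ))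
    (h1 : ¬ ∀ t ∈ J, inner ℝ (S.φ (γ t) (F 1 t)) (F 2 t) = (1 : ℝ))
    (h1' : ¬ ∀ t ∈ J, inner ℝ (S.φ (γ t) (F 1 t)) (F 2 t) = (-1 : ℝ))
    (δ₁ δ₂ : ℝ) (hδ : δ₂ ≠ 0) :
    (c ≤ -3 → 0 ≤ δ₁ / δ₂ →
      (IsInterpolatingSesquiHarmonic cov δ₁ δ₂ J γ ↔ IsGeodesicOn cov γ J)) ∧
    (-3 < c → δ₁ / δ₂ < 0 → ¬ IsGeodesicOn cov γ J →
      (IsInterpolatingSesquiHarmonic cov δ₁ δ₂ J γ ↔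
        4 ≤ r ∧ ∃ α₀ ∈ Ioo 0 (2 * Real.pi) \ {Real.pi / 2, Real.pi, 3 * Real.pi / 2},
          0 < c + 3 + 3 * (c - 1) * Real.cos α₀ ^ 2 - 4 * (δ₁ / δ₂) ∧
          3 * (c - 1) * Real.sin (2 * α₀) < 0 ∧
          (∀ t ∈ J, S.φ (γ t) (F 1 t) = Real.cos α₀ • F 2 t + Real.sin α₀ • F 4 t) ∧
          ∃ κ₁ κ₂ κ₃ : ℝ, 0 < κ₁ ∧ 0 < κ₂ ∧ 0 < κ₃ ∧
            (∀ t ∈ J, k 1 t = κ₁ ∧ k 2 t = κ₂ ∧ k 3 t = κ₃) ∧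
            κ₁ ^ 2 + κ₂ ^ 2 =
              (c + 3) / 4 + 3 * (c - 1) / 4 * Real.cos α₀ ^ 2 - δ₁ / δ₂ ∧
            κ₂ * κ₃ = -(3 * (c - 1) / 8) * Real.sin (2 * α₀))) := by
  have hsm : ∀ t ∈ J, ContMDiffAt 𝓘(ℝ, ℝ) 𝓘(ℝ, E) ∞ γ t := fun t ht =>
    hγ.smooth.contMDiffAt (hJo.mem_nhds ht)
  have hQ := hγ.isFrenetQuadruple hcov hJo hr
  rw [isInterpolatingSesquiHarmonic_iff hcov hJo hγ.smooth]
  have hfr : ∀ a : ℝ, (¬ ∀ t ∈ J, inner ℝ (S.φ (γ t) (F 1 t)) (F 2 t) = a) →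
      ¬ ∀ t ∈ J, inner ℝ (S.φ (γ t) (velocity 𝓘(ℝ, E) γ t)) (F 2 t) = a := by
    intro a ha hcon
    refine ha fun t ht => ?_
    rw [hγ.frame_one t ht]
    exact hcon t ht
  have hcase : (∀ t ∈ J, eulerLagrange cov δ₁ δ₂ γ t = 0) → ¬ IsGeodesicOn cov γ J →
      ∃ K > 0, ∀ t ∈ J, k 1 t = K := by
    intro hEL hgeo
    obtain ⟨t₀, ht₀, hne⟩ : ∃ t₀ ∈ J, tension cov γ t₀ ≠ 0 := by
      by_contra! hcon
      exact hgeo hcon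
    refine ⟨k 1 t₀, lt_of_le_of_ne (hQ.nonneg₁ t₀ ht₀) fun h => hne ?_, fun t ht =>
      hQ.curvature_const hcov hS hJo hJc hL hδ hEL ht ht₀⟩
    rw [hQ.deriv₁ t₀ ht₀, ← h, zero_smul]
  refine ⟨fun hc3 hneg => ⟨fun hEL => ?_, fun hgeo t ht =>
    eulerLagrange_of_isGeodesicOn hcov hS hJo hsm hL hgeo δ₁ δ₂ ht⟩,
    fun _ _ hgeo => ⟨fun hEL => ?_, ?_⟩⟩
  · by_contra hgeo
    obtain ⟨K, hK, hκ⟩ := hcase hEL hgeo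
    obtain ⟨f, g, K₂, K₃, -, -, -, -, -, hsq, -⟩ := hQ.structure_of_eulerLagrange hcov hS hc hJo hJc
      hL (hfr 0 h0) (hfr 1 h1) (hfr (-1) h1') hδ hK hκ hEL
    -- With c ≤ −3 and δ₁/δ₂ ≥ 0 every term on the right of `hsq` is nonpositive, while K² > 0.
    nlinarith [sq_nonneg K₂, sq_nonneg f, pow_pos hK 2]
  · obtain ⟨K, hK, hκ⟩ := hcase hEL hgeo
    obtain ⟨f, g, K₂, K₃, hf, hfg, hK₂, hK₃, hall, hsq, hprod⟩ :=
      hQ.structure_of_eulerLagrange hcov hS hc hJo hJc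
        hL (hfr 0 h0) (hfr 1 h1) (hfr (-1) h1') hδ hK hκ hEL
    obtain ⟨t₀, ht₀⟩ : J.Nonempty := by
      by_contra hcon
      exact h0 fun t ht => absurd ⟨t, ht⟩ hcon
    -- For smaller r the third curvature was continued by zero, contrary to K₃ > 0.
    have hr4 : 4 ≤ r := by
      by_contra hr4
      have := (hall t₀ ht₀).2.1
      rw [if_neg hr4] at this
      exact hK₃.ne this
    have hg : g ≠ 0 := by
      intro hg
      rw [hg, mul_zero, mul_zero, neg_zero] at hprod
      exact (mul_pos hK₂ hK₃).ne' hprod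
    obtain ⟨α, hα, hcα, hsα⟩ := exists_angle hf hg hfg
    simp only [if_pos hr4, if_pos (show 3 ≤ r by omega)] at hall
    have hs2 : Real.sin (2 * α) = 2 * (f * g) := by
      rw [Real.sin_two_mul, hcα, hsα]
      ring
    refine ⟨hr4, α, hα, ?_, ?_, ?_, K, K₂, K₃, hK, hK₂, hK₃, fun t ht =>
      ⟨hκ t ht, (hall t ht).1, (hall t ht).2.1⟩, ?_, ?_⟩
    · rw [hcα]
      -- The expression is 4(K² + K₂²).
      nlinarith [pow_pos hK 2, pow_pos hK₂ 2]
    · rw [hs2]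
      -- By the formula for K₂K₃ the expression is −8K₂K₃.
      nlinarith [mul_pos hK₂ hK₃]
    · intro t ht
      rw [hcα, hsα, hγ.frame_one t ht]
      exact (hall t ht).2.2
    · rw [hcα]
      exact hsq
    · rw [hs2, hprod]
      ring
  · rintro ⟨hr4, α, -, -, -, hφ, K, K₂, K₃, hK, -, -, hall, hsq, hprod⟩ t ht
    have hr3 : 3 ≤ r := by omega
    rw [hQ.eulerLagrange_eq_zero_iff hcov hS hJo hL hδ hK.ne' (fun t ht => (hall t ht).1) ht]
    simp only [if_pos hr4, if_pos hr3]
    have hd : deriv (k 2) t = 0 := by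
      have : k 2 =ᶠ[𝓝 t] fun _ => K₂ :=
        Filter.eventually_of_mem (hJo.mem_nhds ht) fun s hs => (hall s hs).2.1
      rw [this.deriv_eq, deriv_const]
    have hφt := hφ t ht
    rw [hγ.frame_one t ht] at hφt
    have h22 := hQ.inner₂₂ t ht
    have h24 := hQ.inner₂₄ t ht
    rw [if_pos hr4] at h24
    have hf : inner ℝ (S.φ (γ t) (velocity 𝓘(ℝ, E) γ t)) (F 2 t) = Real.cos α := by
      rw [hφt, inner_add_left, inner_smul_left, inner_smul_left, h22,
        real_inner_comm (F 2 t) (F 4 t), h24]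
      simp
    rw [hf, hd, (hall t ht).2.1, (hall t ht).2.2, hprod, hφt, Real.sin_two_mul]
    -- With φT = cos α E₂ + sin α E₄, the E₂-coefficients cancel by the formula for K² + K₂², and
    -- the E₄-coefficients by the one for K₂K₃.
    have e1 : (c + 3) / 4 - δ₁ / δ₂ - K ^ 2 - K₂ ^ 2 = -(3 * (c - 1) / 4 * Real.cos α ^ 2) := by
      linarith
    rw [e1]
    module

end Main

end SesquiHarmonic

end

/-- `𝓡 (2 * n + 1)` is notation for the trivial model on Euclidean space, so the result for a
general finite-dimensional model space applies directly. -/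
theorem mainTheorem9 (n : ℕ) (hn : 2 ≤ n)
    {M : Type*} [TopologicalSpace M] [T2Space M] [SecondCountableTopology M]
    [ChartedSpace (EuclideanSpace ℝ (Fin (2 * n + 1))) M] [IsManifold (𝓡 (2 * n + 1)) ∞ M]
    [RiemannianBundle (fun x : M => TangentSpace (𝓡 (2 * n + 1)) x)]
    [IsContMDiffRiemannianBundle (𝓡 (2 * n + 1)) ∞ (EuclideanSpace ℝ (Fin (2 * n + 1)))
      (fun x : M => TangentSpace (𝓡 (2 * n + 1)) x)]
    (cov : CovariantDerivative (𝓡 (2 * n + 1)) (EuclideanSpace ℝ (Fin (2 * n + 1)))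
      (TangentSpace (𝓡 (2 * n + 1)) : M → Type _))
    (hcov : SesquiHarmonic.IsLeviCivita cov)
    (S : SesquiHarmonic.AlmostContactMetric (𝓡 (2 * n + 1)) M)
    (c : ℝ) (hS : S.IsSasakianSpaceForm cov c) (hc : c ≠ 1)
    (J : Set ℝ) (hJo : IsOpen J) (hJc : IsPreconnected J) (γ : ℝ → M)
    (r : ℕ) (F : ℕ → Π t : ℝ, TangentSpace (𝓡 (2 * n + 1)) (γ t)) (k : ℕ → ℝ → ℝ)
    (hγ : SesquiHarmonic.IsFrenetCurveOn cov J γ r F k) (hr : 2 ≤ r)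
    (hL : S.IsLegendreOn γ J)
    (h0 : ¬ ∀ t ∈ J, inner ℝ (S.φ (γ t) (F 1 t)) (F 2 t) = 0)
    (h1 : ¬ ∀ t ∈ J, inner ℝ (S.φ (γ t) (F 1 t)) (F 2 t) = 1)
    (h1' : ¬ ∀ t ∈ J, inner ℝ (S.φ (γ t) (F 1 t)) (F 2 t) = -1)
    (δ₁ δ₂ : ℝ) (hδ : δ₂ ≠ 0) :
    (c ≤ -3 → 0 ≤ δ₁ / δ₂ →
      (SesquiHarmonic.IsInterpolatingSesquiHarmonic cov δ₁ δ₂ J γ ↔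
        SesquiHarmonic.IsGeodesicOn cov γ J)) ∧
    (-3 < c → δ₁ / δ₂ < 0 → ¬ SesquiHarmonic.IsGeodesicOn cov γ J →
      (SesquiHarmonic.IsInterpolatingSesquiHarmonic cov δ₁ δ₂ J γ ↔
        4 ≤ r ∧ ∃ α₀ ∈ Ioo 0 (2 * Real.pi) \ {Real.pi / 2, Real.pi, 3 * Real.pi / 2},
          0 < c + 3 + 3 * (c - 1) * Real.cos α₀ ^ 2 - 4 * (δ₁ / δ₂) ∧
          3 * (c - 1) * Real.sin (2 * α₀) < 0 ∧
          (∀ t ∈ J, S.φ (γ t) (F 1 t) = Real.cos α₀ • F 2 t + Real.sin α₀ • F 4 t) ∧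
          ∃ κ₁ κ₂ κ₃ : ℝ, 0 < κ₁ ∧ 0 < κ₂ ∧ 0 < κ₃ ∧
            (∀ t ∈ J, k 1 t = κ₁ ∧ k 2 t = κ₂ ∧ k 3 t = κ₃) ∧
            κ₁ ^ 2 + κ₂ ^ 2 =
              (c + 3) / 4 + 3 * (c - 1) / 4 * Real.cos α₀ ^ 2 - δ₁ / δ₂ ∧
            κ₂ * κ₃ = -(3 * (c - 1) / 8) * Real.sin (2 * α₀))) :=
  SesquiHarmonic.isInterpolatingSesquiHarmonic_legendre hcov hS hc hJo hJc hγ hr hL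
    h0 h1 h1' δ₁ δ₂ hδ
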